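/- **Theorem ((−ε)-Cartan structures and pseudo-Riemannian surfaces).** Let $\epsilon\in\{1,-1\}$. A *bi-contact structure* on a smooth 3-manifold $M$ is a pair $(\omega^1,\omega^2)$ of smooth contact forms (so $\omega^i\wedge d\omega^i$ vanishes nowhere) with $\ker\omega^1_p\neq\ker\omega^2_p$ for every $p\in M$. It is called a *$(-\epsilon)$-Cartan structure* if it is normalized by $\omega^1\wedge d\omega^1=-\epsilon\,\omega^2\wedge d\omega^2$ and satisfies $$\omega^1\wedge d\omega^2=\omega^2\wedge d\omega^1=0 .$$ A *bi-contactomorphism* is a diffeomorphism whose differential maps the first contact distribution onto the first and the second onto the second. For a smooth pseudo-Riemannian surface $(\Sigma,g)$ of signature $(1,-\epsilon)$ (Riemannian if $\epsilon=-1$, Lorentzian if $\epsilon=1$), let $\pi:\mathcal F\Sigma\to\Sigma$ be the 3-manifold of all frames $(e_1,e_2)$ with $g(e_1,e_1)=1$, $g(e_1,e_2)=0$, $g(e_2,e_2)=-\epsilon$, and let $\theta^1,\theta^2$ be its solder forms, i.e. $\theta^1(V),\theta^2(V)$ are the components of $d\pi(V)$ in the frame at which $V$ is based. Let $K_\Sigma=\dfrac{g(R(X,Y)Y,X)}{g(X,X)g(Y,Y)-g(X,Y)^2}$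 be the Gauss (sectional) curvature. 1. Let $(M,\omega^1,\omega^2)$ be a $(-\epsilon)$-Cartan structure. There is a unique 1-form $\omega^3$ on $M$ with $d\omega^1=\omega^2\wedge\omega^3$ and $d\omega^2=\epsilon\,\omega^1\wedge\omega^3$; the triple $(\omega^1,\omega^2,\omega^3)$ is a smooth coframe, and there is a smooth function $K$ on $M$ such that $$d\omega^1=\omega^2\wedge\omega^3,\qquad d\omega^2=\epsilon\,\omega^1\wedge\omega^3,\qquad d\omega^3=K\,\omega^1\wedge\omega^2 .$$ Moreover, $(M,\omega^1,\omega^2)$ is locally bi-contactomorphic to an orthonormal frame bundle: for every $p\in M$ there are a pseudo-Riemannian surface $(\Sigma,g)$ of signature $(1,-\epsilon)$ and a bi-contactomorphism $\Phi$ from an open neighbourhood of $p$ onto an open subset of $(\mathcal F\Sigma,\theta^1,\theta^2)$; $\Phi$ can be chosen so that $\Phi^*\theta^1=\omega^1$, $\Phi^*\theta^2=\omega^2$, and then $K=-\epsilon\,K_\Sigma\circ\pi\circ\Phi$. So $K$ is the Gauss curvature of $\Sigma$ in the Riemannian case, and the Gauss curvature with the opposite sign (equivalently, the Gauss curvature of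 $-g$) in the Lorentzian case. 2. Conversely, for every pseudo-Riemannian surface $(\Sigma,g)$ of signature $(1,-\epsilon)$, the solder forms $(\theta^1,\theta^2)$ are a $(-\epsilon)$-Cartan structure on $\mathcal F\Sigma$ with $\pi^*g=(\theta^1)^2-\epsilon(\theta^2)^2$. There is a unique 1-form $\theta^3$ on $\mathcal F\Sigma$ with $d\theta^1=\theta^2\wedge\theta^3$ and $d\theta^2=\epsilon\,\theta^1\wedge\theta^3$; the triple $(\theta^1,\theta^2,\theta^3)$ is a smooth coframe, and $d\theta^3=K\,\theta^1\wedge\theta^2$ with $K=-\epsilon\,K_\Sigma\circ\pi$ smooth. -/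

import Mathlib

open scoped Manifold ContDiff

noncomputable section

open Set Bundle

namespace BiContact

/-! ### One-forms, exterior derivative and wedge products on a manifold -/

section Forms

variable {E : Type*} [NormedAddCommGroup E] [NormedSpace ℝ E]
  {M : Type*} [TopologicalSpace M] [ChartedSpace E M]

/-- A (not necessarily smooth) 1-form on the manifold `M` modelled on `E`. -/
abbrev OneForm (E : Type*) [NormedAddCommGroup E] [NormedSpace ℝ E]
    (M : Type*) [TopologicalSpace M] [ChartedSpace E M] :=
  ∀ x : M, TangentSpace 𝓘(ℝ, E) x →L[ℝ] ℝ

/-- A family of functions of two tangent vectors; all those below are alternating bilinear. -/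
abbrev TwoForm (E : Type*) [NormedAddCommGroup E] [NormedSpace ℝ E]
    (M : Type*) [TopologicalSpace M] [ChartedSpace E M] :=
  ∀ x : M, TangentSpace 𝓘(ℝ, E) x → TangentSpace 𝓘(ℝ, E) x → ℝ

/-- A family of functions of three tangent vectors; all those below are alternating trilinear. -/
abbrev ThreeForm (E : Type*) [NormedAddCommGroup E] [NormedSpace ℝ E]
    (M : Type*) [TopologicalSpace M] [ChartedSpace E M] :=
  ∀ x : M, TangentSpace 𝓘(ℝ, E) x → TangentSpace 𝓘(ℝ, E) x → TangentSpace 𝓘(ℝ, E) x → ℝ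

/-- Smoothness of a 1-form, as a section of the cotangent bundle. -/
def OneForm.IsSmooth [IsManifold 𝓘(ℝ, E) ∞ M] (η : OneForm E M) : Prop :=
  ContMDiff 𝓘(ℝ, E) (𝓘(ℝ, E).prod 𝓘(ℝ, E →L[ℝ] ℝ)) ∞
    (fun x => TotalSpace.mk' (E →L[ℝ] ℝ)
      (E := fun x : M => TangentSpace 𝓘(ℝ, E) x →L[ℝ] ℝ) x (η x))

/-- The 1-form `η` read in the preferred chart at `x₀`. -/
def OneForm.inChart (η : OneForm E M) (x₀ : M) (y : E) : E →L[ℝ] ℝ :=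
  (η ((extChartAt 𝓘(ℝ, E) x₀).symm y)).comp
    (mfderiv 𝓘(ℝ, E) 𝓘(ℝ, E) (extChartAt 𝓘(ℝ, E) x₀).symm y)

/-- The exterior derivative of a 1-form. At `x` it is computed in the preferred chart at `x`, through
which Mathlib identifies `TangentSpace 𝓘(ℝ, E) x` with `E`. -/
def OneForm.d (η : OneForm E M) : TwoForm E M := fun x (v w : E) =>
  fderiv ℝ (η.inChart x) (extChartAt 𝓘(ℝ, E) x x) v w
    - fderiv ℝ (η.inChart x) (extChartAt 𝓘(ℝ, E) x x) w v

/-- The wedge product of two 1-forms. -/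
def wedge (α β : OneForm E M) : TwoForm E M := fun x v w => α x v * β x w - α x w * β x v

/-- The wedge product of a 1-form and a 2-form. -/
def wedge₁₂ (α : OneForm E M) (β : TwoForm E M) : ThreeForm E M := fun x u v w =>
  α x u * β x v w - α x v * β x u w + α x w * β x u v

/-- The sign `ε = ±1` as a real number. -/
def sgn (ε : ℤˣ) : ℝ := ((ε : ℤ) : ℝ)

theorem sgn_mul_self (ε : ℤˣ) : sgn ε * sgn ε = 1 := by
  rcases Int.units_eq_one_or ε with rfl | rfl <;> norm_num [sgn]

/-- A contact form on a 3-manifold: `η ∧ dη` vanishes nowhere. -/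
def IsContactForm (η : OneForm E M) : Prop := ∀ x, wedge₁₂ η η.d x ≠ 0

/-- A bi-contact structure given by two forms: smooth contact forms on a 3-manifold whose contact
distributions differ at each point. -/
structure IsBiContact [IsManifold 𝓘(ℝ, E) ∞ M] (ω₁ ω₂ : OneForm E M) : Prop where
  smooth₁ : ω₁.IsSmooth
  smooth₂ : ω₂.IsSmooth
  contact₁ : IsContactForm ω₁
  contact₂ : IsContactForm ω₂
  ker_ne : ∀ x, (ω₁ x).ker ≠ (ω₂ x).ker

/-- A `(-ε)`-Cartan structure: a bi-contact structure, normalised by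
`ω¹ ∧ dω¹ = -ε ω² ∧ dω²`, with `ω¹ ∧ dω² = ω² ∧ dω¹ = 0`. -/
structure IsCartan [IsManifold 𝓘(ℝ, E) ∞ M] (ε : ℤˣ) (ω₁ ω₂ : OneForm E M) : Prop
    extends IsBiContact ω₁ ω₂ where
  normalized : wedge₁₂ ω₁ ω₁.d = -sgn ε • wedge₁₂ ω₂ ω₂.d
  wedge_d₁₂ : wedge₁₂ ω₁ ω₂.d = 0
  wedge_d₂₁ : wedge₁₂ ω₂ ω₁.d = 0

/-- `(ω¹, ω², ω³)` is a smooth coframe. -/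
structure IsCoframe [IsManifold 𝓘(ℝ, E) ∞ M] (ω₁ ω₂ ω₃ : OneForm E M) : Prop where
  smooth₁ : ω₁.IsSmooth
  smooth₂ : ω₂.IsSmooth
  smooth₃ : ω₃.IsSmooth
  nondeg : ∀ x, wedge₁₂ ω₁ (wedge ω₂ ω₃) x ≠ 0

/-- The first two structure equations, `dω¹ = ω² ∧ ω³` and `dω² = ε ω¹ ∧ ω³`, which say that `ω³`
is adapted to `(ω¹, ω²)`. -/
def IsAdapted (ε : ℤˣ) (ω₁ ω₂ ω₃ : OneForm E M) : Prop :=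
  ω₁.d = wedge ω₂ ω₃ ∧ ω₂.d = sgn ε • wedge ω₁ ω₃

/-- The adapted structure equations `dω¹ = ω² ∧ ω³`, `dω² = ε ω¹ ∧ ω³`, `dω³ = K ω¹ ∧ ω²` with the
smooth function `K`: there is a unique 1-form `ω³` satisfying the first two, `(ω¹, ω², ω³)` is a
smooth coframe, and the third equation holds. -/
def HasStructureEquations [IsManifold 𝓘(ℝ, E) ∞ M] (ε : ℤˣ) (ω₁ ω₂ : OneForm E M)
    (K : M → ℝ) : Prop :=
  ContMDiff 𝓘(ℝ, E) 𝓘(ℝ, ℝ) ∞ K ∧ ∃ ω₃ : OneForm E M, IsCoframe ω₁ ω₂ ω₃ ∧ IsAdapted ε ω₁ ω₂ ω₃ ∧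
    (∀ x, ω₃.d x = K x • wedge ω₁ ω₂ x) ∧ ∀ η : OneForm E M, IsAdapted ε ω₁ ω₂ η → η = ω₃

variable {E' : Type*} [NormedAddCommGroup E'] [NormedSpace ℝ E']
  {N : Type*} [TopologicalSpace N] [ChartedSpace E' N]

/-- The pullback of a 1-form under a map; meaningful where the map is differentiable. -/
def pullback (f : M → N) (θ : OneForm E' N) : OneForm E M := fun x =>
  (θ (f x)).comp (mfderiv 𝓘(ℝ, E) 𝓘(ℝ, E') f x)

/-- `Φ`, a diffeomorphism from an open subset of `M` onto an open subset of `N`, is a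
bi-contactomorphism: its differential maps the contact distributions `ker ω¹`, `ker ω²` onto
`ker θ¹`, `ker θ²`. -/
def IsBiContactomorphism (Φ : PartialDiffeomorph 𝓘(ℝ, E) 𝓘(ℝ, E') M N ∞)
    (ω₁ ω₂ : OneForm E M) (θ₁ θ₂ : OneForm E' N) : Prop :=
  ∀ x ∈ Φ.source,
    (ω₁ x).ker.map (mfderiv 𝓘(ℝ, E) 𝓘(ℝ, E') Φ x).toLinearMap = (θ₁ (Φ x)).ker ∧
    (ω₂ x).ker.map (mfderiv 𝓘(ℝ, E) 𝓘(ℝ, E') Φ x).toLinearMap = (θ₂ (Φ x)).ker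

end Forms

/-! ### Pseudo-Riemannian surfaces -/

/-- The model space of surfaces. -/
abbrev E2 := EuclideanSpace ℝ (Fin 2)

/-- A smooth pseudo-Riemannian metric of signature `(1, -ε)` on a surface: Riemannian for `ε = -1`,
Lorentzian for `ε = 1`. -/
structure SurfaceMetric (ε : ℤˣ) (S : Type*) [TopologicalSpace S] [ChartedSpace E2 S]
    [IsManifold 𝓘(ℝ, E2) ∞ S] where
  inner (x : S) : TangentSpace 𝓘(ℝ, E2) x →L[ℝ] TangentSpace 𝓘(ℝ, E2) x →L[ℝ] ℝ
  symm (x : S) (v w : TangentSpace 𝓘(ℝ, E2) x) : inner x v w = inner x w v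
  signature (x : S) : ∃ v w : TangentSpace 𝓘(ℝ, E2) x,
    inner x v v = 1 ∧ inner x v w = 0 ∧ inner x w w = -sgn ε
  smooth : ContMDiff 𝓘(ℝ, E2) (𝓘(ℝ, E2).prod 𝓘(ℝ, E2 →L[ℝ] E2 →L[ℝ] ℝ)) ∞
    (fun x => TotalSpace.mk' (E2 →L[ℝ] E2 →L[ℝ] ℝ)
      (E := fun x : S => TangentSpace 𝓘(ℝ, E2) x →L[ℝ] TangentSpace 𝓘(ℝ, E2) x →L[ℝ] ℝ)
      x (inner x))

variable {ε : ℤˣ} {S : Type*} [TopologicalSpace S] [ChartedSpace E2 S]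
  [IsManifold 𝓘(ℝ, E2) ∞ S]

/-- The standard basis of the model space. -/
def stdVec (i : Fin 2) : E2 := EuclideanSpace.single i 1

/-- The matrix `(g_{ij})` of the metric in the preferred chart at `x₀`. -/
def SurfaceMetric.matrix (g : SurfaceMetric ε S) (x₀ : S) (y : E2) : Matrix (Fin 2) (Fin 2) ℝ :=
  Matrix.of fun i j =>
    g.inner ((extChartAt 𝓘(ℝ, E2) x₀).symm y)
      (mfderiv 𝓘(ℝ, E2) 𝓘(ℝ, E2) (extChartAt 𝓘(ℝ, E2) x₀).symm y (stdVec i))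
      (mfderiv 𝓘(ℝ, E2) 𝓘(ℝ, E2) (extChartAt 𝓘(ℝ, E2) x₀).symm y (stdVec j))

/-- The `i`-th partial derivative. -/
def partialD (i : Fin 2) (f : E2 → ℝ) (y : E2) : ℝ := fderiv ℝ f y (stdVec i)

/-- The Christoffel symbols `Γ^k_{ij} = ½ g^{kl} (∂_i g_{jl} + ∂_j g_{il} - ∂_l g_{ij})` of the
Levi-Civita connection in the preferred chart at `x₀`. -/
def SurfaceMetric.christoffel (g : SurfaceMetric ε S) (x₀ : S) (k i j : Fin 2) (y : E2) : ℝ :=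
  (1 / 2) * ∑ l, (g.matrix x₀ y)⁻¹ k l *
    (partialD i (fun z => g.matrix x₀ z j l) y + partialD j (fun z => g.matrix x₀ z i l) y
      - partialD l (fun z => g.matrix x₀ z i j) y)

/-- The components `R^l_{kij}` of the Riemann tensor, `R(∂_i, ∂_j) ∂_k = R^l_{kij} ∂_l`, where
`R(X, Y) = ∇_X ∇_Y - ∇_Y ∇_X - ∇_{[X, Y]}`. -/
def SurfaceMetric.riemann (g : SurfaceMetric ε S) (x₀ : S) (l k i j : Fin 2) (y : E2) : ℝ :=
  partialD i (g.christoffel x₀ l j k) y - partialD j (g.christoffel x₀ l i k) y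
    + ∑ m, (g.christoffel x₀ l i m y * g.christoffel x₀ m j k y
      - g.christoffel x₀ l j m y * g.christoffel x₀ m i k y)

/-- The Gauss (sectional) curvature
`g(R(∂₁, ∂₂) ∂₂, ∂₁) / (g(∂₁, ∂₁) g(∂₂, ∂₂) - g(∂₁, ∂₂)²)`. -/
def SurfaceMetric.gaussCurvature (g : SurfaceMetric ε S) (x : S) : ℝ :=
  (∑ l, g.riemann x l 1 0 1 (extChartAt 𝓘(ℝ, E2) x x)
      * g.matrix x (extChartAt 𝓘(ℝ, E2) x x) l 0)
    / (g.matrix x (extChartAt 𝓘(ℝ, E2) x x)).det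

/-! ### The orthonormal frame bundle -/

/-- An orthonormal frame of the surface `(S, g)`: a point and a basis `(e₁, e₂)` of the tangent space
there with `g(e₁, e₁) = 1`, `g(e₁, e₂) = 0`, `g(e₂, e₂) = -ε`. -/
@[ext]
structure OFrame (g : SurfaceMetric ε S) where
  pt : S
  e₁ : TangentSpace 𝓘(ℝ, E2) pt
  e₂ : TangentSpace 𝓘(ℝ, E2) pt
  g₁₁ : g.inner pt e₁ e₁ = 1
  g₁₂ : g.inner pt e₁ e₂ = 0
  g₂₂ : g.inner pt e₂ e₂ = -sgn ε

/-- A smooth local orthonormal frame field, on an open set inside the domain of the preferred chart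
at the base point of the orthonormal frame `u₀`, and extending `u₀`. -/
structure LocalFrame (g : SurfaceMetric ε S) (u₀ : OFrame g) where
  U : Set S
  isOpen : IsOpen U
  subset : U ⊆ (chartAt E2 u₀.pt).source
  mem : u₀.pt ∈ U
  X₁ : ∀ x : S, TangentSpace 𝓘(ℝ, E2) x
  X₂ : ∀ x : S, TangentSpace 𝓘(ℝ, E2) x
  smooth₁ : ContMDiffOn 𝓘(ℝ, E2) (𝓘(ℝ, E2).prod 𝓘(ℝ, E2)) ∞
    (fun x => TotalSpace.mk' E2 (E := fun x : S => TangentSpace 𝓘(ℝ, E2) x) x (X₁ x)) U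
  smooth₂ : ContMDiffOn 𝓘(ℝ, E2) (𝓘(ℝ, E2).prod 𝓘(ℝ, E2)) ∞
    (fun x => TotalSpace.mk' E2 (E := fun x : S => TangentSpace 𝓘(ℝ, E2) x) x (X₂ x)) U
  g₁₁ : ∀ x ∈ U, g.inner x (X₁ x) (X₁ x) = 1
  g₁₂ : ∀ x ∈ U, g.inner x (X₁ x) (X₂ x) = 0
  g₂₂ : ∀ x ∈ U, g.inner x (X₂ x) (X₂ x) = -sgn ε
  eq₁ : X₁ u₀.pt = u₀.e₁
  eq₂ : X₂ u₀.pt = u₀.e₂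

/-- The value at a point of the pairing of two smooth local fields is smooth. -/
theorem SurfaceMetric.contMDiffOn_inner (g : SurfaceMetric ε S) {U : Set S}
    {X Y : ∀ x : S, TangentSpace 𝓘(ℝ, E2) x}
    (hX : ContMDiffOn 𝓘(ℝ, E2) (𝓘(ℝ, E2).prod 𝓘(ℝ, E2)) ∞
      (fun x => TotalSpace.mk' E2 (E := fun x : S => TangentSpace 𝓘(ℝ, E2) x) x (X x)) U)
    (hY : ContMDiffOn 𝓘(ℝ, E2) (𝓘(ℝ, E2).prod 𝓘(ℝ, E2)) ∞
      (fun x => TotalSpace.mk' E2 (E := fun x : S => TangentSpace 𝓘(ℝ, E2) x) x (Y x)) U) :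
    ContMDiffOn 𝓘(ℝ, E2) 𝓘(ℝ, ℝ) ∞ (fun x => g.inner x (X x) (Y x)) U := by
  have h := ContMDiffOn.clm_bundle_apply₂ (F₁ := E2) (F₂ := E2) (F₃ := ℝ)
    (E₁ := fun x : S => TangentSpace 𝓘(ℝ, E2) x) (E₂ := fun x : S => TangentSpace 𝓘(ℝ, E2) x)
    (E₃ := Bundle.Trivial S ℝ) (b := fun x : S => x) (ψ := fun x => g.inner x)
    (v := X) (w := Y) (s := U) g.smooth.contMDiffOn hX hY
  intro x hx
  have := h x hx
  simp only [Bundle.contMDiffWithinAt_totalSpace] at this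
  simpa using this.2

/-- A tangent vector at `x₀` extends to a smooth local field on the chart domain. -/
theorem exists_smooth_extension (x₀ : S) (v : TangentSpace 𝓘(ℝ, E2) x₀) :
    ∃ X : ∀ x : S, TangentSpace 𝓘(ℝ, E2) x, X x₀ = v ∧
      ContMDiffOn 𝓘(ℝ, E2) (𝓘(ℝ, E2).prod 𝓘(ℝ, E2)) ∞
        (fun x => TotalSpace.mk' E2 (E := fun x : S => TangentSpace 𝓘(ℝ, E2) x) x (X x))
        (chartAt E2 x₀).source := by
  set e := trivializationAt E2 (fun x : S => TangentSpace 𝓘(ℝ, E2) x) x₀ with he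
  have hb : e.baseSet = (chartAt E2 x₀).source := by
    rw [he, TangentBundle.trivializationAt_baseSet]
  refine ⟨fun x => e.symm x (e ⟨x₀, v⟩).2, ?_, ?_⟩
  · exact e.symm_apply_apply_mk (by rw [hb]; exact mem_chart_source E2 x₀) v
  · rw [← hb]
    refine (Bundle.Trivialization.contMDiffOn_section_baseSet_iff (n := ∞) e).2 ?_
    refine (contMDiffOn_const (c := (e ⟨x₀, v⟩).2)).congr fun x hx => ?_
    rw [e.apply_mk_symm hx]

/-- Smooth local orthonormal frame fields exist through each orthonormal frame (Gram-Schmidt). -/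
theorem exists_localFrame (g : SurfaceMetric ε S) (u₀ : OFrame g) :
    Nonempty (LocalFrame g u₀) := by
  obtain ⟨X₁, hX₁, sX₁⟩ := exists_smooth_extension u₀.pt u₀.e₁
  obtain ⟨X₂, hX₂, sX₂⟩ := exists_smooth_extension u₀.pt u₀.e₂
  have hε := sgn_mul_self ε
  set V := (chartAt E2 u₀.pt).source with hV
  have oV : IsOpen V := (chartAt E2 u₀.pt).open_source
  have mV : u₀.pt ∈ V := mem_chart_source E2 u₀.pt
  let a : S → ℝ := fun x => g.inner x (X₁ x) (X₁ x)
  have sa : ContMDiffOn 𝓘(ℝ, E2) 𝓘(ℝ, ℝ) ∞ a V := g.contMDiffOn_inner sX₁ sX₁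
  let W := V ∩ a ⁻¹' Ioi 0
  have oW : IsOpen W := sa.continuousOn.isOpen_inter_preimage oV isOpen_Ioi
  have a0 : a u₀.pt = 1 := by simp only [a, hX₁, u₀.g₁₁]
  have mW : u₀.pt ∈ W := ⟨mV, by simp [a0]⟩
  let r : S → ℝ := fun x => (√(a x))⁻¹
  have sr : ContMDiffOn 𝓘(ℝ, E2) 𝓘(ℝ, ℝ) ∞ r W := by
    have : ContDiffOn ℝ ∞ (fun t : ℝ => (√t)⁻¹) (Ioi 0) := by
      refine ContDiffOn.inv (ContDiffOn.sqrt contDiffOn_id fun x hx => ?_) fun x hx => ?_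
      · exact ne_of_gt hx
      · exact (Real.sqrt_pos.2 hx).ne'
    exact (this.contMDiffOn).comp (sa.mono inter_subset_left) fun x hx => hx.2
  let Y₁ : ∀ x : S, TangentSpace 𝓘(ℝ, E2) x := fun x => r x • X₁ x
  have sY₁ := ContMDiffOn.smul_section (V := fun x : S => TangentSpace 𝓘(ℝ, E2) x) sr
    (sX₁.mono (inter_subset_left : W ⊆ V))
  have hY₁ : Y₁ u₀.pt = u₀.e₁ := by simp [Y₁, r, a0, hX₁]
  have gY₁ : ∀ x ∈ W, g.inner x (Y₁ x) (Y₁ x) = 1 := by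
    intro x hx
    have h0 : 0 < a x := hx.2
    have h1 : g.inner x (Y₁ x) (Y₁ x) = r x * (r x * a x) := by simp [Y₁, a]
    rw [h1]
    have : √(a x) * √(a x) = a x := Real.mul_self_sqrt h0.le
    have h2 : √(a x) ≠ 0 := (Real.sqrt_pos.2 h0).ne'
    simp only [r]
    field_simp
    nlinarith
  let c : S → ℝ := fun x => g.inner x (X₂ x) (Y₁ x)
  have sc : ContMDiffOn 𝓘(ℝ, E2) 𝓘(ℝ, ℝ) ∞ c W :=
    g.contMDiffOn_inner (sX₂.mono inter_subset_left) sY₁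
  have c0 : c u₀.pt = 0 := by
    simp only [c, hY₁, hX₂]
    rw [g.symm, u₀.g₁₂]
  let Z : ∀ x : S, TangentSpace 𝓘(ℝ, E2) x := fun x => X₂ x - c x • Y₁ x
  have sZ := ContMDiffOn.sub_section (V := fun x : S => TangentSpace 𝓘(ℝ, E2) x)
    (sX₂.mono (inter_subset_left : W ⊆ V)) (ContMDiffOn.smul_section sc sY₁)
  have hZ : Z u₀.pt = u₀.e₂ := by simp [Z, c0, hX₂]
  have gZ : ∀ x ∈ W, g.inner x (Y₁ x) (Z x) = 0 := by
    intro x hx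
    have h1 : g.inner x (Y₁ x) (Z x)
        = g.inner x (Y₁ x) (X₂ x) - c x * g.inner x (Y₁ x) (Y₁ x) := by simp [Z]
    rw [h1, gY₁ x hx, g.symm]
    simp [c]
  let b : S → ℝ := fun x => -sgn ε * g.inner x (Z x) (Z x)
  have sb : ContMDiffOn 𝓘(ℝ, E2) 𝓘(ℝ, ℝ) ∞ b W := by
    have h := g.contMDiffOn_inner sZ sZ
    have h2 : ContDiff ℝ ∞ (fun t : ℝ => -sgn ε * t) := contDiff_const.mul contDiff_id
    exact h2.contMDiff.comp_contMDiffOn h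
  have b0 : b u₀.pt = 1 := by
    simp only [b, hZ, u₀.g₂₂]
    linarith
  let U := W ∩ b ⁻¹' Ioi 0
  have oU : IsOpen U := sb.continuousOn.isOpen_inter_preimage oW isOpen_Ioi
  have mU : u₀.pt ∈ U := ⟨mW, by simp [b0]⟩
  let q : S → ℝ := fun x => (√(b x))⁻¹
  have sq : ContMDiffOn 𝓘(ℝ, E2) 𝓘(ℝ, ℝ) ∞ q U := by
    have : ContDiffOn ℝ ∞ (fun t : ℝ => (√t)⁻¹) (Ioi 0) := by
      refine ContDiffOn.inv (ContDiffOn.sqrt contDiffOn_id fun x hx => ?_) fun x hx => ?_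
      · exact ne_of_gt hx
      · exact (Real.sqrt_pos.2 hx).ne'
    exact (this.contMDiffOn).comp (sb.mono inter_subset_left) fun x hx => hx.2
  let Y₂ : ∀ x : S, TangentSpace 𝓘(ℝ, E2) x := fun x => q x • Z x
  have sY₂ := ContMDiffOn.smul_section (V := fun x : S => TangentSpace 𝓘(ℝ, E2) x) sq
    (sZ.mono (inter_subset_left : U ⊆ W))
  refine ⟨{ U := U, isOpen := oU, subset := fun x hx => hx.1.1, mem := mU, X₁ := Y₁, X₂ := Y₂,
            smooth₁ := sY₁.mono inter_subset_left, smooth₂ := sY₂,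
            g₁₁ := fun x hx => gY₁ x hx.1, g₁₂ := ?_, g₂₂ := ?_, eq₁ := hY₁, eq₂ := ?_ }⟩
  · intro x hx
    have h1 : g.inner x (Y₁ x) (Y₂ x) = q x * g.inner x (Y₁ x) (Z x) := by simp [Y₂]
    rw [h1, gZ x hx.1, mul_zero]
  · intro x hx
    have h0 : 0 < b x := hx.2
    have h1 : g.inner x (Y₂ x) (Y₂ x) = q x * (q x * g.inner x (Z x) (Z x)) := by simp [Y₂]
    have h3 : g.inner x (Z x) (Z x) = -sgn ε * b x := by
      simp only [b]
      linear_combination (-(g.inner x (Z x) (Z x))) * hε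
    rw [h1, h3]
    have : √(b x) * √(b x) = b x := Real.mul_self_sqrt h0.le
    have h2 : √(b x) ≠ 0 := (Real.sqrt_pos.2 h0).ne'
    simp only [q]
    field_simp
    linear_combination sgn ε * this
  · simp [Y₂, q, b0, hZ]

namespace LocalFrame

variable {g : SurfaceMetric ε S} {u₀ : OFrame g}

/-- The frame `(c X₁ + s X₂, ε s X₁ + c X₂)`, `c = √(1 + ε s²)`, at the point `x`. -/
def rotate (D : LocalFrame g u₀) (x : S) (hx : x ∈ D.U) (s : ℝ) (hs : 0 < 1 + sgn ε * s ^ 2) :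
    OFrame g where
  pt := x
  e₁ := √(1 + sgn ε * s ^ 2) • D.X₁ x + s • D.X₂ x
  e₂ := (sgn ε * s) • D.X₁ x + √(1 + sgn ε * s ^ 2) • D.X₂ x
  g₁₁ := by
    have h := Real.mul_self_sqrt hs.le
    simp only [map_add, map_smul, add_apply, smul_apply,
      smul_eq_mul, D.g₁₁ x hx, D.g₁₂ x hx, D.g₂₂ x hx, g.symm x (D.X₂ x) (D.X₁ x)]
    linear_combination h
  g₁₂ := by
    simp only [map_add, map_smul, add_apply, smul_apply,
      smul_eq_mul, D.g₁₁ x hx, D.g₁₂ x hx, D.g₂₂ x hx, g.symm x (D.X₂ x) (D.X₁ x)]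
    ring
  g₂₂ := by
    have h := Real.mul_self_sqrt hs.le
    have hε := sgn_mul_self ε
    simp only [map_add, map_smul, add_apply, smul_apply,
      smul_eq_mul, D.g₁₁ x hx, D.g₁₂ x hx, D.g₂₂ x hx, g.symm x (D.X₂ x) (D.X₁ x)]
    linear_combination (-sgn ε) * h

/-- Expansion of a tangent vector in an orthonormal pair. -/
theorem _root_.BiContact.SurfaceMetric.expand (g : SurfaceMetric ε S) {x : S}
    {a b : TangentSpace 𝓘(ℝ, E2) x} (h₁ : g.inner x a a = 1) (h₂ : g.inner x a b = 0)
    (h₃ : g.inner x b b = -sgn ε) (v : TangentSpace 𝓘(ℝ, E2) x) :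
    v = g.inner x v a • a + (-sgn ε * g.inner x v b) • b := by
  have hε := sgn_mul_self ε
  have h₂' : g.inner x b a = 0 := by rw [g.symm, h₂]
  have hli : LinearIndependent ℝ ![a, b] := by
    rw [LinearIndependent.pair_iff]
    intro s t h
    have e₁ : g.inner x (s • a + t • b) a = 0 := by rw [h]; simp
    have e₂ : g.inner x (s • a + t • b) b = 0 := by rw [h]; simp
    simp only [map_add, map_smul, add_apply, smul_apply, smul_eq_mul, h₁, h₂, h₂', h₃] at e₁ e₂
    refine ⟨by linarith, ?_⟩
    linear_combination (-sgn ε) * e₂ - t * hε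
  have hfr : Module.finrank ℝ (TangentSpace 𝓘(ℝ, E2) x) = 2 :=
    (finrank_euclideanSpace_fin : Module.finrank ℝ E2 = 2)
  have hsp : Submodule.span ℝ (Set.range ![a, b]) = ⊤ :=
    hli.span_eq_top_of_card_eq_finrank (by simp [hfr])
  have hv : v ∈ Submodule.span ℝ {a, b} := by
    have : v ∈ Submodule.span ℝ (Set.range ![a, b]) := by rw [hsp]; trivial
    simpa [Matrix.range_cons, Set.pair_comm] using this
  obtain ⟨s, t, rfl⟩ := Submodule.mem_span_pair.1 hv
  have e₁ : g.inner x (s • a + t • b) a = s := by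
    simp only [map_add, map_smul, add_apply, smul_apply, smul_eq_mul, h₁, h₂']
    ring
  have e₂ : -sgn ε * g.inner x (s • a + t • b) b = t := by
    simp only [map_add, map_smul, add_apply, smul_apply, smul_eq_mul, h₂, h₃]
    linear_combination t * hε
  rw [e₁, e₂]

theorem rotate_congr (D : LocalFrame g u₀) {x y : S} (h : x = y) (hx : x ∈ D.U) (hy : y ∈ D.U)
    {s t : ℝ} (hst : s = t) (hs : 0 < 1 + sgn ε * s ^ 2) (ht : 0 < 1 + sgn ε * t ^ 2) :
    D.rotate x hx s hs = D.rotate y hy t ht := by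
  subst h
  subst hst
  rfl

theorem rotate_e₁_X₁ (D : LocalFrame g u₀) {x : S} (hx : x ∈ D.U) {s : ℝ}
    (hs : 0 < 1 + sgn ε * s ^ 2) :
    g.inner x (D.rotate x hx s hs).e₁ (D.X₁ x) = √(1 + sgn ε * s ^ 2) := by
  change g.inner x (√(1 + sgn ε * s ^ 2) • D.X₁ x + s • D.X₂ x) (D.X₁ x) = _
  simp only [map_add, map_smul, add_apply, smul_apply, smul_eq_mul, D.g₁₁ x hx,
    g.symm x (D.X₂ x) (D.X₁ x), D.g₁₂ x hx]
  ring

theorem rotate_e₁_X₂ (D : LocalFrame g u₀) {x : S} (hx : x ∈ D.U) {s : ℝ}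
    (hs : 0 < 1 + sgn ε * s ^ 2) :
    -sgn ε * g.inner x (D.rotate x hx s hs).e₁ (D.X₂ x) = s := by
  change -sgn ε * g.inner x (√(1 + sgn ε * s ^ 2) • D.X₁ x + s • D.X₂ x) (D.X₂ x) = _
  simp only [map_add, map_smul, add_apply, smul_apply, smul_eq_mul, D.g₂₂ x hx, D.g₁₂ x hx]
  linear_combination s * sgn_mul_self ε

theorem rotate_e₂_X₂ (D : LocalFrame g u₀) {x : S} (hx : x ∈ D.U) {s : ℝ}
    (hs : 0 < 1 + sgn ε * s ^ 2) :
    -sgn ε * g.inner x (D.rotate x hx s hs).e₂ (D.X₂ x) = √(1 + sgn ε * s ^ 2) := by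
  change -sgn ε * g.inner x ((sgn ε * s) • D.X₁ x + √(1 + sgn ε * s ^ 2) • D.X₂ x) (D.X₂ x) = _
  simp only [map_add, map_smul, add_apply, smul_apply, smul_eq_mul, D.g₂₂ x hx, D.g₁₂ x hx]
  linear_combination √(1 + sgn ε * s ^ 2) * sgn_mul_self ε

/-- A frame that has positive components along the local frame field is a rotation of it. -/
theorem exists_rotate_eq (D : LocalFrame g u₀) (u : OFrame g) (hu : u.pt ∈ D.U)
    (h₁ : 0 < g.inner u.pt u.e₁ (D.X₁ u.pt))
    (h₂ : 0 < -sgn ε * g.inner u.pt u.e₂ (D.X₂ u.pt)) :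
    ∃ hs : 0 < 1 + sgn ε * (-sgn ε * g.inner u.pt u.e₁ (D.X₂ u.pt)) ^ 2,
      D.rotate u.pt hu (-sgn ε * g.inner u.pt u.e₁ (D.X₂ u.pt)) hs = u := by
  have hε := sgn_mul_self ε
  obtain ⟨x, e₁, e₂, k₁₁, k₁₂, k₂₂⟩ := u
  dsimp only at hu h₁ h₂ ⊢
  have x₁ := g.expand (D.g₁₁ x hu) (D.g₁₂ x hu) (D.g₂₂ x hu) e₁
  have x₂ := g.expand (D.g₁₁ x hu) (D.g₁₂ x hu) (D.g₂₂ x hu) e₂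
  generalize g.inner x e₁ (D.X₁ x) = a at *
  generalize -sgn ε * g.inner x e₁ (D.X₂ x) = s at *
  generalize g.inner x e₂ (D.X₁ x) = p at *
  generalize -sgn ε * g.inner x e₂ (D.X₂ x) = q at *
  subst x₁
  subst x₂
  simp only [map_add, map_smul, add_apply, smul_apply, smul_eq_mul, D.g₁₁ x hu, D.g₁₂ x hu,
    D.g₂₂ x hu, g.symm x (D.X₂ x) (D.X₁ x)] at k₁₁ k₁₂ k₂₂
  have ha : a ^ 2 = 1 + sgn ε * s ^ 2 := by linear_combination k₁₁
  have hs : 0 < 1 + sgn ε * s ^ 2 := by rw [← ha]; positivity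
  have hsq : √(1 + sgn ε * s ^ 2) = a := by rw [← ha]; exact Real.sqrt_sq h₁.le
  have hap : a * p = sgn ε * s * q := by linear_combination k₁₂
  have hqa2 : q ^ 2 = a ^ 2 := by
    have t₁ : a ^ 2 * (p ^ 2 - sgn ε * q ^ 2) = -sgn ε * a ^ 2 := by
      linear_combination a ^ 2 * k₂₂
    have t₂ : a ^ 2 * p ^ 2 = s ^ 2 * q ^ 2 := by
      linear_combination (a * p + sgn ε * s * q) * hap + s ^ 2 * q ^ 2 * hε
    have t₃ : s ^ 2 * q ^ 2 - sgn ε * (a ^ 2 * q ^ 2) = -sgn ε * a ^ 2 := by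
      linear_combination t₁ - t₂
    rw [ha] at t₃ ⊢
    linear_combination (-sgn ε) * t₃ + ((-q ^ 2 + 1) * (1 + sgn ε * s ^ 2)) * hε
      + (sgn ε * s ^ 2 * q ^ 2 * 0) * hε
  have hqa : q = a := by
    have := sq_eq_sq₀ h₂.le h₁.le |>.1 hqa2
    exact this
  have hp : p = sgn ε * s := by
    have : a * (p - sgn ε * s) = 0 := by rw [hqa] at hap; linear_combination hap
    rcases mul_eq_zero.1 this with h | h
    · exact absurd h h₁.ne'
    · linarith
  refine ⟨hs, ?_⟩
  subst hp
  subst hqa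
  simp only [rotate, hsq]

open Classical in
/-- The chart of the orthonormal frame bundle defined by a local frame field: `u` has coordinates
the position of its base point in the chart of the surface, and the second component of `u.e₁` in
the frame field. Its domain consists of the frames whose two vectors have positive components along
the corresponding vectors of the frame field. -/
def chart (D : LocalFrame g u₀) : PartialEquiv (OFrame g) (E2 × ℝ) where
  toFun u := (chartAt E2 u₀.pt u.pt, -sgn ε * g.inner u.pt u.e₁ (D.X₂ u.pt))
  invFun p := if h : (chartAt E2 u₀.pt).symm p.1 ∈ D.U ∧ 0 < 1 + sgn ε * p.2 ^ 2
    then D.rotate ((chartAt E2 u₀.pt).symm p.1) h.1 p.2 h.2 else u₀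
  source := {u | u.pt ∈ D.U ∧ 0 < g.inner u.pt u.e₁ (D.X₁ u.pt) ∧
    0 < -sgn ε * g.inner u.pt u.e₂ (D.X₂ u.pt)}
  target := {p | p.1 ∈ (chartAt E2 u₀.pt).target ∧ (chartAt E2 u₀.pt).symm p.1 ∈ D.U ∧
    0 < 1 + sgn ε * p.2 ^ 2}
  map_source' := by
    rintro u ⟨h₁, h₂, h₃⟩
    have hu := D.subset h₁
    obtain ⟨hs, -⟩ := D.exists_rotate_eq u h₁ h₂ h₃
    refine ⟨(chartAt E2 u₀.pt).map_source hu, ?_, hs⟩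
    simpa only [(chartAt E2 u₀.pt).left_inv hu] using h₁
  map_target' := by
    rintro p ⟨h₁, h₂, h₃⟩
    have hc : 0 < √(1 + sgn ε * p.2 ^ 2) := Real.sqrt_pos.2 h₃
    rw [dif_pos ⟨h₂, h₃⟩]
    exact ⟨h₂, (D.rotate_e₁_X₁ h₂ h₃).symm ▸ hc, (D.rotate_e₂_X₂ h₂ h₃).symm ▸ hc⟩
  left_inv' := by
    rintro u ⟨h₁, h₂, h₃⟩
    have hu := (chartAt E2 u₀.pt).left_inv (D.subset h₁)
    obtain ⟨hs, h⟩ := D.exists_rotate_eq u h₁ h₂ h₃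
    have h₁' := h₁
    rw [← hu] at h₁'
    rw [dif_pos ⟨h₁', hs⟩]
    exact (D.rotate_congr hu h₁' h₁ rfl hs hs).trans h
  right_inv' := by
    rintro p ⟨h₁, h₂, h₃⟩
    rw [dif_pos ⟨h₂, h₃⟩]
    exact Prod.ext ((chartAt E2 u₀.pt).right_inv h₁) (D.rotate_e₁_X₂ h₂ h₃)

theorem mem_chart_source (D : LocalFrame g u₀) : u₀ ∈ D.chart.source := by
  have hε := sgn_mul_self ε
  refine ⟨D.mem, ?_, ?_⟩
  · rw [D.eq₁, u₀.g₁₁]; exact one_pos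
  · rw [D.eq₂, u₀.g₂₂]; linarith

/-- The scalar functions of a frame that enter the transition maps: components of the rotated frame
field of `D` along local fields are smooth in the coordinates. -/
theorem contDiffOn_component (D : LocalFrame g u₀) {V : Set S}
    {X Y : ∀ x : S, TangentSpace 𝓘(ℝ, E2) x}
    (hX : ContMDiffOn 𝓘(ℝ, E2) (𝓘(ℝ, E2).prod 𝓘(ℝ, E2)) ∞
      (fun x => TotalSpace.mk' E2 (E := fun x : S => TangentSpace 𝓘(ℝ, E2) x) x (X x)) V)
    (hY : ContMDiffOn 𝓘(ℝ, E2) (𝓘(ℝ, E2).prod 𝓘(ℝ, E2)) ∞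
      (fun x => TotalSpace.mk' E2 (E := fun x : S => TangentSpace 𝓘(ℝ, E2) x) x (Y x)) V) :
    ContDiffOn ℝ ∞ (fun p : E2 × ℝ => g.inner ((chartAt E2 u₀.pt).symm p.1)
      (X ((chartAt E2 u₀.pt).symm p.1)) (Y ((chartAt E2 u₀.pt).symm p.1)))
      (D.chart.target ∩ {p | (chartAt E2 u₀.pt).symm p.1 ∈ V}) := by
  have h₁ := g.contMDiffOn_inner hX hY
  have h₂ : ContMDiffOn 𝓘(ℝ, E2) 𝓘(ℝ, E2) ∞ (chartAt E2 u₀.pt).symm (chartAt E2 u₀.pt).target :=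
    contMDiffOn_chart_symm
  have h₃ := h₁.comp (h₂.mono (inter_subset_left (t := (chartAt E2 u₀.pt).symm ⁻¹' V)))
    (fun y hy => hy.2)
  have h₄ := contMDiffOn_iff_contDiffOn.1 h₃
  exact h₄.comp contDiff_fst.contDiffOn (fun p hp => ⟨hp.1.1, hp.2⟩)

theorem contDiffOn_sqrt (D : LocalFrame g u₀) :
    ContDiffOn ℝ ∞ (fun p : E2 × ℝ => √(1 + sgn ε * p.2 ^ 2)) D.chart.target := by
  refine ContDiffOn.sqrt ?_ fun p hp => ne_of_gt hp.2.2
  exact (contDiff_const.add (contDiff_const.mul (contDiff_snd.pow 2))).contDiffOn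

/-- The part of the chart's target lying over an open set. -/
def targetOver (D : LocalFrame g u₀) (V : Set S) : Set (E2 × ℝ) :=
  D.chart.target ∩ {p | (chartAt E2 u₀.pt).symm p.1 ∈ V}

theorem isOpen_targetOver (D : LocalFrame g u₀) {V : Set S} (hV : IsOpen V) : IsOpen (D.targetOver V) := by
  have h₁ := (chartAt E2 u₀.pt).isOpen_inter_preimage_symm (D.isOpen.inter hV)
  have h₂ : IsOpen {p : E2 × ℝ | 0 < 1 + sgn ε * p.2 ^ 2} :=
    isOpen_lt continuous_const (by fun_prop)
  have : D.targetOver V = (Prod.fst ⁻¹' ((chartAt E2 u₀.pt).target ∩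
      (chartAt E2 u₀.pt).symm ⁻¹' (D.U ∩ V))) ∩ {p : E2 × ℝ | 0 < 1 + sgn ε * p.2 ^ 2} := by
    ext p
    constructor
    · rintro ⟨⟨a, b, c⟩, d⟩
      exact ⟨⟨a, b, d⟩, c⟩
    · rintro ⟨⟨a, b, d⟩, c⟩
      exact ⟨⟨a, b, c⟩, d⟩
  rw [this]
  exact (h₁.preimage continuous_fst).inter h₂

/-- Linear combinations of the frame field, paired with a smooth local field, in coordinates. -/
theorem contDiffOn_pairing (D : LocalFrame g u₀) {V : Set S}
    {Y : ∀ x : S, TangentSpace 𝓘(ℝ, E2) x}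
    (hY : ContMDiffOn 𝓘(ℝ, E2) (𝓘(ℝ, E2).prod 𝓘(ℝ, E2)) ∞
      (fun x => TotalSpace.mk' E2 (E := fun x : S => TangentSpace 𝓘(ℝ, E2) x) x (Y x)) V)
    {a b : E2 × ℝ → ℝ} (ha : ContDiffOn ℝ ∞ a D.chart.target)
    (hb : ContDiffOn ℝ ∞ b D.chart.target) :
    ContDiffOn ℝ ∞ (fun p : E2 × ℝ => g.inner ((chartAt E2 u₀.pt).symm p.1)
      (a p • D.X₁ ((chartAt E2 u₀.pt).symm p.1) + b p • D.X₂ ((chartAt E2 u₀.pt).symm p.1))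
      (Y ((chartAt E2 u₀.pt).symm p.1))) (D.targetOver V) := by
  have h₁ := D.contDiffOn_component (D.smooth₁.mono (inter_subset_left (t := V)))
    (hY.mono inter_subset_right)
  have h₂ := D.contDiffOn_component (D.smooth₂.mono (inter_subset_left (t := V)))
    (hY.mono inter_subset_right)
  have hs : D.targetOver V ⊆ D.chart.target ∩ {p | (chartAt E2 u₀.pt).symm p.1 ∈ D.U ∩ V} :=
    fun p hp => ⟨hp.1, hp.1.2.1, hp.2⟩
  have hs' : D.targetOver V ⊆ D.chart.target := inter_subset_left
  refine (((ha.mono hs').mul (h₁.mono hs)).add ((hb.mono hs').mul (h₂.mono hs))).congr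
    fun p _ => ?_
  simp only [map_add, map_smul, add_apply, smul_apply, smul_eq_mul]

variable {u₁ : OFrame g}

/-- The chart coordinates of the second chart as functions of those of the first one. -/
def change (D : LocalFrame g u₀) (D' : LocalFrame g u₁) (p : E2 × ℝ) : E2 × ℝ :=
  (chartAt E2 u₁.pt ((chartAt E2 u₀.pt).symm p.1),
    -sgn ε * g.inner ((chartAt E2 u₀.pt).symm p.1)
      (√(1 + sgn ε * p.2 ^ 2) • D.X₁ ((chartAt E2 u₀.pt).symm p.1)
        + p.2 • D.X₂ ((chartAt E2 u₀.pt).symm p.1)) (D'.X₂ ((chartAt E2 u₀.pt).symm p.1)))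

theorem chart_symm_apply (D : LocalFrame g u₀) {p : E2 × ℝ} (hp : p ∈ D.chart.target) :
    D.chart.symm p = D.rotate ((chartAt E2 u₀.pt).symm p.1) hp.2.1 p.2 hp.2.2 :=
  dif_pos hp.2

theorem trans_eqOn (D : LocalFrame g u₀) (D' : LocalFrame g u₁) :
    EqOn (D.chart.symm.trans D'.chart) (D.change D') (D.chart.symm.trans D'.chart).source := by
  intro p hp
  have hp' : p ∈ D.chart.target := hp.1
  change D'.chart (D.chart.symm p) = _
  rw [D.chart_symm_apply hp']
  rfl

theorem trans_source (D : LocalFrame g u₀) (D' : LocalFrame g u₁) :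
    (D.chart.symm.trans D'.chart).source = D.targetOver D'.U ∩
      ({p | 0 < g.inner ((chartAt E2 u₀.pt).symm p.1)
        (√(1 + sgn ε * p.2 ^ 2) • D.X₁ ((chartAt E2 u₀.pt).symm p.1)
          + p.2 • D.X₂ ((chartAt E2 u₀.pt).symm p.1)) (D'.X₁ ((chartAt E2 u₀.pt).symm p.1))} ∩
      {p | 0 < -sgn ε * g.inner ((chartAt E2 u₀.pt).symm p.1)
        ((sgn ε * p.2) • D.X₁ ((chartAt E2 u₀.pt).symm p.1)
          + √(1 + sgn ε * p.2 ^ 2) • D.X₂ ((chartAt E2 u₀.pt).symm p.1))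
        (D'.X₂ ((chartAt E2 u₀.pt).symm p.1))}) := by
  ext p
  constructor
  · rintro ⟨hp, hq⟩
    have hp' : p ∈ D.chart.target := hp
    have hq' : D.chart.symm p ∈ D'.chart.source := hq
    rw [D.chart_symm_apply hp'] at hq'
    exact ⟨⟨hp', hq'.1⟩, hq'.2.1, hq'.2.2⟩
  · rintro ⟨⟨hp, h₁⟩, h₂, h₃⟩
    refine ⟨hp, ?_⟩
    change D.chart.symm p ∈ D'.chart.source
    rw [D.chart_symm_apply hp]
    exact ⟨h₁, h₂, h₃⟩

theorem isOpen_trans_source (D : LocalFrame g u₀) (D' : LocalFrame g u₁) :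
    IsOpen (D.chart.symm.trans D'.chart).source := by
  have h₁ := (D.contDiffOn_pairing D'.smooth₁ D.contDiffOn_sqrt contDiff_snd.contDiffOn).continuousOn
  have h₂ := continuousOn_const (c := -sgn ε) |>.mul (D.contDiffOn_pairing D'.smooth₂
    (a := fun p => sgn ε * p.2) (contDiff_const.mul contDiff_snd).contDiffOn
    D.contDiffOn_sqrt).continuousOn
  have hO := D.isOpen_targetOver D'.isOpen
  have o₁ := h₁.isOpen_inter_preimage hO isOpen_Ioi (t := Ioi (0 : ℝ))
  have o₂ := h₂.isOpen_inter_preimage hO isOpen_Ioi (t := Ioi (0 : ℝ))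
  rw [D.trans_source D', Set.inter_inter_distrib_left]
  exact o₁.inter o₂

theorem contDiffOn_change (D : LocalFrame g u₀) (D' : LocalFrame g u₁) :
    ContDiffOn ℝ ∞ (D.change D') (D.targetOver D'.U) := by
  refine ContDiffOn.prodMk ?_ ?_
  · have h₁ : ContMDiffOn 𝓘(ℝ, E2) 𝓘(ℝ, E2) ∞ (chartAt E2 u₁.pt) (chartAt E2 u₁.pt).source :=
      contMDiffOn_chart
    have h₂ : ContMDiffOn 𝓘(ℝ, E2) 𝓘(ℝ, E2) ∞ (chartAt E2 u₀.pt).symm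
      (chartAt E2 u₀.pt).target := contMDiffOn_chart_symm
    have h₃ := h₁.comp (h₂.mono
      (inter_subset_left (t := (chartAt E2 u₀.pt).symm ⁻¹' (chartAt E2 u₁.pt).source)))
      (fun y hy => hy.2)
    exact (contMDiffOn_iff_contDiffOn.1 h₃).comp contDiff_fst.contDiffOn
      (fun p hp => ⟨hp.1.1, D'.subset hp.2⟩)
  · exact contDiffOn_const.mul
      (D.contDiffOn_pairing D'.smooth₂ D.contDiffOn_sqrt contDiff_snd.contDiffOn)

theorem contDiffOn_trans (D : LocalFrame g u₀) (D' : LocalFrame g u₁) :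
    ContDiffOn ℝ ∞ (D.chart.symm.trans D'.chart) (D.chart.symm.trans D'.chart).source := by
  refine ((D.contDiffOn_change D').mono ?_).congr (D.trans_eqOn D')
  rw [D.trans_source D']
  exact inter_subset_left

end LocalFrame

namespace OFrame

variable (g : SurfaceMetric ε S)

/-- The atlas of the orthonormal frame bundle: the charts of all local orthonormal frame fields. -/
def chartedSpaceCore : ChartedSpaceCore (E2 × ℝ) (OFrame g) where
  atlas := {e | ∃ (u₀ : OFrame g) (D : LocalFrame g u₀), e = D.chart}
  chartAt u₀ := (exists_localFrame g u₀).some.chart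
  mem_chart_source u₀ := (exists_localFrame g u₀).some.mem_chart_source
  chart_mem_atlas u₀ := ⟨u₀, _, rfl⟩
  open_source := by
    rintro _ _ ⟨u₀, D, rfl⟩ ⟨u₁, D', rfl⟩
    exact D.isOpen_trans_source D'
  continuousOn_toFun := by
    rintro _ _ ⟨u₀, D, rfl⟩ ⟨u₁, D', rfl⟩
    exact (D.contDiffOn_trans D').continuousOn

instance : TopologicalSpace (OFrame g) := (chartedSpaceCore g).toTopologicalSpace

instance : ChartedSpace (E2 × ℝ) (OFrame g) := (chartedSpaceCore g).toChartedSpace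

/-- The orthonormal frame bundle is a smooth 3-manifold. -/
instance : IsManifold 𝓘(ℝ, E2 × ℝ) ∞ (OFrame g) := by
  refine isManifold_of_contDiffOn _ _ _ ?_
  intro e e' he he'
  have he₁ : e ∈ ⋃ (e : PartialEquiv (OFrame g) (E2 × ℝ)) (he : e ∈ (chartedSpaceCore g).atlas),
    {(chartedSpaceCore g).openPartialHomeomorph e he} := he
  have he₂ : e' ∈ ⋃ (e : PartialEquiv (OFrame g) (E2 × ℝ)) (he : e ∈ (chartedSpaceCore g).atlas),
    {(chartedSpaceCore g).openPartialHomeomorph e he} := he'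
  simp only [mem_iUnion, mem_singleton_iff] at he₁ he₂
  obtain ⟨_, ⟨u₀, D, rfl⟩, rfl⟩ := he₁
  obtain ⟨_, ⟨u₁, D', rfl⟩, rfl⟩ := he₂
  refine (D.contDiffOn_trans D').mono ?_
  rintro p ⟨hp, -⟩
  exact hp

/-- The solder form `θ¹` on the orthonormal frame bundle: the first component, in the frame `u`, of
the projection of a tangent vector at `u` to the surface. -/
def solder₁ : OneForm (E2 × ℝ) (OFrame g) := fun u =>
  (g.inner u.pt u.e₁).comp (mfderiv 𝓘(ℝ, E2 × ℝ) 𝓘(ℝ, E2) (OFrame.pt (g := g)) u)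

/-- The solder form `θ²` on the orthonormal frame bundle: the second component, in the frame `u`, of
the projection of a tangent vector at `u` to the surface. -/
def solder₂ : OneForm (E2 × ℝ) (OFrame g) := fun u =>
  (-sgn ε) • (g.inner u.pt u.e₂).comp
    (mfderiv 𝓘(ℝ, E2 × ℝ) 𝓘(ℝ, E2) (OFrame.pt (g := g)) u)

end OFrame

end BiContact

end

noncomputable section

open Set Bundle Filter Topology

/-! Write c = ω¹, s = ω². Since c and s are independent, the two vanishing conditions say that s
divides dc and that c divides ds. Each quotient is determined only up to a multiple of the divisor,
and the normalization is exactly what allows one covector ω³ to serve both equations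
(`IsCartan.exists_isAdaptedAt`). It is unique, because a difference of two choices would be a
multiple of both c and s (`adapted_unique`).

For the local model, take coordinates in which the line field ker c ∩ ker s is spanned by ∂_t
(`exists_straightening`). With h = ω³(∂_t), the structure equations give L_{∂_t} c = -h s and
L_{∂_t} s = -ε h c. Hence the quadratic form c² - ε s², which kills ∂_t, is constant along the
t-lines and descends to a metric on the leaf space, a plane (`FiberedForms.form_eq`). At each point
the frame of the plane dual to (c, s) is orthonormal for this metric. The resulting map to the frame
bundle pulls the solder forms back to c and s (`FiberedForms.pullback_frame_solder₁`,
`FiberedForms.pullback_frame_solder₂`). A vector killed by its differential is killed by c, s and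
the pulled-back connection form, which are a coframe because c is contact; so the inverse function
theorem applies.

Curvature is computed only once, on frame bundles. In a bundle chart the solder forms are a circular
or hyperbolic rotation of a local orthonormal coframe (a, b), and the connection form is that of the
surface, γ, plus ε times the differential of the rotation parameter. The identity dγ = -ε K_Σ a ∧ b
comes from the Christoffel symbols (`CoframeComponents.gaussCurvature_eq`). For a Cartan structure,
the smoothness of ω³ and its structure equation are pulled back from the local models; uniqueness of
ω³ glues them (`hasStructureEquations_of_local`) and makes K independent of the model
(`IsFrameMapAt.curvature_eq`).

Straightening needs a flow that is smooth jointly in time and initial value. This is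
`exists_smooth_flow`, obtained by applying the inverse function theorem to the integral equation on
the Banach space C([0,1], E). -/

namespace BiContact

/-! ### Pullback, smoothness and exterior derivative of 1-forms in charts -/

section FormCalculus

variable {E : Type*} [NormedAddCommGroup E] [NormedSpace ℝ E]
  {M : Type*} [TopologicalSpace M] [ChartedSpace E M]
  {E' : Type*} [NormedAddCommGroup E'] [NormedSpace ℝ E']
  {N : Type*} [TopologicalSpace N] [ChartedSpace E' N]
  {E'' : Type*} [NormedAddCommGroup E''] [NormedSpace ℝ E'']
  {P : Type*} [TopologicalSpace P] [ChartedSpace E'' P]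

/-- The exterior derivative of a 1-form on a vector space, as an antisymmetrized derivative. -/
def extDerivFlat (α : E → E →L[ℝ] ℝ) (y v w : E) : ℝ := fderiv ℝ α y v w - fderiv ℝ α y w v

/-- Smoothness of a 1-form at a point, tested in the preferred chart. -/
def OneForm.IsSmoothAt (η : OneForm E M) (x : M) : Prop :=
  ContDiffAt ℝ ∞ (η.inChart x) (extChartAt 𝓘(ℝ, E) x x)

/-- The covectors at `a` and `b` have different types, so a direct rewrite fails. All tangent spaces
unfold to the model space, which is what makes this statement well typed. -/
theorem OneForm.comp_congr (θ : OneForm E' N) {a b : N} (h : a = b) {A B : E →L[ℝ] E'}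
    (h' : A = B) : (θ a : E' →L[ℝ] ℝ).comp A = (θ b : E' →L[ℝ] ℝ).comp B := by
  subst h h'
  rfl

theorem pullback_congr {f g : M → N} {x : M} (θ : OneForm E' N) (h : f =ᶠ[𝓝 x] g) :
    pullback (E := E) f θ x = pullback (E := E) g θ x :=
  OneForm.comp_congr (E := E) θ h.eq_of_nhds h.mfderiv_eq

theorem pullback_congr_form (f : M → N) {x : M} {θ θ' : OneForm E' N} (h : θ (f x) = θ' (f x)) :
    pullback (E := E) f θ x = pullback (E := E) f θ' x := by
  simp only [pullback, h]

theorem pullback_comp {g : N → P} {f : M → N} {x : M} (θ : OneForm E'' P)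
    (hg : MDifferentiableAt 𝓘(ℝ, E') 𝓘(ℝ, E'') g (f x))
    (hf : MDifferentiableAt 𝓘(ℝ, E) 𝓘(ℝ, E') f x) :
    pullback (E := E) (g ∘ f) θ x = pullback (E := E) f (pullback (E := E') g θ) x := by
  simp only [pullback, mfderiv_comp x hg hf]
  rfl

theorem pullback_id_of_eventuallyEq {f : M → M} {x : M} (θ : OneForm E M) (h : f =ᶠ[𝓝 x] id) :
    pullback (E := E) f θ x = θ x := by
  rw [pullback_congr θ h]
  simp only [pullback, mfderiv_id]
  rfl

theorem OneForm.inChart_eq_pullback (η : OneForm E M) (x : M) :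
    η.inChart x = pullback (E := E) (extChartAt 𝓘(ℝ, E) x).symm η := rfl

theorem OneForm.inChart_model (η : OneForm E E) (x : E) : η.inChart x = η := by
  funext y
  exact pullback_id_of_eventuallyEq η (Eventually.of_forall fun z => by
    rw [extChartAt_model_space_eq_id]; rfl)

theorem OneForm.d_model (η : OneForm E E) (x v w : E) : η.d x v w = extDerivFlat η x v w := by
  change extDerivFlat (η.inChart x) (extChartAt 𝓘(ℝ, E) x x) v w = _
  rw [OneForm.inChart_model, extChartAt_model_space_eq_id]
  rfl

theorem OneForm.isSmoothAt_model {η : OneForm E E} {x : E} :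
    η.IsSmoothAt x ↔ ContDiffAt (F := E →L[ℝ] ℝ) ℝ ∞ η x := by
  unfold OneForm.IsSmoothAt
  rw [OneForm.inChart_model, extChartAt_model_space_eq_id]
  rfl

theorem extDerivFlat_congr {α β : E → E →L[ℝ] ℝ} {y : E} (h : α =ᶠ[𝓝 y] β) (v w : E) :
    extDerivFlat α y v w = extDerivFlat β y v w := by
  simp only [extDerivFlat, h.fderiv_eq]

theorem eventually_extChartAt_symm {x : M} {p : M → Prop} (h : ∀ᶠ z in 𝓝 x, p z) :
    ∀ᶠ y in 𝓝 (extChartAt 𝓘(ℝ, E) x x), p ((extChartAt 𝓘(ℝ, E) x).symm y) := by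
  have h₁ := continuousAt_extChartAt_symm (I := 𝓘(ℝ, E)) x
  rw [ContinuousAt, extChartAt_to_inv] at h₁
  exact h₁ h

theorem OneForm.inChart_congr {η η' : OneForm E M} {x : M} (h : ∀ᶠ z in 𝓝 x, η z = η' z) :
    η.inChart x =ᶠ[𝓝 (extChartAt 𝓘(ℝ, E) x x)] η'.inChart x := by
  filter_upwards [eventually_extChartAt_symm (E := E) h] with y hy
  exact pullback_congr_form _ hy

theorem OneForm.d_congr {η η' : OneForm E M} {x : M} (h : ∀ᶠ z in 𝓝 x, η z = η' z) :
    η.d x = η'.d x := by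
  funext v w
  exact extDerivFlat_congr (OneForm.inChart_congr h) v w

theorem OneForm.IsSmoothAt.congr {η η' : OneForm E M} {x : M} (hη : η.IsSmoothAt x)
    (h : ∀ᶠ z in 𝓝 x, η z = η' z) : η'.IsSmoothAt x :=
  ContDiffAt.congr_of_eventuallyEq hη (OneForm.inChart_congr h).symm

/-- The product rule produces one extra term, α applied to the second derivative of F. That
derivative is symmetric, so antisymmetrizing removes the term. -/
theorem extDerivFlat_pullback {α : E' → E' →L[ℝ] ℝ} {F : E → E'} {y : E}
    (hα : ContDiffAt ℝ ∞ α (F y)) (hF : ContDiffAt ℝ ∞ F y) (v w : E) :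
    extDerivFlat (fun z => (α (F z)).comp (fderiv ℝ F z)) y v w
      = extDerivFlat α (F y) (fderiv ℝ F y v) (fderiv ℝ F y w) := by
  have d₁ : DifferentiableAt ℝ α (F y) := hα.differentiableAt (by simp)
  have d₂ : DifferentiableAt ℝ F y := hF.differentiableAt (by simp)
  have d₃ : DifferentiableAt ℝ (fderiv ℝ F) y :=
    (hF.fderiv_right (m := 1) (by norm_cast)).differentiableAt (by simp)
  have h₁ : HasFDerivAt (fun z => α (F z)) ((fderiv ℝ α (F y)).comp (fderiv ℝ F y)) y :=
    d₁.hasFDerivAt.comp y d₂.hasFDerivAt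
  have h₂ := h₁.clm_comp d₃.hasFDerivAt
  have hs : IsSymmSndFDerivAt ℝ F y := hF.isSymmSndFDerivAt (by simp; norm_cast)
  have hs' := hs.eq v w
  simp only [extDerivFlat, h₂.fderiv]
  simp [hs']

variable [IsManifold 𝓘(ℝ, E) ∞ M] [IsManifold 𝓘(ℝ, E') ∞ N]

theorem contMDiffAt_extChartAt_symm_self (x : M) {y : E}
    (hy : y ∈ (extChartAt 𝓘(ℝ, E) x).target) :
    ContMDiffAt 𝓘(ℝ, E) 𝓘(ℝ, E) ∞ (extChartAt 𝓘(ℝ, E) x).symm y :=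
  (contMDiffOn_extChartAt_symm x).contMDiffAt
    ((isOpen_extChartAt_target (I := 𝓘(ℝ, E)) x).mem_nhds hy)

omit [IsManifold 𝓘(ℝ, E) ∞ M] [IsManifold 𝓘(ℝ, E') ∞ N] in
theorem contDiffAt_writtenInExtChartAt {f : M → N} {x : M}
    (hf : ContMDiffAt 𝓘(ℝ, E) 𝓘(ℝ, E') ∞ f x) :
    ContDiffAt ℝ ∞ (writtenInExtChartAt 𝓘(ℝ, E) 𝓘(ℝ, E') x f) (extChartAt 𝓘(ℝ, E) x x) := by
  have h := (contMDiffAt_iff.1 hf).2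
  rwa [modelWithCornersSelf_coe, range_id, contDiffWithinAt_univ] at h

omit [IsManifold 𝓘(ℝ, E) ∞ M] [IsManifold 𝓘(ℝ, E') ∞ N] in
theorem mfderiv_eq_fderiv_written {f : M → N} {x : M}
    (hf : MDifferentiableAt 𝓘(ℝ, E) 𝓘(ℝ, E') f x) :
    mfderiv 𝓘(ℝ, E) 𝓘(ℝ, E') f x
      = fderiv ℝ (writtenInExtChartAt 𝓘(ℝ, E) 𝓘(ℝ, E') x f) (extChartAt 𝓘(ℝ, E) x x) := by
  rw [hf.mfderiv, modelWithCornersSelf_coe, range_id, fderivWithin_univ]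

/-- Both sides are pullbacks of θ along the same map: f after the inverse chart at x agrees, near
each nearby point, with the inverse chart at f x after the coordinate expression of f. This reduces
naturality of d to the flat case. -/
theorem inChart_pullback {f : M → N} {x : M} (θ : OneForm E' N)
    (hf : ContMDiffAt 𝓘(ℝ, E) 𝓘(ℝ, E') ∞ f x) :
    (pullback (E := E) f θ).inChart x =ᶠ[𝓝 (extChartAt 𝓘(ℝ, E) x x)]
      fun y => (θ.inChart (f x) (writtenInExtChartAt 𝓘(ℝ, E) 𝓘(ℝ, E') x f y)).comp
        (fderiv ℝ (writtenInExtChartAt 𝓘(ℝ, E) 𝓘(ℝ, E') x f) y) := by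
  set F := writtenInExtChartAt 𝓘(ℝ, E) 𝓘(ℝ, E') x f with hF
  have hF' := contDiffAt_writtenInExtChartAt hf
  have hf₁ : ∀ᶠ z in 𝓝 x, MDifferentiableAt 𝓘(ℝ, E) 𝓘(ℝ, E') f z := by
    have : IsManifold 𝓘(ℝ, E) 1 M := IsManifold.of_le (n := ∞) (by simp)
    have : IsManifold 𝓘(ℝ, E') 1 N := IsManifold.of_le (n := ∞) (by simp)
    filter_upwards [(contMDiffAt_iff_contMDiffAt_nhds (by simp)).1 (hf.of_le (m := 1) (by simp))]
      with z hz using hz.mdifferentiableAt (by simp)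
  have h₁ := hf₁.and
    (hf.continuousAt (extChartAt_source_mem_nhds (I := 𝓘(ℝ, E')) (f x)))
  have h₂ := eventually_extChartAt_symm (E := E) h₁.eventually_nhds
  filter_upwards [h₂, extChartAt_target_mem_nhds (I := 𝓘(ℝ, E)) x,
    (hF'.of_le (m := 1) (by simp)).eventually (by simp)] with y hy hyt hFy
  have hs := contMDiffAt_extChartAt_symm_self x hyt
  obtain ⟨hfy, hmem⟩ := hy.self_of_nhds
  have e₁ : (pullback (E := E) f θ).inChart x y
      = pullback (E := E) (f ∘ (extChartAt 𝓘(ℝ, E) x).symm) θ y :=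
    (pullback_comp θ hfy (hs.mdifferentiableAt (by simp))).symm
  have hFt : F y ∈ (extChartAt 𝓘(ℝ, E') (f x)).target :=
    (extChartAt 𝓘(ℝ, E') (f x)).map_source hmem
  have e₂ := pullback_comp (E := E) (f := F) (x := y) θ
    ((contMDiffAt_extChartAt_symm_self (f x) hFt).mdifferentiableAt (by simp))
    (hFy.differentiableAt (by simp)).mdifferentiableAt
  have e₃ : (extChartAt 𝓘(ℝ, E') (f x)).symm ∘ F =ᶠ[𝓝 y] f ∘ (extChartAt 𝓘(ℝ, E) x).symm := by
    filter_upwards [hs.continuousAt hy] with z hz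
    exact (extChartAt 𝓘(ℝ, E') (f x)).left_inv hz.2
  rw [e₁, ← pullback_congr θ e₃, e₂, ← mfderiv_eq_fderiv]
  rfl

theorem d_pullback {f : M → N} {x : M} {θ : OneForm E' N}
    (hf : ContMDiffAt 𝓘(ℝ, E) 𝓘(ℝ, E') ∞ f x) (hθ : θ.IsSmoothAt (f x))
    (v w : TangentSpace 𝓘(ℝ, E) x) :
    (pullback (E := E) f θ).d x v w
      = θ.d (f x) (mfderiv 𝓘(ℝ, E) 𝓘(ℝ, E') f x v) (mfderiv 𝓘(ℝ, E) 𝓘(ℝ, E') f x w) := by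
  have hx : writtenInExtChartAt 𝓘(ℝ, E) 𝓘(ℝ, E') x f (extChartAt 𝓘(ℝ, E) x x)
      = extChartAt 𝓘(ℝ, E') (f x) (f x) := by simp [writtenInExtChartAt]
  refine (extDerivFlat_congr (inChart_pullback θ hf) v w).trans ?_
  refine (extDerivFlat_pullback (by rw [hx]; exact hθ)
    (contDiffAt_writtenInExtChartAt hf) v w).trans ?_
  rw [hx, mfderiv_eq_fderiv_written (hf.mdifferentiableAt (by simp))]
  rfl

theorem OneForm.IsSmoothAt.pullback {f : M → N} {x : M} {θ : OneForm E' N}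
    (hθ : θ.IsSmoothAt (f x)) (hf : ContMDiffAt 𝓘(ℝ, E) 𝓘(ℝ, E') ∞ f x) :
    OneForm.IsSmoothAt (pullback (E := E) f θ) x := by
  have hx : writtenInExtChartAt 𝓘(ℝ, E) 𝓘(ℝ, E') x f (extChartAt 𝓘(ℝ, E) x x)
      = extChartAt 𝓘(ℝ, E') (f x) (f x) := by simp [writtenInExtChartAt]
  have hF := contDiffAt_writtenInExtChartAt hf
  refine ContDiffAt.congr_of_eventuallyEq ?_ (inChart_pullback θ hf)
  refine ContDiffAt.clm_comp ?_ (hF.fderiv_right (by norm_cast))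
  exact ContDiffAt.comp _ (by rw [hx]; exact hθ) hF

/-- The inverse of the tangent trivialization at x is the derivative of the inverse chart. The
bundle coordinates of η are therefore `η.inChart x` composed with the chart (`key`), and composing
with a chart or its inverse preserves smoothness. -/
theorem OneForm.isSmoothAt_iff {η : OneForm E M} {x : M} :
    η.IsSmoothAt x ↔ ContMDiffAt 𝓘(ℝ, E) (𝓘(ℝ, E).prod 𝓘(ℝ, E →L[ℝ] ℝ)) ∞
    (fun x => TotalSpace.mk' (E →L[ℝ] ℝ)
      (E := fun x : M => TangentSpace 𝓘(ℝ, E) x →L[ℝ] ℝ) x (η x)) x := by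
  have key : ∀ᶠ z in 𝓝 x, ContinuousLinearMap.inCoordinates E (TangentSpace 𝓘(ℝ, E)) ℝ
      (Bundle.Trivial M ℝ) x z x z (η z) = η.inChart x (extChartAt 𝓘(ℝ, E) x z) := by
    filter_upwards [chart_source_mem_nhds E x] with z hz
    have hz' : (extChartAt 𝓘(ℝ, E) x).symm (extChartAt 𝓘(ℝ, E) x z) = z :=
      (extChartAt 𝓘(ℝ, E) x).left_inv (by simpa using hz)
    have e := TangentBundle.symmL_trivializationAt (I := 𝓘(ℝ, E)) hz
    rw [modelWithCornersSelf_coe, range_id, mfderivWithin_univ] at e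
    have := OneForm.comp_congr (E := E) η hz' e.symm
    refine Eq.trans ?_ this.symm
    rw [ContinuousLinearMap.inCoordinates]
    ext v
    simp
  have hφ : ContMDiffAt 𝓘(ℝ, E) 𝓘(ℝ, E) ∞ (extChartAt 𝓘(ℝ, E) x) x := contMDiffAt_extChartAt
  have hs := contMDiffAt_extChartAt_symm_self (E := E) x (mem_extChartAt_target x)
  rw [contMDiffAt_hom_bundle]
  constructor
  · intro h
    refine ⟨contMDiffAt_id, ?_⟩
    refine ContMDiffAt.congr_of_eventuallyEq ?_ key
    exact (ContDiffAt.contMDiffAt h).comp x hφ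
  · rintro ⟨-, h⟩
    have h' := h.congr_of_eventuallyEq (f₁ := fun z => η.inChart x (extChartAt 𝓘(ℝ, E) x z))
      (key.mono fun z hz => hz.symm)
    have h'' := ContMDiffAt.comp_of_eq h' hs (extChartAt_to_inv (I := 𝓘(ℝ, E)) x)
    refine (contMDiffAt_iff_contDiffAt.1 h'').congr_of_eventuallyEq ?_
    filter_upwards [extChartAt_target_mem_nhds (I := 𝓘(ℝ, E)) x] with y hy
    simp only [Function.comp_apply]
    rw [(extChartAt 𝓘(ℝ, E) x).right_inv hy]

theorem OneForm.isSmooth_iff {η : OneForm E M} : η.IsSmooth ↔ ∀ x, η.IsSmoothAt x :=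
  forall_congr' fun _ => OneForm.isSmoothAt_iff.symm

end FormCalculus

/-! ### Pointwise algebra of the structure equations, and gluing -/

section Coframes

variable {E : Type*} [NormedAddCommGroup E] [NormedSpace ℝ E]
  {M : Type*} [TopologicalSpace M] [ChartedSpace E M] {ε : ℤˣ} {ω₁ ω₂ ω₃ : OneForm E M}

/-- The interior product of the exterior derivative with a vector. -/
theorem OneForm.exists_d_apply (η : OneForm E M) (x : M) (u : TangentSpace 𝓘(ℝ, E) x) :
    ∃ L : TangentSpace 𝓘(ℝ, E) x →L[ℝ] ℝ, ∀ v, L v = η.d x u v := by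
  let D : E →L[ℝ] E →L[ℝ] ℝ := fderiv ℝ (η.inChart x) (extChartAt 𝓘(ℝ, E) x x)
  exact ⟨(D u - D.flip u : E →L[ℝ] ℝ), fun v => rfl⟩

/-- Expanding the triple product along ω₃ leaves the values of ω₁ ∧ ω₂ as coefficients. -/
theorem exists_wedge_ne_zero_of_nondeg {x : M} (h : wedge₁₂ ω₁ (wedge ω₂ ω₃) x ≠ 0) :
    ∃ v w, wedge ω₁ ω₂ x v w ≠ 0 := by
  by_contra! h'
  apply h
  funext u v w
  have h₁ := h' u v
  have h₂ := h' u w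
  have h₃ := h' v w
  simp only [wedge, wedge₁₂, Pi.zero_apply] at *
  linear_combination ω₃ x w * h₁ - ω₃ x v * h₂ + ω₃ x u * h₃

/-- Two nonzero covectors whose wedge vanishes are proportional and have the same kernel. The
contact conditions are used only to know that the covectors are nonzero. -/
theorem exists_wedge_ne_zero_of_contact {x : M} {d₁ d₂ : TwoForm E M}
    (h₁ : wedge₁₂ ω₁ d₁ x ≠ 0) (h₂ : wedge₁₂ ω₂ d₂ x ≠ 0) (h : (ω₁ x).ker ≠ (ω₂ x).ker) :
    ∃ v w, wedge ω₁ ω₂ x v w ≠ 0 := by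
  by_contra! h'
  have n₁ : ∃ v, ω₁ x v ≠ 0 := by
    by_contra! h0
    exact h₁ (by funext u v w; simp [wedge₁₂, h0])
  have n₂ : ∃ v, ω₂ x v ≠ 0 := by
    by_contra! h0
    exact h₂ (by funext u v w; simp [wedge₁₂, h0])
  obtain ⟨v₁, n₁⟩ := n₁
  obtain ⟨v₂, n₂⟩ := n₂
  refine h (Submodule.ext fun w => ?_)
  have k₁ := h' v₁ w
  have k₂ := h' w v₂
  simp only [wedge] at k₁ k₂
  constructor
  · intro hw
    have hw' : ω₁ x w = 0 := hw
    have : ω₁ x v₁ * ω₂ x w = 0 := by rw [hw'] at k₁; linarith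
    exact (mul_eq_zero.1 this).resolve_left n₁
  · intro hw
    have hw' : ω₂ x w = 0 := hw
    have : ω₁ x w * ω₂ x v₂ = 0 := by rw [hw'] at k₂; linarith
    exact (mul_eq_zero.1 this).resolve_right n₂

/-- An adapted covector is determined by the first two structure equations. -/
theorem adapted_unique {x : M} {η η' : TangentSpace 𝓘(ℝ, E) x →L[ℝ] ℝ}
    {v w : TangentSpace 𝓘(ℝ, E) x} (h : wedge ω₁ ω₂ x v w ≠ 0)
    (h₁ : ∀ v w, ω₂ x v * η w - ω₂ x w * η v = ω₂ x v * η' w - ω₂ x w * η' v)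
    (h₂ : ∀ v w, ω₁ x v * η w - ω₁ x w * η v = ω₁ x v * η' w - ω₁ x w * η' v) : η = η' := by
  have a₁ := h₁ v w
  have a₂ := h₂ v w
  simp only [wedge] at h
  -- The difference of the two covectors wedges to zero with ω₁ and with ω₂. On the pair (v, w) this
  -- is a 2×2 system with nonzero determinant, so the difference kills v and w, and the pairs (v,
  -- z), (w, z) then show that it kills every z.
  have hw : η w = η' w := by
    refine sub_eq_zero.1 ((mul_eq_zero.1 (?_ : (ω₁ x v * ω₂ x w - ω₁ x w * ω₂ x v) * _ = 0)).resolve_left h)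
    linear_combination ω₂ x w * a₂ - ω₁ x w * a₁
  have hv : η v = η' v := by
    refine sub_eq_zero.1 ((mul_eq_zero.1 (?_ : (ω₁ x v * ω₂ x w - ω₁ x w * ω₂ x v) * _ = 0)).resolve_left h)
    linear_combination ω₂ x v * a₂ - ω₁ x v * a₁
  ext z
  have b₁ := h₂ v z
  have b₂ := h₂ w z
  rw [hv] at b₁
  rw [hw] at b₂
  refine sub_eq_zero.1 ((mul_eq_zero.1 (?_ : (ω₁ x v * ω₂ x w - ω₁ x w * ω₂ x v) * _ = 0)).resolve_left h)
  linear_combination ω₂ x w * b₁ - ω₂ x v * b₂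

/-- `ω³` is adapted to `(ω¹, ω²)` at the point `x`. -/
def IsAdaptedAt (ε : ℤˣ) (ω₁ ω₂ ω₃ : OneForm E M) (x : M) : Prop :=
  ω₁.d x = wedge ω₂ ω₃ x ∧ ω₂.d x = sgn ε • wedge ω₁ ω₃ x

theorem isAdapted_iff : IsAdapted ε ω₁ ω₂ ω₃ ↔ ∀ x, IsAdaptedAt ε ω₁ ω₂ ω₃ x :=
  ⟨fun h x => ⟨congrFun h.1 x, congrFun h.2 x⟩,
    fun h => ⟨funext fun x => (h x).1, funext fun x => (h x).2⟩⟩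

theorem IsAdaptedAt.unique {η η' : OneForm E M} {x : M} (hη : IsAdaptedAt ε ω₁ ω₂ η x)
    (hη' : IsAdaptedAt ε ω₁ ω₂ η' x) (h : ∃ v w, wedge ω₁ ω₂ x v w ≠ 0) : η x = η' x := by
  obtain ⟨v, w, h⟩ := h
  have hε := sgn_mul_self ε
  refine adapted_unique h (fun v w => ?_) (fun v w => ?_)
  · exact congrFun₂ (hη.1.symm.trans hη'.1) v w
  · have k := congrFun₂ (hη.2.symm.trans hη'.2) v w
    simp only [Pi.smul_apply, smul_eq_mul, wedge] at k
    linear_combination sgn ε * k - (ω₁ x v * η x w - ω₁ x w * η x v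
      - (ω₁ x v * η' x w - ω₁ x w * η' x v)) * hε

theorem IsAdaptedAt.congr {η η' : OneForm E M} {x : M} (h : IsAdaptedAt ε ω₁ ω₂ η x)
    (hx : η x = η' x) : IsAdaptedAt ε ω₁ ω₂ η' x := by
  have e : ∀ α : OneForm E M, wedge α η x = wedge α η' x := fun α => by
    funext v w
    simp only [wedge, hx]
  refine ⟨h.1.trans (e _), h.2.trans ?_⟩
  rw [e]

variable [IsManifold 𝓘(ℝ, E) ∞ M]

theorem IsBiContact.exists_wedge_ne_zero (h : IsBiContact ω₁ ω₂) (x : M) :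
    ∃ v w, wedge ω₁ ω₂ x v w ≠ 0 :=
  exists_wedge_ne_zero_of_contact (h.contact₁ x) (h.contact₂ x) (h.ker_ne x)

/-- With e₁, e₂ dual to (ω₁, ω₂), contracting ω₂ ∧ dω₁ = 0 with e₂ gives dω₁ = ω₂ ∧ ι_{e₂}dω₁, and
contracting ω₁ ∧ dω₂ = 0 with e₁ gives dω₂ = ω₁ ∧ ι_{e₁}dω₂. The normalization contracted with e₁,
e₂ reads ι_{e₂}dω₁ + ε dω₂(e₁, e₂) ω₂ = ε ι_{e₁}dω₂ - dω₁(e₁, e₂) ω₁. This common value solves both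
equations. -/
theorem IsCartan.exists_isAdaptedAt (h : IsCartan ε ω₁ ω₂) (x : M) :
    ∃ η : TangentSpace 𝓘(ℝ, E) x →L[ℝ] ℝ, ∀ v w,
      ω₁.d x v w = ω₂ x v * η w - ω₂ x w * η v ∧
      ω₂.d x v w = sgn ε * (ω₁ x v * η w - ω₁ x w * η v) := by
  obtain ⟨v, w, hvw⟩ := h.toIsBiContact.exists_wedge_ne_zero x
  have hε := sgn_mul_self ε
  simp only [wedge] at hvw
  set Δ := ω₁ x v * ω₂ x w - ω₁ x w * ω₂ x v with hΔ
  have hdual : ∀ a b : ℝ, ∃ e, ω₁ x e = a ∧ ω₂ x e = b := fun a b =>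
    ⟨((a * ω₂ x w - b * ω₁ x w) / Δ) • v + ((b * ω₁ x v - a * ω₂ x v) / Δ) • w, by
      simp only [map_add, map_smul, smul_eq_mul]
      field_simp
      rw [hΔ]
      ring, by
      simp only [map_add, map_smul, smul_eq_mul]
      field_simp
      rw [hΔ]
      ring⟩
  obtain ⟨e₁, e₁₁, e₁₂⟩ := hdual 1 0
  obtain ⟨e₂, e₂₁, e₂₂⟩ := hdual 0 1
  obtain ⟨L, hL⟩ := ω₁.exists_d_apply x e₂
  refine ⟨L + (sgn ε * ω₂.d x e₁ e₂) • ω₂ x, fun u v => ?_⟩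
  have k₁ : wedge₁₂ ω₂ ω₁.d x e₂ u v = 0 := congrFun (congrFun₂ (congrFun h.wedge_d₂₁ x) e₂ u) v
  have k₂ : wedge₁₂ ω₁ ω₂.d x e₁ u v = 0 := congrFun (congrFun₂ (congrFun h.wedge_d₁₂ x) e₁ u) v
  have k₃ := fun z => congrFun (congrFun₂ (congrFun h.normalized x) e₁ e₂) z
  have k₃u := k₃ u
  have k₃v := k₃ v
  simp only [wedge₁₂, Pi.smul_apply, smul_eq_mul, e₁₁, e₁₂, e₂₁, e₂₂] at k₁ k₂ k₃u k₃v
  simp only [add_apply, smul_apply, smul_eq_mul, hL]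
  constructor
  · linear_combination k₁
  · linear_combination k₂ - sgn ε * ω₁ x u * k₃v + sgn ε * ω₁ x v * k₃u
      + (ω₁ x v * ω₂.d x e₁ u - ω₁ x u * ω₂.d x e₁ v) * hε

theorem IsCartan.exists_isAdapted (h : IsCartan ε ω₁ ω₂) : ∃ ω₃, IsAdapted ε ω₁ ω₂ ω₃ := by
  choose η hη using h.exists_isAdaptedAt
  refine ⟨η, funext fun x => ?_, funext fun x => ?_⟩
  · funext v w
    exact (hη x v w).1
  · funext v w
    exact (hη x v w).2

/-- By the structure equations ω₁ ∧ dω₁ is the volume form ω₁ ∧ ω₂ ∧ ω₃ and ω₂ ∧ dω₂ is -ε times it,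
while the mixed products contain a repeated factor. -/
theorem IsAdapted.isCartan (h : IsAdapted ε ω₁ ω₂ ω₃) (h' : IsCoframe ω₁ ω₂ ω₃) :
    IsCartan ε ω₁ ω₂ := by
  have hε := sgn_mul_self ε
  have e₂ : wedge₁₂ ω₂ ω₂.d = -sgn ε • wedge₁₂ ω₁ (wedge ω₂ ω₃) := by
    rw [h.2]
    funext x u v w
    simp only [wedge₁₂, wedge, Pi.smul_apply, smul_eq_mul]
    ring
  refine ⟨⟨h'.smooth₁, h'.smooth₂, fun x => ?_, fun x => ?_, fun x hx => ?_⟩, ?_, ?_, ?_⟩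
  · rw [h.1]
    exact h'.nondeg x
  · rw [e₂]
    refine fun h0 => h'.nondeg x ?_
    funext u v w
    have k := congrFun (congrFun₂ h0 u v) w
    simp only [Pi.smul_apply, smul_eq_mul, Pi.zero_apply] at k ⊢
    linear_combination (-sgn ε) * k - wedge₁₂ ω₁ (wedge ω₂ ω₃) x u v w * hε
  · obtain ⟨v, w, hvw⟩ := exists_wedge_ne_zero_of_nondeg (h'.nondeg x)
    have hz : ω₁ x v • w - ω₁ x w • v ∈ (ω₁ x).ker := by
      change ω₁ x _ = 0
      simp only [map_sub, map_smul, smul_eq_mul]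
      ring
    rw [hx] at hz
    have hz' : ω₂ x (ω₁ x v • w - ω₁ x w • v) = 0 := hz
    simp only [map_sub, map_smul, smul_eq_mul] at hz'
    exact hvw hz'
  · rw [e₂, h.1, smul_smul]
    simp [hε]
  · rw [h.2]
    funext x u v w
    simp only [wedge₁₂, wedge, Pi.smul_apply, smul_eq_mul, Pi.zero_apply]
    ring
  · rw [h.1]
    funext x u v w
    simp only [wedge₁₂, wedge, Pi.zero_apply]
    ring

omit [IsManifold 𝓘(ℝ, E) ∞ M] in
theorem ContMDiffAt.of_comp_extChartAt_symm {F : Type*} [NormedAddCommGroup F] [NormedSpace ℝ F]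
    {f : M → F} {x : M}
    (h : ContDiffAt ℝ ∞ (f ∘ (extChartAt 𝓘(ℝ, E) x).symm) (extChartAt 𝓘(ℝ, E) x x)) :
    ContMDiffAt 𝓘(ℝ, E) 𝓘(ℝ, F) ∞ f x := by
  refine (ContMDiffAt.comp x h.contMDiffAt contMDiffAt_extChartAt).congr_of_eventuallyEq ?_
  filter_upwards [extChartAt_source_mem_nhds (I := 𝓘(ℝ, E)) x] with z hz
  simp only [Function.comp_apply, (extChartAt 𝓘(ℝ, E) x).left_inv hz]

theorem OneForm.apply_eq_inChart (η : OneForm E M) (x : M) (v : TangentSpace 𝓘(ℝ, E) x) :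
    η x v = η.inChart x (extChartAt 𝓘(ℝ, E) x x)
      (mfderiv 𝓘(ℝ, E) 𝓘(ℝ, E) (extChartAt 𝓘(ℝ, E) x) x v) := by
  have hφ : ContMDiffAt 𝓘(ℝ, E) 𝓘(ℝ, E) ∞ (extChartAt 𝓘(ℝ, E) x) x := contMDiffAt_extChartAt
  have hs := contMDiffAt_extChartAt_symm_self (E := E) x (mem_extChartAt_target x)
  have h := pullback_comp (E := E) (f := extChartAt 𝓘(ℝ, E) x) (x := x) η
    (hs.mdifferentiableAt (by simp)) (hφ.mdifferentiableAt (by simp))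
  rw [pullback_id_of_eventuallyEq] at h
  · rw [h]
    rfl
  · filter_upwards [extChartAt_source_mem_nhds (I := 𝓘(ℝ, E)) x] with z hz
    exact (extChartAt 𝓘(ℝ, E) x).left_inv hz

theorem ContDiffAt.extDerivFlat {α : E → E →L[ℝ] ℝ} {y : E} (h : ContDiffAt ℝ ∞ α y) (v w : E) :
    ContDiffAt ℝ ∞ (fun z => BiContact.extDerivFlat α z v w) y := by
  have hd : ContDiffAt ℝ ∞ (fderiv ℝ α) y := h.fderiv_right (by norm_cast)
  exact ((hd.clm_apply contDiffAt_const).clm_apply contDiffAt_const).sub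
    ((hd.clm_apply contDiffAt_const).clm_apply contDiffAt_const)

/-- The coefficient in an equation `dη = K α ∧ β` between smooth forms is smooth. -/
theorem contMDiff_of_d_eq_smul_wedge {K : M → ℝ} {α β η : OneForm E M}
    (hα : α.IsSmooth) (hβ : β.IsSmooth) (hη : η.IsSmooth) (h : ∀ x, η.d x = K x • wedge α β x)
    (h0 : ∀ x, ∃ v w, wedge α β x v w ≠ 0) : ContMDiff 𝓘(ℝ, E) 𝓘(ℝ, ℝ) ∞ K := by
  intro x
  rw [OneForm.isSmooth_iff] at hα hβ hη
  refine ContMDiffAt.of_comp_extChartAt_symm ?_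
  obtain ⟨v, w, hvw⟩ := h0 x
  simp only [wedge, OneForm.apply_eq_inChart] at hvw
  set v' : E := mfderiv 𝓘(ℝ, E) 𝓘(ℝ, E) (extChartAt 𝓘(ℝ, E) x) x v
  set w' : E := mfderiv 𝓘(ℝ, E) 𝓘(ℝ, E) (extChartAt 𝓘(ℝ, E) x) x w
  set y₀ := extChartAt 𝓘(ℝ, E) x x
  let W : E → ℝ := fun y => α.inChart x y v' * β.inChart x y w' - α.inChart x y w' * β.inChart x y v'
  have ca : ContDiffAt ℝ ∞ (α.inChart x) y₀ := hα x
  have cb : ContDiffAt ℝ ∞ (β.inChart x) y₀ := hβ x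
  have hW : ContDiffAt ℝ ∞ W y₀ :=
    ((ca.clm_apply contDiffAt_const).mul (cb.clm_apply contDiffAt_const)).sub
      ((ca.clm_apply contDiffAt_const).mul (cb.clm_apply contDiffAt_const))
  -- Evaluated on two fixed coordinate vectors, the equation presents K near x as a quotient of
  -- smooth functions.
  have hq := (ContDiffAt.extDerivFlat (hη x) v' w').div hW hvw
  refine hq.congr_of_eventuallyEq ?_
  filter_upwards [extChartAt_target_mem_nhds (I := 𝓘(ℝ, E)) x,
    hW.continuousAt.eventually_ne hvw] with y hy hWy
  have hs := contMDiffAt_extChartAt_symm_self (E := E) x hy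
  have e := d_pullback (θ := η) hs (hη _) v' w'
  rw [OneForm.d_model, h] at e
  change K _ = _ / W y
  rw [eq_div_iff hWy]
  exact e.symm

/-- The structure equations hold globally if they hold locally. -/
theorem hasStructureEquations_of_local {K : M → ℝ} (h₁ : ω₁.IsSmooth) (h₂ : ω₂.IsSmooth)
    (h : ∀ x, ∃ η : OneForm E M, η.IsSmoothAt x ∧ (∀ᶠ z in 𝓝 x, IsAdaptedAt ε ω₁ ω₂ η z) ∧
      wedge₁₂ ω₁ (wedge ω₂ η) x ≠ 0 ∧ η.d x = K x • wedge ω₁ ω₂ x) :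
    HasStructureEquations ε ω₁ ω₂ K := by
  choose η hη ha hn hd using h
  -- The global form takes at x the value of the local solution chosen for x. By pointwise
  -- uniqueness it agrees with that solution on a whole neighbourhood, so smoothness and the
  -- exterior derivative can be read off there.
  let ω₃ : OneForm E M := fun x => η x x
  have h0 : ∀ x, ∃ v w, wedge ω₁ ω₂ x v w ≠ 0 := fun x => exists_wedge_ne_zero_of_nondeg (hn x)
  have heq : ∀ x, ∀ᶠ z in 𝓝 x, η x z = ω₃ z := fun x => (ha x).mono fun z hz =>
    hz.unique (ha z).self_of_nhds (h0 z)
  have h₃ : ω₃.IsSmooth := OneForm.isSmooth_iff.2 fun x => (hη x).congr (heq x)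
  have had : ∀ x, IsAdaptedAt ε ω₁ ω₂ ω₃ x := fun x =>
    (ha x).self_of_nhds.congr (heq x).self_of_nhds
  have hd₃ : ∀ x, ω₃.d x = K x • wedge ω₁ ω₂ x := fun x => by
    rw [← OneForm.d_congr (heq x), hd]
  refine ⟨contMDiff_of_d_eq_smul_wedge h₁ h₂ h₃ hd₃ h0, ω₃, ⟨h₁, h₂, h₃, hn⟩,
    isAdapted_iff.2 had, hd₃, fun η' h' => funext fun x => ?_⟩
  exact (isAdapted_iff.1 h' x).unique (had x) (h0 x)

end Coframes

/-! ### Gauss curvature from an orthonormal coframe and its connection form -/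

section Curvature

theorem partialD_congr {f f' : E2 → ℝ} {y : E2} (h : f =ᶠ[𝓝 y] f') (i : Fin 2) :
    partialD i f y = partialD i f' y := by
  simp only [partialD, h.fderiv_eq]

theorem partialD_add {f f' : E2 → ℝ} {y : E2} (h : DifferentiableAt ℝ f y)
    (h' : DifferentiableAt ℝ f' y) (i : Fin 2) :
    partialD i (fun z => f z + f' z) y = partialD i f y + partialD i f' y := by
  simp only [partialD, fderiv_fun_add h h']
  rfl

theorem partialD_const_mul {f : E2 → ℝ} {y : E2} (h : DifferentiableAt ℝ f y) (c : ℝ)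
    (i : Fin 2) : partialD i (fun z => c * f z) y = c * partialD i f y := by
  simp only [partialD, fderiv_const_mul h]
  rfl

theorem partialD_mul {f f' : E2 → ℝ} {y : E2} (h : DifferentiableAt ℝ f y)
    (h' : DifferentiableAt ℝ f' y) (i : Fin 2) :
    partialD i (fun z => f z * f' z) y = partialD i f y * f' y + f y * partialD i f' y := by
  simp only [partialD, fderiv_fun_mul h h']
  simp
  ring

theorem partialD_comm {f : E2 → ℝ} {y : E2} (h : ContDiffAt ℝ ∞ f y) (i j : Fin 2) :
    partialD i (partialD j f) y = partialD j (partialD i f) y := by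
  have d : DifferentiableAt ℝ (fderiv ℝ f) y :=
    (h.fderiv_right (m := 1) (by norm_cast)).differentiableAt (by simp)
  have hs : IsSymmSndFDerivAt ℝ f y := h.isSymmSndFDerivAt (by simp; norm_cast)
  have e : ∀ i j, partialD i (partialD j f) y = fderiv ℝ (fderiv ℝ f) y (stdVec i) (stdVec j) :=
    fun i j => by
      have := (d.hasFDerivAt.clm_apply (hasFDerivAt_const (stdVec j) y)).fderiv
      change fderiv ℝ (fun z => fderiv ℝ f z (stdVec j)) y (stdVec i) = _
      rw [this]
      simp
  rw [e, e, hs.eq]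

theorem ContDiffAt.partialD {f : E2 → ℝ} {y : E2} (h : ContDiffAt ℝ ∞ f y) (i : Fin 2) :
    ContDiffAt ℝ ∞ (BiContact.partialD i f) y :=
  (h.fderiv_right (by norm_cast)).clm_apply contDiffAt_const

variable {ε : ℤˣ} {S : Type*} [TopologicalSpace S] [ChartedSpace E2 S]
  [IsManifold 𝓘(ℝ, E2) ∞ S]

/-- Components `a`, `b` of an orthonormal coframe and `γ` of its connection form, in the chart at
`x`, on the open set `V`. -/
structure CoframeComponents (g : SurfaceMetric ε S) (x : S) (V : Set E2)
    (a b γ : Fin 2 → E2 → ℝ) : Prop where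
  isOpen : IsOpen V
  smooth_a : ∀ i, ∀ y ∈ V, ContDiffAt ℝ ∞ (a i) y
  smooth_b : ∀ i, ∀ y ∈ V, ContDiffAt ℝ ∞ (b i) y
  smooth_γ : ∀ i, ∀ y ∈ V, ContDiffAt ℝ ∞ (γ i) y
  indep : ∀ y ∈ V, a 0 y * b 1 y - a 1 y * b 0 y ≠ 0
  matrix : ∀ y ∈ V, ∀ i j, g.matrix x y i j = a i y * a j y - sgn ε * (b i y * b j y)
  torsion_a : ∀ y ∈ V, ∀ i j,
    partialD i (a j) y - partialD j (a i) y = b i y * γ j y - b j y * γ i y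
  torsion_b : ∀ y ∈ V, ∀ i j,
    partialD i (b j) y - partialD j (b i) y = sgn ε * (a i y * γ j y - a j y * γ i y)

namespace CoframeComponents

variable {g : SurfaceMetric ε S} {x : S} {V : Set E2} {a b γ : Fin 2 → E2 → ℝ}

/-- The Gram matrix is Aᵀ diag(1, -ε) A, where A is the matrix of the coframe. -/
theorem det_eq (h : CoframeComponents g x V a b γ) {y : E2} (hy : y ∈ V) :
    (g.matrix x y).det = -sgn ε * (a 0 y * b 1 y - a 1 y * b 0 y) ^ 2 := by
  have hε := sgn_mul_self ε
  rw [Matrix.det_fin_two]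
  simp only [h.matrix y hy]
  linear_combination (b 0 y * b 0 y * b 1 y * b 1 y - b 0 y * b 1 y * b 1 y * b 0 y) * hε

theorem partialD_matrix (h : CoframeComponents g x V a b γ) {y : E2} (hy : y ∈ V) (n i j : Fin 2) :
    partialD n (fun z => g.matrix x z i j) y
      = partialD n (a i) y * a j y + a i y * partialD n (a j) y
        - sgn ε * (partialD n (b i) y * b j y + b i y * partialD n (b j) y) := by
  have da := fun i => (h.smooth_a i y hy).differentiableAt (by simp)
  have db := fun i => (h.smooth_b i y hy).differentiableAt (by simp)
  have e : (fun z => g.matrix x z i j) =ᶠ[𝓝 y]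
      fun z => a i z * a j z + (-sgn ε) * (b i z * b j z) := by
    filter_upwards [h.isOpen.mem_nhds hy] with z hz
    rw [h.matrix z hz]
    ring
  rw [partialD_congr e, partialD_add ((da i).fun_mul (da j)) (((db i).fun_mul (db j)).const_mul _),
    partialD_const_mul ((db i).fun_mul (db j)), partialD_mul (da i) (da j),
    partialD_mul (db i) (db j)]
  ring

/-- These equations say ∇a = -γ ⊗ b and ∇b = -ε γ ⊗ a. Such a connection preserves a² - ε b², and by
the torsion equations it is torsion free, so it must be the Levi-Civita connection given by the
Christoffel formula. -/
theorem christoffel_spec (h : CoframeComponents g x V a b γ) {y : E2} (hy : y ∈ V) (i j : Fin 2) :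
    (∑ l, a l y * g.christoffel x l i j y = partialD i (a j) y + γ i y * b j y) ∧
    (∑ l, b l y * g.christoffel x l i j y
      = partialD i (b j) y + sgn ε * (γ i y * a j y)) := by
  have hε := sgn_mul_self ε
  have hm := h.indep y hy
  have hu : IsUnit (g.matrix x y).det := by
    rw [h.det_eq hy, isUnit_iff_ne_zero]
    refine mul_ne_zero (neg_ne_zero.2 fun h0 => ?_) (pow_ne_zero 2 hm)
    simp [h0] at hε
  have hinv := Matrix.mul_nonsing_inv (g.matrix x y) hu
  have key : ∀ n, ∑ l, g.matrix x y n l * g.christoffel x l i j y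
      = (1 / 2) * (partialD i (fun z => g.matrix x z j n) y
        + partialD j (fun z => g.matrix x z i n) y - partialD n (fun z => g.matrix x z i j) y) := by
    intro n
    have k := fun l => congrFun (congrFun hinv n) l
    have k0 := k 0
    have k1 := k 1
    simp only [Matrix.mul_apply, Fin.sum_univ_two, Matrix.one_apply] at k0 k1
    simp only [SurfaceMetric.christoffel, Fin.sum_univ_two]
    set Γ : Fin 2 → ℝ := fun l => partialD i (fun z => g.matrix x z j l) y
        + partialD j (fun z => g.matrix x z i l) y - partialD l (fun z => g.matrix x z i j) y with hΓ
    change _ = 1 / 2 * Γ n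
    have hn : Γ n = (if n = 0 then 1 else 0) * Γ 0 + (if n = 1 then 1 else 0) * Γ 1 := by
      fin_cases n <;> simp
    rw [hn]
    linear_combination (1 / 2 * Γ 0) * k0 + (1 / 2 * Γ 1) * k1
  have ta := h.torsion_a y hy
  have tb := h.torsion_b y hy
  -- The errors in the two claimed identities satisfy a homogeneous linear system, one equation for
  -- each n. Its determinant is -ε times the density of the coframe, so both errors vanish.
  have lin : ∀ n, a n y * ((∑ l, a l y * g.christoffel x l i j y)
        - (partialD i (a j) y + γ i y * b j y))
      - sgn ε * (b n y * ((∑ l, b l y * g.christoffel x l i j y)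
        - (partialD i (b j) y + sgn ε * (γ i y * a j y)))) = 0 := by
    intro n
    have k := key n
    simp only [h.matrix y hy, h.partialD_matrix hy, Fin.sum_univ_two] at k ⊢
    linear_combination k + (1 / 2) * (a j y * ta i n + a i y * ta j n - a n y * ta i j)
      - (sgn ε / 2) * (b j y * tb i n + b i y * tb j n - b n y * tb i j)
      + (1 / 2) * (- b j y * (a i y * γ n y - a n y * γ i y)
        - b i y * (a j y * γ n y - a n y * γ j y)
        + b n y * (a i y * γ j y - a j y * γ i y) + 2 * b n y * γ i y * a j y) * hε
  have l0 := lin 0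
  have l1 := lin 1
  constructor
  · refine sub_eq_zero.1 ((mul_eq_zero.1 (?_ : (a 0 y * b 1 y - a 1 y * b 0 y) * _ = 0)).resolve_left hm)
    linear_combination b 1 y * l0 - b 0 y * l1
  · refine sub_eq_zero.1 ((mul_eq_zero.1 (?_ : (a 0 y * b 1 y - a 1 y * b 0 y) * _ = 0)).resolve_left hm)
    linear_combination sgn ε * (a 1 y * l0 - a 0 y * l1) - (a 0 y * b 1 y - a 1 y * b 0 y) *
      ((∑ l, b l y * g.christoffel x l i j y)
        - (partialD i (b j) y + sgn ε * (γ i y * a j y))) * hε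

/-- Cramer's rule applied to `christoffel_spec` presents the symbols as quotients of smooth
functions. -/
theorem contDiffAt_christoffel (h : CoframeComponents g x V a b γ) {y : E2} (hy : y ∈ V)
    (l i j : Fin 2) : ContDiffAt ℝ ∞ (g.christoffel x l i j) y := by
  have ca := fun i => h.smooth_a i y hy
  have cb := fun i => h.smooth_b i y hy
  have cγ := fun i => h.smooth_γ i y hy
  have cm : ContDiffAt ℝ ∞ (fun z => a 0 z * b 1 z - a 1 z * b 0 z) y :=
    ((ca 0).mul (cb 1)).sub ((ca 1).mul (cb 0))
  have cp : ContDiffAt ℝ ∞ (fun z => partialD i (a j) z + γ i z * b j z) y :=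
    (ContDiffAt.partialD (ca j) i).add ((cγ i).mul (cb j))
  have cq : ContDiffAt ℝ ∞ (fun z => partialD i (b j) z + sgn ε * (γ i z * a j z)) y :=
    (ContDiffAt.partialD (cb j) i).add (contDiffAt_const.mul ((cγ i).mul (ca j)))
  fin_cases l
  · refine ((((cb 1).mul cp).sub ((ca 1).mul cq)).div cm (h.indep y hy)).congr_of_eventuallyEq ?_
    filter_upwards [h.isOpen.mem_nhds hy] with z hz
    obtain ⟨e₁, e₂⟩ := h.christoffel_spec hz i j
    rw [Fin.sum_univ_two] at e₁ e₂
    change g.christoffel x 0 i j z = _ / _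
    rw [eq_div_iff (h.indep z hz)]
    dsimp only
    rw [← e₁, ← e₂]
    ring
  · refine ((((ca 0).mul cq).sub ((cb 0).mul cp)).div cm (h.indep y hy)).congr_of_eventuallyEq ?_
    filter_upwards [h.isOpen.mem_nhds hy] with z hz
    obtain ⟨e₁, e₂⟩ := h.christoffel_spec hz i j
    rw [Fin.sum_univ_two] at e₁ e₂
    change g.christoffel x 1 i j z = _ / _
    rw [eq_div_iff (h.indep z hz)]
    dsimp only
    rw [← e₁, ← e₂]
    ring

theorem partialD_christoffel (h : CoframeComponents g x V a b γ) {y : E2} (hy : y ∈ V)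
    (n i j : Fin 2) :
    (∑ l, (partialD n (a l) y * g.christoffel x l i j y
        + a l y * partialD n (g.christoffel x l i j) y)
      = partialD n (partialD i (a j)) y + (partialD n (γ i) y * b j y + γ i y * partialD n (b j) y)) ∧
    (∑ l, (partialD n (b l) y * g.christoffel x l i j y
        + b l y * partialD n (g.christoffel x l i j) y)
      = partialD n (partialD i (b j)) y
        + sgn ε * (partialD n (γ i) y * a j y + γ i y * partialD n (a j) y)) := by
  have da := fun i => (h.smooth_a i y hy).differentiableAt (by simp)
  have db := fun i => (h.smooth_b i y hy).differentiableAt (by simp)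
  have dγ := fun i => (h.smooth_γ i y hy).differentiableAt (by simp)
  have dΓ := fun l => (h.contDiffAt_christoffel hy l i j).differentiableAt (by simp)
  have dpa := (ContDiffAt.partialD (h.smooth_a j y hy) i).differentiableAt (by simp)
  have dpb := (ContDiffAt.partialD (h.smooth_b j y hy) i).differentiableAt (by simp)
  have e₁ : (fun z => a 0 z * g.christoffel x 0 i j z + a 1 z * g.christoffel x 1 i j z) =ᶠ[𝓝 y]
      fun z => partialD i (a j) z + γ i z * b j z := by
    filter_upwards [h.isOpen.mem_nhds hy] with z hz
    rw [← (h.christoffel_spec hz i j).1, Fin.sum_univ_two]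
  have e₂ : (fun z => b 0 z * g.christoffel x 0 i j z + b 1 z * g.christoffel x 1 i j z) =ᶠ[𝓝 y]
      fun z => partialD i (b j) z + sgn ε * (γ i z * a j z) := by
    filter_upwards [h.isOpen.mem_nhds hy] with z hz
    rw [← (h.christoffel_spec hz i j).2, Fin.sum_univ_two]
  have k₁ := partialD_congr e₁ n
  have k₂ := partialD_congr e₂ n
  rw [partialD_add ((da 0).fun_mul (dΓ 0)) ((da 1).fun_mul (dΓ 1)), partialD_mul (da 0) (dΓ 0),
    partialD_mul (da 1) (dΓ 1), partialD_add dpa ((dγ i).fun_mul (db j)),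
    partialD_mul (dγ i) (db j)] at k₁
  rw [partialD_add ((db 0).fun_mul (dΓ 0)) ((db 1).fun_mul (dΓ 1)), partialD_mul (db 0) (dΓ 0),
    partialD_mul (db 1) (dΓ 1), partialD_add dpb (((dγ i).fun_mul (da j)).const_mul _),
    partialD_const_mul ((dγ i).fun_mul (da j)), partialD_mul (dγ i) (da j)] at k₂
  rw [Fin.sum_univ_two, Fin.sum_univ_two]
  exact ⟨k₁, k₂⟩

/-- The Gauss curvature in terms of the connection form. -/
theorem gaussCurvature_eq (h : CoframeComponents g x V a b γ)
    (hx : extChartAt 𝓘(ℝ, E2) x x ∈ V) :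
    partialD 0 (γ 1) (extChartAt 𝓘(ℝ, E2) x x) - partialD 1 (γ 0) (extChartAt 𝓘(ℝ, E2) x x)
      = -sgn ε * g.gaussCurvature x
        * (a 0 (extChartAt 𝓘(ℝ, E2) x x) * b 1 (extChartAt 𝓘(ℝ, E2) x x)
          - a 1 (extChartAt 𝓘(ℝ, E2) x x) * b 0 (extChartAt 𝓘(ℝ, E2) x x)) := by
  have hε := sgn_mul_self ε
  have hε0 : sgn ε ≠ 0 := fun h0 => by simp [h0] at hε
  unfold SurfaceMetric.gaussCurvature
  rw [h.det_eq hx]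
  generalize extChartAt 𝓘(ℝ, E2) x x = y at *
  have hm := h.indep y hx
  obtain ⟨a₁, b₁⟩ := h.partialD_christoffel hx 0 1 1
  obtain ⟨a₂, b₂⟩ := h.partialD_christoffel hx 1 0 1
  have s₁ := partialD_comm (h.smooth_a 1 y hx) 0 1
  have s₂ := partialD_comm (h.smooth_b 1 y hx) 0 1
  have c := fun i j => h.christoffel_spec hx i j
  have c00 := c 0 0
  have c01 := c 0 1
  have c10 := c 1 0
  have c11 := c 1 1
  simp only [Fin.sum_univ_two] at a₁ b₁ a₂ b₂ c00 c01 c10 c11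
  -- This is the second structure equation a(R(∂₀, ∂₁)∂₁) = dγ(∂₀, ∂₁) b(∂₁). The second derivatives
  -- of a cancel by symmetry, and the terms quadratic in γ cancel because a single form γ describes
  -- the whole connection.
  have ha : a 0 y * g.riemann x 0 1 0 1 y + a 1 y * g.riemann x 1 1 0 1 y
      = (partialD 0 (γ 1) y - partialD 1 (γ 0) y) * b 1 y := by
    simp only [SurfaceMetric.riemann, Fin.sum_univ_two]
    linear_combination a₁ - a₂ + s₁ + g.christoffel x 0 1 1 y * c00.1 + g.christoffel x 1 1 1 y * c01.1
      - g.christoffel x 0 0 1 y * c10.1 - g.christoffel x 1 0 1 y * c11.1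
      + γ 0 y * c11.2 - γ 1 y * c01.2
  have hb : b 0 y * g.riemann x 0 1 0 1 y + b 1 y * g.riemann x 1 1 0 1 y
      = sgn ε * (partialD 0 (γ 1) y - partialD 1 (γ 0) y) * a 1 y := by
    simp only [SurfaceMetric.riemann, Fin.sum_univ_two]
    linear_combination b₁ - b₂ + s₂ + g.christoffel x 0 1 1 y * c00.2 + g.christoffel x 1 1 1 y * c01.2
      - g.christoffel x 0 0 1 y * c10.2 - g.christoffel x 1 0 1 y * c11.2
      + sgn ε * γ 0 y * c11.1 - sgn ε * γ 1 y * c01.1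
  simp only [Fin.sum_univ_two, h.matrix y hx]
  -- With m the density of the coframe, the numerator of the Gauss curvature is dγ(∂₀, ∂₁) m and its
  -- denominator is -ε m², which explains the factor -ε in the conclusion.
  have hnum : g.riemann x 0 1 0 1 y * (a 0 y * a 0 y - sgn ε * (b 0 y * b 0 y))
      + g.riemann x 1 1 0 1 y * (a 1 y * a 0 y - sgn ε * (b 1 y * b 0 y))
      = (partialD 0 (γ 1) y - partialD 1 (γ 0) y) * (a 0 y * b 1 y - a 1 y * b 0 y) := by
    linear_combination a 0 y * ha - sgn ε * b 0 y * hb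
      - (partialD 0 (γ 1) y - partialD 1 (γ 0) y) * (a 1 y * b 0 y) * hε
  rw [hnum]
  field_simp

end CoframeComponents

end Curvature

/-! ### Structure equations tested in one chart, and rules for the flat exterior derivative -/

section LocalCharts

variable {E : Type*} [NormedAddCommGroup E] [NormedSpace ℝ E]
  {M : Type*} [TopologicalSpace M] [ChartedSpace E M] [IsManifold 𝓘(ℝ, E) ∞ M]
  {ε : ℤˣ} {ω₁ ω₂ : OneForm E M}

theorem OneForm.eq_pullback_inChart (η : OneForm E M) (x : M) {z : M}
    (hz : z ∈ (extChartAt 𝓘(ℝ, E) x).source) :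
    η z = pullback (E := E) (extChartAt 𝓘(ℝ, E) x) (η.inChart x : OneForm E E) z := by
  have hφ : ContMDiffAt 𝓘(ℝ, E) 𝓘(ℝ, E) ∞ (extChartAt 𝓘(ℝ, E) x) z :=
    contMDiffAt_extChartAt' (by simpa using hz)
  have hs := contMDiffAt_extChartAt_symm_self (E := E) x ((extChartAt 𝓘(ℝ, E) x).map_source hz)
  have h := pullback_comp (E := E) (f := extChartAt 𝓘(ℝ, E) x) (x := z) η
    (hs.mdifferentiableAt (by simp)) (hφ.mdifferentiableAt (by simp))
  rw [pullback_id_of_eventuallyEq] at h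
  · exact h
  · filter_upwards [extChartAt_source_mem_nhds' (I := 𝓘(ℝ, E)) hz] with t ht
    exact (extChartAt 𝓘(ℝ, E) x).left_inv ht

/-- Structure equations verified in the preferred charts. -/
theorem hasStructureEquations_of_charts {K : M → ℝ} (h₁ : ω₁.IsSmooth) (h₂ : ω₂.IsSmooth)
    (h : ∀ x, ∃ τ : E → E →L[ℝ] ℝ, ContDiffAt ℝ ∞ τ (extChartAt 𝓘(ℝ, E) x x) ∧
      (∀ᶠ y in 𝓝 (extChartAt 𝓘(ℝ, E) x x), ∀ v w : E,
        extDerivFlat (ω₁.inChart x) y v w = ω₂.inChart x y v * τ y w - ω₂.inChart x y w * τ y v ∧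
        extDerivFlat (ω₂.inChart x) y v w
          = sgn ε * (ω₁.inChart x y v * τ y w - ω₁.inChart x y w * τ y v)) ∧
      (wedge₁₂ (M := E) (ω₁.inChart x) (wedge (M := E) (ω₂.inChart x) τ)
        (extChartAt 𝓘(ℝ, E) x x) ≠ 0) ∧
      ∀ v w : E, extDerivFlat τ (extChartAt 𝓘(ℝ, E) x x) v w
        = K x * (ω₁.inChart x (extChartAt 𝓘(ℝ, E) x x) v * ω₂.inChart x (extChartAt 𝓘(ℝ, E) x x) w
          - ω₁.inChart x (extChartAt 𝓘(ℝ, E) x x) w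
            * ω₂.inChart x (extChartAt 𝓘(ℝ, E) x x) v)) :
    HasStructureEquations ε ω₁ ω₂ K := by
  refine hasStructureEquations_of_local h₁ h₂ fun x => ?_
  obtain ⟨τ, hτ, hd, hn, hK⟩ := h x
  rw [OneForm.isSmooth_iff] at h₁ h₂
  have hφ : ∀ z ∈ (extChartAt 𝓘(ℝ, E) x).source,
      ContMDiffAt 𝓘(ℝ, E) 𝓘(ℝ, E) ∞ (extChartAt 𝓘(ℝ, E) x) z := fun z hz =>
    contMDiffAt_extChartAt' (by simpa using hz)
  have hx := mem_extChartAt_source (I := 𝓘(ℝ, E)) x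
  -- The exterior derivative at z is defined through the preferred chart at z. Naturality moves the
  -- computation to the fixed chart at x.
  have hdz : ∀ η : OneForm E M, (∀ x, η.IsSmoothAt x) → ∀ z ∈ (extChartAt 𝓘(ℝ, E) x).source,
      ∀ v w, η.d z v w = extDerivFlat (η.inChart x) (extChartAt 𝓘(ℝ, E) x z)
        (mfderiv 𝓘(ℝ, E) 𝓘(ℝ, E) (extChartAt 𝓘(ℝ, E) x) z v)
        (mfderiv 𝓘(ℝ, E) 𝓘(ℝ, E) (extChartAt 𝓘(ℝ, E) x) z w) := by
    intro η hη z hz v w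
    have hsm : OneForm.IsSmoothAt (η.inChart x : OneForm E E) (extChartAt 𝓘(ℝ, E) x z) :=
      (hη _).pullback (contMDiffAt_extChartAt_symm_self x ((extChartAt 𝓘(ℝ, E) x).map_source hz))
    have e := (d_pullback (hφ z hz) hsm v w).trans (OneForm.d_model _ _ _ _)
    have := OneForm.d_congr (η := η)
      (η' := pullback (E := E) (extChartAt 𝓘(ℝ, E) x) (η.inChart x : OneForm E E)) (x := z) (by
        filter_upwards [extChartAt_source_mem_nhds' (I := 𝓘(ℝ, E)) hz] with t ht
        exact η.eq_pullback_inChart x ht)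
    rw [this]
    exact e
  have hτ' : OneForm.IsSmoothAt (τ : OneForm E E) (extChartAt 𝓘(ℝ, E) x x) :=
    OneForm.isSmoothAt_model.2 hτ
  refine ⟨pullback (E := E) (extChartAt 𝓘(ℝ, E) x) (τ : OneForm E E), hτ'.pullback (hφ x hx),
    ?_, ?_, ?_⟩
  · filter_upwards [(hφ x hx).continuousAt hd, extChartAt_source_mem_nhds (I := 𝓘(ℝ, E)) x]
      with z hz hzs
    constructor
    · funext v w
      refine (hdz ω₁ h₁ z hzs v w).trans ((hz _ _).1.trans ?_)
      simp only [wedge, ω₂.eq_pullback_inChart x hzs]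
      rfl
    · funext v w
      refine (hdz ω₂ h₂ z hzs v w).trans ((hz _ _).2.trans ?_)
      simp only [wedge, ω₁.eq_pullback_inChart x hzs, Pi.smul_apply, smul_eq_mul]
      rfl
  · intro h0
    apply hn
    have hsurj : Function.Surjective (mfderiv 𝓘(ℝ, E) 𝓘(ℝ, E) (extChartAt 𝓘(ℝ, E) x) x) :=
      (isInvertible_mfderiv_extChartAt hx).bijective.surjective
    funext u v w
    obtain ⟨u, rfl⟩ := hsurj u
    obtain ⟨v, rfl⟩ := hsurj v
    obtain ⟨w, rfl⟩ := hsurj w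
    have k := congrFun (congrFun₂ h0 u v) w
    simp only [wedge₁₂, wedge, ω₁.eq_pullback_inChart x hx, ω₂.eq_pullback_inChart x hx] at k
    exact k
  · funext v w
    refine (d_pullback (hφ x hx) hτ' v w).trans ((OneForm.d_model _ _ _ _).trans ((hK _ _).trans ?_))
    simp only [wedge, ω₁.eq_pullback_inChart x hx, ω₂.eq_pullback_inChart x hx, Pi.smul_apply,
      smul_eq_mul]
    rfl

variable {E' : Type*} [NormedAddCommGroup E'] [NormedSpace ℝ E']

theorem extDerivFlat_add {α β : E → E →L[ℝ] ℝ} {y : E} (hα : DifferentiableAt ℝ α y)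
    (hβ : DifferentiableAt ℝ β y) (v w : E) :
    extDerivFlat (fun z => α z + β z) y v w = extDerivFlat α y v w + extDerivFlat β y v w := by
  simp only [extDerivFlat, fderiv_fun_add hα hβ, add_apply]
  ring

theorem extDerivFlat_smul {f : E → ℝ} {α : E → E →L[ℝ] ℝ} {y : E} (hf : DifferentiableAt ℝ f y)
    (hα : DifferentiableAt ℝ α y) (v w : E) :
    extDerivFlat (fun z => f z • α z) y v w
      = f y * extDerivFlat α y v w + fderiv ℝ f y v * α y w - fderiv ℝ f y w * α y v := by
  simp only [extDerivFlat, fderiv_fun_smul hf hα, add_apply, smul_apply, smul_eq_mul,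
    ContinuousLinearMap.smulRight_apply]
  ring

theorem extDerivFlat_const (L : E →L[ℝ] ℝ) (y v w : E) : extDerivFlat (fun _ => L) y v w = 0 := by
  simp [extDerivFlat]

theorem extDerivFlat_comp_fst {α : E → E →L[ℝ] ℝ} {p : E × E'} (hα : ContDiffAt ℝ ∞ α p.1)
    (v w : E × E') :
    extDerivFlat (fun z : E × E' => (α z.1).comp (ContinuousLinearMap.fst ℝ E E')) p v w
      = extDerivFlat α p.1 v.1 w.1 := by
  have h := extDerivFlat_pullback (F := (Prod.fst : E × E' → E)) (y := p) hα contDiffAt_fst v w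
  simp only [fderiv_fst] at h
  exact h

theorem E2.eq_sum (v : E2) : v = v 0 • stdVec 0 + v 1 • stdVec 1 := by
  ext i
  fin_cases i <;> simp [stdVec]

theorem E2.extDerivFlat_eq (α : E2 → E2 →L[ℝ] ℝ) (y v w : E2) :
    extDerivFlat α y v w = (v 0 * w 1 - v 1 * w 0) * extDerivFlat α y (stdVec 0) (stdVec 1) := by
  conv_lhs => rw [E2.eq_sum v, E2.eq_sum w]
  simp only [extDerivFlat, map_add, map_smul, add_apply, smul_apply, smul_eq_mul]
  ring

theorem E2.wedge_eq (α β : E2 →L[ℝ] ℝ) (v w : E2) :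
    α v * β w - α w * β v = (v 0 * w 1 - v 1 * w 0) *
      (α (stdVec 0) * β (stdVec 1) - α (stdVec 1) * β (stdVec 0)) := by
  conv_lhs => rw [E2.eq_sum v, E2.eq_sum w]
  simp only [map_add, map_smul, smul_eq_mul]
  ring

theorem partialD_apply_stdVec {α : E2 → E2 →L[ℝ] ℝ} {y : E2} (hα : DifferentiableAt ℝ α y)
    (i j : Fin 2) :
    partialD i (fun z => α z (stdVec j)) y = fderiv ℝ α y (stdVec i) (stdVec j) := by
  simp only [partialD]
  rw [(hα.hasFDerivAt.clm_apply (hasFDerivAt_const (stdVec j) y)).fderiv]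
  simp

end LocalCharts

/-! ### The coframe and connection form of a local orthonormal frame field -/

section SolderForms

variable {ε : ℤˣ} {S : Type*} [TopologicalSpace S] [ChartedSpace E2 S]
  [IsManifold 𝓘(ℝ, E2) ∞ S] {g : SurfaceMetric ε S}

/-- The metric in terms of an orthonormal pair. -/
theorem SurfaceMetric.inner_eq (g : SurfaceMetric ε S) {x : S} {a b : TangentSpace 𝓘(ℝ, E2) x}
    (h₁ : g.inner x a a = 1) (h₂ : g.inner x a b = 0) (h₃ : g.inner x b b = -sgn ε)
    (v w : TangentSpace 𝓘(ℝ, E2) x) :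
    g.inner x v w = g.inner x a v * g.inner x a w
      - sgn ε * ((-sgn ε * g.inner x b v) * (-sgn ε * g.inner x b w)) := by
  have hε := sgn_mul_self ε
  have e := congrArg (fun z => g.inner x z w) (g.expand h₁ h₂ h₃ v)
  simp only [map_add, map_smul, add_apply, smul_apply, smul_eq_mul, g.symm x v a,
    g.symm x v b] at e
  rw [e]
  linear_combination (sgn ε * g.inner x b v * g.inner x b w) * hε

/-- The local orthonormal frame field that defines the preferred chart at an orthonormal frame. -/
def OFrame.localFrame (u : OFrame g) : LocalFrame g u := (exists_localFrame g u).some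

theorem OFrame.extChartAt_symm_apply (u : OFrame g) (p : E2 × ℝ) :
    (extChartAt 𝓘(ℝ, E2 × ℝ) u).symm p = u.localFrame.chart.symm p := rfl

theorem OFrame.target_extChartAt (u : OFrame g) :
    (extChartAt 𝓘(ℝ, E2 × ℝ) u).target = u.localFrame.chart.target := by
  rw [extChartAt_target]
  simp only [modelWithCornersSelf_coe_symm, preimage_id_eq, id_eq, modelWithCornersSelf_coe,
    range_id, inter_univ]
  rfl

/-- In the charts at u and at its base point this map is the projection to the first factor. -/
theorem OFrame.contMDiff_pt : ContMDiff 𝓘(ℝ, E2 × ℝ) 𝓘(ℝ, E2) ∞ (OFrame.pt (g := g)) := by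
  intro u
  have h₁ : ContMDiffAt 𝓘(ℝ, E2 × ℝ) 𝓘(ℝ, E2 × ℝ) ∞ (extChartAt 𝓘(ℝ, E2 × ℝ) u) u :=
    contMDiffAt_extChartAt
  have h₂ : ContMDiffAt 𝓘(ℝ, E2 × ℝ) 𝓘(ℝ, E2) ∞ (Prod.fst : E2 × ℝ → E2)
      (extChartAt 𝓘(ℝ, E2 × ℝ) u u) := contDiffAt_fst.contMDiffAt
  have h₃ := contMDiffAt_extChartAt_symm_self (E := E2) u.pt (mem_extChartAt_target u.pt)
  refine (ContMDiffAt.comp u (g := (extChartAt 𝓘(ℝ, E2) u.pt).symm) h₃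
    (h₂.comp u h₁)).congr_of_eventuallyEq ?_
  filter_upwards [extChartAt_source_mem_nhds (I := 𝓘(ℝ, E2 × ℝ)) u] with z hz
  exact ((extChartAt 𝓘(ℝ, E2) u.pt).left_inv
    (by simpa using u.localFrame.subset hz.1.1)).symm

namespace LocalFrame

variable {u : OFrame g} (D : LocalFrame g u)

/-- The first form of the coframe dual to a local frame field. -/
def coframe₁ : OneForm E2 S := fun x => g.inner x (D.X₁ x)

/-- The second form of the coframe dual to a local frame field. -/
def coframe₂ : OneForm E2 S := fun x => (-sgn ε) • g.inner x (D.X₂ x)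

/-- The open set, in the chart at the base point, over which the frame field is defined. -/
def domain : Set E2 :=
  (extChartAt 𝓘(ℝ, E2) u.pt).target ∩ (extChartAt 𝓘(ℝ, E2) u.pt).symm ⁻¹' D.U

theorem isOpen_domain : IsOpen D.domain :=
  (continuousOn_extChartAt_symm (I := 𝓘(ℝ, E2)) u.pt).isOpen_inter_preimage
    (isOpen_extChartAt_target u.pt) D.isOpen

theorem mem_domain : extChartAt 𝓘(ℝ, E2) u.pt u.pt ∈ D.domain :=
  ⟨mem_extChartAt_target u.pt, by
    change (extChartAt 𝓘(ℝ, E2) u.pt).symm _ ∈ D.U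
    rw [extChartAt_to_inv]
    exact D.mem⟩

theorem isSmoothAt_inner {U : Set S} (hU : IsOpen U) {X : ∀ x : S, TangentSpace 𝓘(ℝ, E2) x}
    (hX : ContMDiffOn 𝓘(ℝ, E2) (𝓘(ℝ, E2).prod 𝓘(ℝ, E2)) ∞
      (fun x => TotalSpace.mk' E2 (E := fun x : S => TangentSpace 𝓘(ℝ, E2) x) x (X x)) U)
    {x : S} (hx : x ∈ U) :
    OneForm.IsSmoothAt (E := E2) (M := S) (fun x => g.inner x (X x)) x := by
  rw [OneForm.isSmoothAt_iff]
  have h := ContMDiffOn.clm_bundle_apply (F₁ := E2) (F₂ := E2 →L[ℝ] ℝ)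
    (E₁ := fun x : S => TangentSpace 𝓘(ℝ, E2) x)
    (E₂ := fun x : S => TangentSpace 𝓘(ℝ, E2) x →L[ℝ] ℝ)
    (b := fun x : S => x) (ϕ := fun x => g.inner x) (v := X) (s := U) g.smooth.contMDiffOn hX
  exact h.contMDiffAt (hU.mem_nhds hx)

theorem _root_.BiContact.OneForm.IsSmoothAt.const_smul {E : Type*} [NormedAddCommGroup E]
    [NormedSpace ℝ E] {M : Type*} [TopologicalSpace M] [ChartedSpace E M] {η : OneForm E M}
    {x : M} (h : η.IsSmoothAt x) (c : ℝ) :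
    OneForm.IsSmoothAt (E := E) (M := M) (fun z => c • η z) x := by
  have h' := ContDiffAt.const_smul c h
  exact h'

theorem contDiffAt_coframe₁ {y : E2} (hy : y ∈ D.domain) :
    ContDiffAt ℝ ∞ (D.coframe₁.inChart u.pt) y :=
  OneForm.isSmoothAt_model.1 ((isSmoothAt_inner D.isOpen D.smooth₁ hy.2).pullback
    (contMDiffAt_extChartAt_symm_self u.pt hy.1))

theorem contDiffAt_coframe₂ {y : E2} (hy : y ∈ D.domain) :
    ContDiffAt ℝ ∞ (D.coframe₂.inChart u.pt) y :=
  OneForm.isSmoothAt_model.1 (((isSmoothAt_inner D.isOpen D.smooth₂ hy.2).const_smul _).pullback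
    (contMDiffAt_extChartAt_symm_self u.pt hy.1))

theorem matrix_eq {y : E2} (hy : y ∈ D.domain) (i j : Fin 2) :
    g.matrix u.pt y i j = D.coframe₁.inChart u.pt y (stdVec i) * D.coframe₁.inChart u.pt y (stdVec j)
      - sgn ε * (D.coframe₂.inChart u.pt y (stdVec i) * D.coframe₂.inChart u.pt y (stdVec j)) :=
  g.inner_eq (D.g₁₁ _ hy.2) (D.g₁₂ _ hy.2) (D.g₂₂ _ hy.2) _ _

/-- The density of the coframe with respect to the coordinates. -/
def density (y : E2) : ℝ :=
  D.coframe₁.inChart u.pt y (stdVec 0) * D.coframe₂.inChart u.pt y (stdVec 1)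
    - D.coframe₁.inChart u.pt y (stdVec 1) * D.coframe₂.inChart u.pt y (stdVec 0)

/-- The coordinate vectors representing X₁ and X₂ have coframe matrix 1 in the relevant entries, so
the coframe has wedge 1 on them; this wedge is a multiple of the density. -/
theorem density_ne_zero {y : E2} (hy : y ∈ D.domain) : D.density y ≠ 0 := by
  have hsurj : Function.Surjective
      (mfderiv 𝓘(ℝ, E2) 𝓘(ℝ, E2) (extChartAt 𝓘(ℝ, E2) u.pt).symm y) := by
    have h := isInvertible_mfderivWithin_extChartAt_symm (I := 𝓘(ℝ, E2)) hy.1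
    rw [modelWithCornersSelf_coe, range_id, mfderivWithin_univ] at h
    exact h.bijective.surjective
  obtain ⟨v, hv⟩ := hsurj (D.X₁ ((extChartAt 𝓘(ℝ, E2) u.pt).symm y))
  obtain ⟨w, hw⟩ := hsurj (D.X₂ ((extChartAt 𝓘(ℝ, E2) u.pt).symm y))
  have e := E2.wedge_eq (D.coframe₁.inChart u.pt y) (D.coframe₂.inChart u.pt y) v w
  have a₁ : D.coframe₁.inChart u.pt y v = 1 := by
    change g.inner _ _ (mfderiv 𝓘(ℝ, E2) 𝓘(ℝ, E2) (extChartAt 𝓘(ℝ, E2) u.pt).symm y v) = 1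
    rw [hv, D.g₁₁ _ hy.2]
  have a₂ : D.coframe₁.inChart u.pt y w = 0 := by
    change g.inner _ _ (mfderiv 𝓘(ℝ, E2) 𝓘(ℝ, E2) (extChartAt 𝓘(ℝ, E2) u.pt).symm y w) = 0
    rw [hw, D.g₁₂ _ hy.2]
  have b₂ : D.coframe₂.inChart u.pt y w = 1 := by
    change -sgn ε * g.inner _ _ (mfderiv 𝓘(ℝ, E2) 𝓘(ℝ, E2) (extChartAt 𝓘(ℝ, E2) u.pt).symm y w) = 1
    rw [hw, D.g₂₂ _ hy.2]
    linear_combination sgn_mul_self ε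
  intro h0
  rw [a₁, a₂, b₂] at e
  unfold density at h0
  rw [h0] at e
  simp at e

/-- The connection form of the coframe, in the chart at the base point. -/
def connection (y : E2) : E2 →L[ℝ] ℝ :=
  -- For γ = p a + q b one has b ∧ γ = -p a ∧ b and ε a ∧ γ = ε q a ∧ b. Comparing with da and db
  -- determines p and q.
  (-(extDerivFlat (D.coframe₁.inChart u.pt) y (stdVec 0) (stdVec 1) / D.density y)) •
      D.coframe₁.inChart u.pt y
    + (sgn ε * (extDerivFlat (D.coframe₂.inChart u.pt) y (stdVec 0) (stdVec 1) / D.density y)) •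
      D.coframe₂.inChart u.pt y

theorem contDiffAt_density {y : E2} (hy : y ∈ D.domain) : ContDiffAt ℝ ∞ D.density y :=
  (((D.contDiffAt_coframe₁ hy).clm_apply contDiffAt_const).mul
    ((D.contDiffAt_coframe₂ hy).clm_apply contDiffAt_const)).sub
  (((D.contDiffAt_coframe₁ hy).clm_apply contDiffAt_const).mul
    ((D.contDiffAt_coframe₂ hy).clm_apply contDiffAt_const))

theorem contDiffAt_connection {y : E2} (hy : y ∈ D.domain) : ContDiffAt ℝ ∞ D.connection y := by
  have h₁ := D.contDiffAt_coframe₁ hy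
  have h₂ := D.contDiffAt_coframe₂ hy
  have hm := D.contDiffAt_density hy
  have h0 := D.density_ne_zero hy
  exact (((ContDiffAt.extDerivFlat h₁ _ _).div hm h0).neg.smul h₁).add
    ((contDiffAt_const.mul ((ContDiffAt.extDerivFlat h₂ _ _).div hm h0)).smul h₂)

theorem extDerivFlat_coframe₁ {y : E2} (hy : y ∈ D.domain) (v w : E2) :
    extDerivFlat (D.coframe₁.inChart u.pt) y v w
      = D.coframe₂.inChart u.pt y v * D.connection y w
        - D.coframe₂.inChart u.pt y w * D.connection y v := by
  have h0 := D.density_ne_zero hy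
  rw [E2.extDerivFlat_eq, E2.wedge_eq]
  simp only [connection, add_apply, smul_apply, smul_eq_mul]
  field_simp
  unfold density
  ring

theorem extDerivFlat_coframe₂ {y : E2} (hy : y ∈ D.domain) (v w : E2) :
    extDerivFlat (D.coframe₂.inChart u.pt) y v w
      = sgn ε * (D.coframe₁.inChart u.pt y v * D.connection y w
        - D.coframe₁.inChart u.pt y w * D.connection y v) := by
  have h0 := D.density_ne_zero hy
  have hε := sgn_mul_self ε
  rw [E2.extDerivFlat_eq, E2.wedge_eq]
  simp only [connection, add_apply, smul_apply, smul_eq_mul]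
  field_simp
  have e : sgn ε ^ 2 = 1 := by rw [sq, hε]
  unfold density
  ring_nf
  rw [e]
  ring

theorem coframeComponents : CoframeComponents g u.pt D.domain
    (fun i y => D.coframe₁.inChart u.pt y (stdVec i))
    (fun i y => D.coframe₂.inChart u.pt y (stdVec i)) (fun i y => D.connection y (stdVec i)) where
  isOpen := D.isOpen_domain
  smooth_a i y hy := (D.contDiffAt_coframe₁ hy).clm_apply contDiffAt_const
  smooth_b i y hy := (D.contDiffAt_coframe₂ hy).clm_apply contDiffAt_const
  smooth_γ i y hy := (D.contDiffAt_connection hy).clm_apply contDiffAt_const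
  indep y hy := D.density_ne_zero hy
  matrix y hy i j := D.matrix_eq hy i j
  torsion_a y hy i j := by
    have h := (D.contDiffAt_coframe₁ hy).differentiableAt (by simp)
    rw [partialD_apply_stdVec h, partialD_apply_stdVec h]
    exact D.extDerivFlat_coframe₁ hy _ _
  torsion_b y hy i j := by
    have h := (D.contDiffAt_coframe₂ hy).differentiableAt (by simp)
    rw [partialD_apply_stdVec h, partialD_apply_stdVec h]
    exact D.extDerivFlat_coframe₂ hy _ _

theorem extDerivFlat_connection (v w : E2) :
    extDerivFlat D.connection (extChartAt 𝓘(ℝ, E2) u.pt u.pt) v w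
      = -sgn ε * g.gaussCurvature u.pt *
        (D.coframe₁.inChart u.pt (extChartAt 𝓘(ℝ, E2) u.pt u.pt) v
          * D.coframe₂.inChart u.pt (extChartAt 𝓘(ℝ, E2) u.pt u.pt) w
        - D.coframe₁.inChart u.pt (extChartAt 𝓘(ℝ, E2) u.pt u.pt) w
          * D.coframe₂.inChart u.pt (extChartAt 𝓘(ℝ, E2) u.pt u.pt) v) := by
  have h := D.coframeComponents.gaussCurvature_eq D.mem_domain
  have hd := (D.contDiffAt_connection D.mem_domain).differentiableAt (by simp)
  rw [partialD_apply_stdVec hd, partialD_apply_stdVec hd] at h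
  rw [E2.extDerivFlat_eq, E2.wedge_eq, extDerivFlat, h]
  ring

end LocalFrame

end SolderForms

/-! ### Solder forms and their structure equations on the frame bundle -/

section FrameBundleStructure

variable {ε : ℤˣ} {S : Type*} [TopologicalSpace S] [ChartedSpace E2 S]
  [IsManifold 𝓘(ℝ, E2) ∞ S] {g : SurfaceMetric ε S}

theorem SurfaceMetric.inner_comb (g : SurfaceMetric ε S) {x : S} (c s : ℝ)
    (a b w : TangentSpace 𝓘(ℝ, E2) x) :
    g.inner x (c • a + s • b) w
      = c * g.inner x a w + (-sgn ε * s) * (-sgn ε * g.inner x b w) := by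
  simp only [map_add, map_smul, add_apply, smul_apply, smul_eq_mul]
  linear_combination (-s * g.inner x b w) * sgn_mul_self ε

theorem SurfaceMetric.inner_comb' (g : SurfaceMetric ε S) {x : S} (c s : ℝ)
    (a b w : TangentSpace 𝓘(ℝ, E2) x) :
    -sgn ε * g.inner x ((sgn ε * s) • a + c • b) w
      = (-s) * g.inner x a w + c * (-sgn ε * g.inner x b w) := by
  simp only [map_add, map_smul, add_apply, smul_apply, smul_eq_mul]
  linear_combination (-s * g.inner x a w) * sgn_mul_self ε

theorem fderiv_comp_snd_apply {E : Type*} [NormedAddCommGroup E] [NormedSpace ℝ E] {h : ℝ → ℝ}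
    {p : E × ℝ} (hh : DifferentiableAt ℝ h p.2) (v : E × ℝ) :
    fderiv ℝ (fun q : E × ℝ => h q.2) p v = v.2 * deriv h p.2 := by
  have e := (hh.hasDerivAt.hasFDerivAt.comp p (hasFDerivAt_snd (𝕜 := ℝ))).fderiv
  change fderiv ℝ (h ∘ Prod.snd) p v = _
  rw [e]
  simp

theorem OFrame.pullback_solder₁ {E : Type*} [NormedAddCommGroup E] [NormedSpace ℝ E]
    {N : Type*} [TopologicalSpace N] [ChartedSpace E N] {f : N → OFrame g} {x : N}
    (hf : MDifferentiableAt 𝓘(ℝ, E) 𝓘(ℝ, E2 × ℝ) f x) (v : TangentSpace 𝓘(ℝ, E) x) :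
    pullback (E := E) f (OFrame.solder₁ g) x v
      = g.inner (f x).pt (f x).e₁ (mfderiv 𝓘(ℝ, E) 𝓘(ℝ, E2) (OFrame.pt ∘ f) x v) := by
  rw [mfderiv_comp x ((OFrame.contMDiff_pt _).mdifferentiableAt (by simp)) hf]
  rfl

theorem OFrame.pullback_solder₂ {E : Type*} [NormedAddCommGroup E] [NormedSpace ℝ E]
    {N : Type*} [TopologicalSpace N] [ChartedSpace E N] {f : N → OFrame g} {x : N}
    (hf : MDifferentiableAt 𝓘(ℝ, E) 𝓘(ℝ, E2 × ℝ) f x) (v : TangentSpace 𝓘(ℝ, E) x) :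
    pullback (E := E) f (OFrame.solder₂ g) x v
      = -sgn ε * g.inner (f x).pt (f x).e₂ (mfderiv 𝓘(ℝ, E) 𝓘(ℝ, E2) (OFrame.pt ∘ f) x v) := by
  rw [mfderiv_comp x ((OFrame.contMDiff_pt _).mdifferentiableAt (by simp)) hf]
  rfl

namespace LocalFrame

variable {u : OFrame g} (D : LocalFrame g u)

/-- The coordinate expression of the first solder form. -/
def chartSolder₁ (p : E2 × ℝ) : E2 × ℝ →L[ℝ] ℝ :=
  √(1 + sgn ε * p.2 ^ 2) • (D.coframe₁.inChart u.pt p.1).comp (ContinuousLinearMap.fst ℝ E2 ℝ)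
    + (-sgn ε * p.2) • (D.coframe₂.inChart u.pt p.1).comp (ContinuousLinearMap.fst ℝ E2 ℝ)

/-- The coordinate expression of the second solder form. -/
def chartSolder₂ (p : E2 × ℝ) : E2 × ℝ →L[ℝ] ℝ :=
  (-p.2) • (D.coframe₁.inChart u.pt p.1).comp (ContinuousLinearMap.fst ℝ E2 ℝ)
    + √(1 + sgn ε * p.2 ^ 2) • (D.coframe₂.inChart u.pt p.1).comp (ContinuousLinearMap.fst ℝ E2 ℝ)

/-- The coordinate expression of the connection form on the frame bundle. -/
def chartConnection (p : E2 × ℝ) : E2 × ℝ →L[ℝ] ℝ :=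
  (D.connection p.1).comp (ContinuousLinearMap.fst ℝ E2 ℝ)
    -- Here s = `p.2` is the sine of the rotation angle for ε = -1 and the hyperbolic sine of the
    -- boost for ε = 1. In both cases ds / √(1 + ε s²) is the differential of that parameter.
    + (sgn ε / √(1 + sgn ε * p.2 ^ 2)) • ContinuousLinearMap.snd ℝ E2 ℝ

variable {D} {p : E2 × ℝ}

theorem fst_mem_domain (hp : p ∈ D.chart.target) : p.1 ∈ D.domain :=
  ⟨by simpa using hp.1, hp.2.1⟩

theorem contDiffAt_root (hp : p ∈ D.chart.target) :
    ContDiffAt ℝ ∞ (fun s : ℝ => √(1 + sgn ε * s ^ 2)) p.2 :=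
  ContDiffAt.sqrt (by fun_prop) hp.2.2.ne'

theorem root_ne_zero (hp : p ∈ D.chart.target) : √(1 + sgn ε * p.2 ^ 2) ≠ 0 :=
  (Real.sqrt_pos.2 hp.2.2).ne'

theorem deriv_root (hp : p ∈ D.chart.target) :
    deriv (fun s : ℝ => √(1 + sgn ε * s ^ 2)) p.2 = sgn ε / √(1 + sgn ε * p.2 ^ 2) * p.2 := by
  have h : HasDerivAt (fun s : ℝ => 1 + sgn ε * s ^ 2) (sgn ε * (2 * p.2)) p.2 := by
    simpa using ((hasDerivAt_pow 2 p.2).const_mul (sgn ε)).const_add 1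
  rw [(h.sqrt hp.2.2.ne').deriv]
  have := root_ne_zero hp
  field_simp

theorem contDiffAt_fst_comp {α : E2 → E2 →L[ℝ] ℝ} (h : ContDiffAt ℝ ∞ α p.1) :
    ContDiffAt ℝ ∞ (fun q : E2 × ℝ => (α q.1).comp (ContinuousLinearMap.fst ℝ E2 ℝ)) p :=
  (ContDiffAt.comp p h contDiffAt_fst).clm_comp contDiffAt_const

theorem contDiffAt_root_snd (hp : p ∈ D.chart.target) :
    ContDiffAt ℝ ∞ (fun q : E2 × ℝ => √(1 + sgn ε * q.2 ^ 2)) p :=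
  ContDiffAt.comp (g := fun s : ℝ => √(1 + sgn ε * s ^ 2)) p (contDiffAt_root hp) contDiffAt_snd

theorem contDiffAt_chartSolder₁ (hp : p ∈ D.chart.target) : ContDiffAt ℝ ∞ D.chartSolder₁ p :=
  ((contDiffAt_root_snd hp).smul
    (contDiffAt_fst_comp (D.contDiffAt_coframe₁ (fst_mem_domain hp)))).add
  ((contDiffAt_const.mul contDiffAt_snd).smul
    (contDiffAt_fst_comp (D.contDiffAt_coframe₂ (fst_mem_domain hp))))

theorem contDiffAt_chartSolder₂ (hp : p ∈ D.chart.target) : ContDiffAt ℝ ∞ D.chartSolder₂ p :=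
  ((contDiffAt_snd.neg).smul
    (contDiffAt_fst_comp (D.contDiffAt_coframe₁ (fst_mem_domain hp)))).add
  ((contDiffAt_root_snd hp).smul
    (contDiffAt_fst_comp (D.contDiffAt_coframe₂ (fst_mem_domain hp))))

theorem contDiffAt_chartConnection (hp : p ∈ D.chart.target) :
    ContDiffAt ℝ ∞ D.chartConnection p :=
  (contDiffAt_fst_comp (D.contDiffAt_connection (fst_mem_domain hp))).add
    ((contDiffAt_const.div (contDiffAt_root_snd hp) (root_ne_zero hp)).smul contDiffAt_const)

/-- Write r = √(1 + ε s²), so θ¹ = r a - ε s b and θ² = -s a + r b. The derivatives of a and b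
contribute r b ∧ γ - s a ∧ γ = θ² ∧ γ. Since dr = (ε s / r) ds, the derivatives of the coefficients
contribute θ² ∧ (ε / r) ds. -/
theorem extDerivFlat_chartSolder₁ (hp : p ∈ D.chart.target) (v w : E2 × ℝ) :
    extDerivFlat D.chartSolder₁ p v w
      = D.chartSolder₂ p v * D.chartConnection p w - D.chartSolder₂ p w * D.chartConnection p v := by
  have h₁ := D.contDiffAt_coframe₁ (fst_mem_domain hp)
  have h₂ := D.contDiffAt_coframe₂ (fst_mem_domain hp)
  have d₁ := (contDiffAt_fst_comp (p := p) h₁).differentiableAt (by simp)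
  have d₂ := (contDiffAt_fst_comp (p := p) h₂).differentiableAt (by simp)
  have dc := (contDiffAt_root_snd hp).differentiableAt (by simp)
  have ds : DifferentiableAt ℝ (fun q : E2 × ℝ => -sgn ε * q.2) p := by fun_prop
  have fs := fun v => fderiv_comp_snd_apply (p := p) (h := fun s => -sgn ε * s) (by fun_prop) v
  have fc := fun v => fderiv_comp_snd_apply (p := p)
    ((contDiffAt_root hp).differentiableAt (by simp)) v
  have ek : sgn ε / √(1 + sgn ε * p.2 ^ 2) * √(1 + sgn ε * p.2 ^ 2) = sgn ε :=
    div_mul_cancel₀ _ (root_ne_zero hp)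
  have hs : deriv (fun s => -sgn ε * s) p.2 = -sgn ε := by simp
  rw [deriv_root hp] at fc
  rw [hs] at fs
  refine (extDerivFlat_add (dc.fun_smul d₁) (ds.fun_smul d₂) v w).trans ?_
  rw [extDerivFlat_smul dc d₁, extDerivFlat_smul ds d₂, extDerivFlat_comp_fst h₁,
    extDerivFlat_comp_fst h₂, fc, fc, fs, fs, D.extDerivFlat_coframe₁ (fst_mem_domain hp),
    D.extDerivFlat_coframe₂ (fst_mem_domain hp)]
  simp only [chartSolder₂, chartConnection, add_apply, smul_apply, smul_eq_mul,
    ContinuousLinearMap.comp_apply, ContinuousLinearMap.coe_fst', ContinuousLinearMap.coe_snd']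
  generalize sgn ε / √(1 + sgn ε * p.2 ^ 2) = k at *
  generalize √(1 + sgn ε * p.2 ^ 2) = c at *
  linear_combination (v.2 * D.coframe₂.inChart u.pt p.1 w.1
    - w.2 * D.coframe₂.inChart u.pt p.1 v.1) * ek
    - p.2 * (D.coframe₁.inChart u.pt p.1 v.1 * D.connection p.1 w.1
        - D.coframe₁.inChart u.pt p.1 w.1 * D.connection p.1 v.1) * sgn_mul_self ε

theorem extDerivFlat_chartSolder₂ (hp : p ∈ D.chart.target) (v w : E2 × ℝ) :
    extDerivFlat D.chartSolder₂ p v w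
      = sgn ε * (D.chartSolder₁ p v * D.chartConnection p w
        - D.chartSolder₁ p w * D.chartConnection p v) := by
  have h₁ := D.contDiffAt_coframe₁ (fst_mem_domain hp)
  have h₂ := D.contDiffAt_coframe₂ (fst_mem_domain hp)
  have d₁ := (contDiffAt_fst_comp (p := p) h₁).differentiableAt (by simp)
  have d₂ := (contDiffAt_fst_comp (p := p) h₂).differentiableAt (by simp)
  have dc := (contDiffAt_root_snd hp).differentiableAt (by simp)
  have ds : DifferentiableAt ℝ (fun q : E2 × ℝ => -q.2) p := by fun_prop
  have fs := fun v => fderiv_comp_snd_apply (p := p) (h := fun s => -s) (by fun_prop) v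
  have fc := fun v => fderiv_comp_snd_apply (p := p)
    ((contDiffAt_root hp).differentiableAt (by simp)) v
  have ek : sgn ε / √(1 + sgn ε * p.2 ^ 2) * √(1 + sgn ε * p.2 ^ 2) = sgn ε :=
    div_mul_cancel₀ _ (root_ne_zero hp)
  have hs : deriv (fun s : ℝ => -s) p.2 = -1 := by simp
  rw [deriv_root hp] at fc
  rw [hs] at fs
  refine (extDerivFlat_add (ds.fun_smul d₁) (dc.fun_smul d₂) v w).trans ?_
  rw [extDerivFlat_smul dc d₂, extDerivFlat_smul ds d₁, extDerivFlat_comp_fst h₁,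
    extDerivFlat_comp_fst h₂, fc, fc, fs, fs, D.extDerivFlat_coframe₁ (fst_mem_domain hp),
    D.extDerivFlat_coframe₂ (fst_mem_domain hp)]
  simp only [chartSolder₁, chartConnection, add_apply, smul_apply, smul_eq_mul,
    ContinuousLinearMap.comp_apply, ContinuousLinearMap.coe_fst', ContinuousLinearMap.coe_snd']
  generalize sgn ε / √(1 + sgn ε * p.2 ^ 2) = k at *
  generalize √(1 + sgn ε * p.2 ^ 2) = c at *
  linear_combination sgn ε * (v.2 * D.coframe₁.inChart u.pt p.1 w.1
      - w.2 * D.coframe₁.inChart u.pt p.1 v.1) * ek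
    + (v.2 * D.coframe₁.inChart u.pt p.1 w.1 - w.2 * D.coframe₁.inChart u.pt p.1 v.1) *
      sgn_mul_self ε
    + p.2 * (D.coframe₂.inChart u.pt p.1 v.1 * (D.connection p.1 w.1 + k * w.2)
        - D.coframe₂.inChart u.pt p.1 w.1 * (D.connection p.1 v.1 + k * v.2)) * sgn_mul_self ε

/-- The vertical summand is a function of s times ds, hence closed. -/
theorem extDerivFlat_chartConnection (hp : p ∈ D.chart.target) (v w : E2 × ℝ) :
    extDerivFlat D.chartConnection p v w = extDerivFlat D.connection p.1 v.1 w.1 := by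
  have h := D.contDiffAt_connection (fst_mem_domain hp)
  have d := (contDiffAt_fst_comp (p := p) h).differentiableAt (by simp)
  have dh : DifferentiableAt ℝ (fun s : ℝ => sgn ε / √(1 + sgn ε * s ^ 2)) p.2 := ((contDiffAt_const (c := sgn ε)).div (contDiffAt_root hp)
    (root_ne_zero hp)).differentiableAt (by simp)
  have dk : DifferentiableAt ℝ (fun q : E2 × ℝ => sgn ε / √(1 + sgn ε * q.2 ^ 2)) p := ((contDiffAt_const (c := sgn ε)).div (contDiffAt_root_snd hp)
    (root_ne_zero hp)).differentiableAt (by simp)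
  have fk := fun v => fderiv_comp_snd_apply (p := p) dh v
  refine (extDerivFlat_add d (dk.fun_smul (differentiableAt_const _)) v w).trans ?_
  rw [extDerivFlat_comp_fst h, extDerivFlat_smul dk (differentiableAt_const _),
    extDerivFlat_const]
  have e := fk v
  have e' := fk w
  simp only [ContinuousLinearMap.coe_snd'] at e e' ⊢
  rw [e, e']
  ring

end LocalFrame

namespace OFrame

theorem pt_comp_extChartAt_symm (u : OFrame g) {p : E2 × ℝ} (hp : p ∈ u.localFrame.chart.target) :
    (OFrame.pt ∘ (extChartAt 𝓘(ℝ, E2 × ℝ) u).symm) =ᶠ[𝓝 p]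
      ((extChartAt 𝓘(ℝ, E2) u.pt).symm ∘ Prod.fst) := by
  rw [← u.target_extChartAt] at hp
  filter_upwards [(isOpen_extChartAt_target (I := 𝓘(ℝ, E2 × ℝ)) u).mem_nhds hp] with q hq
  rw [u.target_extChartAt] at hq
  simp only [Function.comp_apply, u.extChartAt_symm_apply, u.localFrame.chart_symm_apply hq]
  rfl

theorem mfderiv_pt_comp (u : OFrame g) {p : E2 × ℝ} (hp : p ∈ u.localFrame.chart.target)
    (v : E2 × ℝ) :
    mfderiv 𝓘(ℝ, E2 × ℝ) 𝓘(ℝ, E2) (OFrame.pt ∘ (extChartAt 𝓘(ℝ, E2 × ℝ) u).symm) p v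
      = mfderiv 𝓘(ℝ, E2) 𝓘(ℝ, E2) (extChartAt 𝓘(ℝ, E2) u.pt).symm p.1 v.1 := by
  have h₁ : MDifferentiableAt 𝓘(ℝ, E2 × ℝ) 𝓘(ℝ, E2) (Prod.fst : E2 × ℝ → E2) p :=
    differentiableAt_fst.mdifferentiableAt
  have h₂ := (contMDiffAt_extChartAt_symm_self (E := E2) u.pt
    (LocalFrame.fst_mem_domain hp).1).mdifferentiableAt (by simp)
  have e : mfderiv 𝓘(ℝ, E2 × ℝ) 𝓘(ℝ, E2) (Prod.fst : E2 × ℝ → E2) p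
      = ContinuousLinearMap.fst ℝ E2 ℝ := by
    rw [mfderiv_eq_fderiv, fderiv_fst]
  rw [(u.pt_comp_extChartAt_symm hp).mfderiv_eq, mfderiv_comp p h₂ h₁, e]
  rfl

theorem solder₁_inChart (u : OFrame g) {p : E2 × ℝ} (hp : p ∈ u.localFrame.chart.target) :
    (solder₁ g).inChart u p = u.localFrame.chartSolder₁ p := by
  have hs := contMDiffAt_extChartAt_symm_self (E := E2 × ℝ) u
    (by rw [u.target_extChartAt]; exact hp)
  refine ContinuousLinearMap.ext fun v => ?_
  rw [OneForm.inChart_eq_pullback]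
  refine (pullback_solder₁ (hs.mdifferentiableAt (by simp)) v).trans ?_
  rw [u.mfderiv_pt_comp hp, u.extChartAt_symm_apply, u.localFrame.chart_symm_apply hp]
  set w := mfderiv 𝓘(ℝ, E2) 𝓘(ℝ, E2) (extChartAt 𝓘(ℝ, E2) u.pt).symm p.1 v.1 with hw
  exact g.inner_comb (x := (extChartAt 𝓘(ℝ, E2) u.pt).symm p.1) _ _ _ _ w

theorem solder₂_inChart (u : OFrame g) {p : E2 × ℝ} (hp : p ∈ u.localFrame.chart.target) :
    (solder₂ g).inChart u p = u.localFrame.chartSolder₂ p := by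
  have hs := contMDiffAt_extChartAt_symm_self (E := E2 × ℝ) u
    (by rw [u.target_extChartAt]; exact hp)
  refine ContinuousLinearMap.ext fun v => ?_
  rw [OneForm.inChart_eq_pullback]
  refine (pullback_solder₂ (hs.mdifferentiableAt (by simp)) v).trans ?_
  rw [u.mfderiv_pt_comp hp, u.extChartAt_symm_apply, u.localFrame.chart_symm_apply hp]
  set w := mfderiv 𝓘(ℝ, E2) 𝓘(ℝ, E2) (extChartAt 𝓘(ℝ, E2) u.pt).symm p.1 v.1 with hw
  exact g.inner_comb' (x := (extChartAt 𝓘(ℝ, E2) u.pt).symm p.1) _ _ _ _ w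

theorem mem_target (u : OFrame g) :
    extChartAt 𝓘(ℝ, E2 × ℝ) u u ∈ u.localFrame.chart.target := by
  rw [← u.target_extChartAt]
  exact mem_extChartAt_target u

theorem eventually_mem_target (u : OFrame g) :
    ∀ᶠ p in 𝓝 (extChartAt 𝓘(ℝ, E2 × ℝ) u u), p ∈ u.localFrame.chart.target := by
  rw [← u.target_extChartAt]
  exact extChartAt_target_mem_nhds u

/-- The frame field defining the chart extends u, so u is unrotated. At this point the solder forms
are just the coframe of the surface, which is why the last structure equation need only be checked
there. -/
theorem extChartAt_self (u : OFrame g) :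
    extChartAt 𝓘(ℝ, E2 × ℝ) u u = (extChartAt 𝓘(ℝ, E2) u.pt u.pt, 0) := by
  refine Prod.ext rfl ?_
  change -sgn ε * g.inner u.pt u.e₁ (u.localFrame.X₂ u.pt) = 0
  rw [u.localFrame.eq₂, u.g₁₂, mul_zero]

variable (g) in
theorem solder₁_isSmooth : (solder₁ g).IsSmooth :=
  OneForm.isSmooth_iff.2 fun u => (LocalFrame.contDiffAt_chartSolder₁
    u.mem_target).congr_of_eventuallyEq
      (u.eventually_mem_target.mono fun _ hp => u.solder₁_inChart hp)

variable (g) in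
theorem solder₂_isSmooth : (solder₂ g).IsSmooth :=
  OneForm.isSmooth_iff.2 fun u => (LocalFrame.contDiffAt_chartSolder₂
    u.mem_target).congr_of_eventuallyEq
      (u.eventually_mem_target.mono fun _ hp => u.solder₂_inChart hp)

variable (g) in
/-- The structure equations of the orthonormal frame bundle. -/
theorem hasStructureEquations_solder :
    HasStructureEquations ε (solder₁ g) (solder₂ g)
      (fun u => -sgn ε * g.gaussCurvature u.pt) := by
  have hε := sgn_mul_self ε
  refine hasStructureEquations_of_charts (solder₁_isSmooth g) (solder₂_isSmooth g) fun u => ?_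
  have hm := u.mem_target
  have e₁ : ∀ v, u.localFrame.chartSolder₁ (extChartAt 𝓘(ℝ, E2 × ℝ) u u) v
      = u.localFrame.coframe₁.inChart u.pt (extChartAt 𝓘(ℝ, E2) u.pt u.pt) v.1 := fun v => by
    rw [u.extChartAt_self]
    simp [LocalFrame.chartSolder₁]
  have e₂ : ∀ v, u.localFrame.chartSolder₂ (extChartAt 𝓘(ℝ, E2 × ℝ) u u) v
      = u.localFrame.coframe₂.inChart u.pt (extChartAt 𝓘(ℝ, E2) u.pt u.pt) v.1 := fun v => by
    rw [u.extChartAt_self]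
    simp [LocalFrame.chartSolder₂]
  refine ⟨u.localFrame.chartConnection, LocalFrame.contDiffAt_chartConnection hm, ?_, ?_, ?_⟩
  · filter_upwards [u.eventually_mem_target.eventually_nhds] with p hp v w
    have f₁ : (solder₁ g).inChart u =ᶠ[𝓝 p] u.localFrame.chartSolder₁ :=
      hp.mono fun q hq => u.solder₁_inChart hq
    have f₂ : (solder₂ g).inChart u =ᶠ[𝓝 p] u.localFrame.chartSolder₂ :=
      hp.mono fun q hq => u.solder₂_inChart hq
    rw [extDerivFlat_congr f₁, extDerivFlat_congr f₂, f₁.eq_of_nhds, f₂.eq_of_nhds]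
    exact ⟨LocalFrame.extDerivFlat_chartSolder₁ hp.self_of_nhds v w,
      LocalFrame.extDerivFlat_chartSolder₂ hp.self_of_nhds v w⟩
  · intro h0
    -- On the coordinate basis the triple product is ε times the density of the coframe: the solder
    -- forms kill the vertical vector and the connection form takes the value ε on it.
    have k := congrFun (congrFun₂ h0 ((stdVec 0, 0) : E2 × ℝ) ((stdVec 1, 0) : E2 × ℝ))
      ((0, 1) : E2 × ℝ)
    simp only [wedge₁₂, wedge, u.solder₁_inChart hm, u.solder₂_inChart hm] at k
    have f₁ := e₁ ((stdVec 0, 0) : E2 × ℝ)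
    have f₂ := e₁ ((stdVec 1, 0) : E2 × ℝ)
    have f₃ := e₁ ((0, 1) : E2 × ℝ)
    have f₄ := e₂ ((stdVec 0, 0) : E2 × ℝ)
    have f₅ := e₂ ((stdVec 1, 0) : E2 × ℝ)
    have f₆ := e₂ ((0, 1) : E2 × ℝ)
    simp only [map_zero] at f₁ f₂ f₃ f₄ f₅ f₆
    have e₃ : u.localFrame.chartConnection (extChartAt 𝓘(ℝ, E2 × ℝ) u u) ((0, 1) : E2 × ℝ)
        = sgn ε := by
      rw [u.extChartAt_self]
      simp [LocalFrame.chartConnection]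
    refine u.localFrame.density_ne_zero u.localFrame.mem_domain ?_
    unfold LocalFrame.density
    rw [← f₁, ← f₂, ← f₄, ← f₅]
    generalize u.localFrame.chartSolder₁ (extChartAt 𝓘(ℝ, E2 × ℝ) u u) = α₁ at *
    generalize u.localFrame.chartSolder₂ (extChartAt 𝓘(ℝ, E2 × ℝ) u u) = α₂ at *
    generalize u.localFrame.chartConnection (extChartAt 𝓘(ℝ, E2 × ℝ) u u) = α₃ at *
    have k' : α₁ (stdVec 0, 0) * (α₂ (stdVec 1, 0) * α₃ (0, 1) - α₂ (0, 1) * α₃ (stdVec 1, 0))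
      - α₁ (stdVec 1, 0) * (α₂ (stdVec 0, 0) * α₃ (0, 1) - α₂ (0, 1) * α₃ (stdVec 0, 0))
      + α₁ (0, 1) * (α₂ (stdVec 0, 0) * α₃ (stdVec 1, 0)
        - α₂ (stdVec 1, 0) * α₃ (stdVec 0, 0)) = 0 := k
    rw [e₃, f₃, f₆] at k'
    linear_combination sgn ε * k' - (α₁ (stdVec 0, 0) * α₂ (stdVec 1, 0)
      - α₁ (stdVec 1, 0) * α₂ (stdVec 0, 0)) * hε
  · intro v w
    rw [LocalFrame.extDerivFlat_chartConnection hm, u.solder₁_inChart hm, u.solder₂_inChart hm,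
      e₁, e₂, e₁, e₂, u.extChartAt_self]
    exact u.localFrame.extDerivFlat_connection v.1 w.1

variable (g) in
theorem isCartan_solder : IsCartan ε (solder₁ g) (solder₂ g) := by
  obtain ⟨-, ω₃, h₁, h₂, -⟩ := hasStructureEquations_solder g
  exact h₂.isCartan h₁

theorem inner_mfderiv_pt (u : OFrame g) (v w : TangentSpace 𝓘(ℝ, E2 × ℝ) u) :
    g.inner u.pt (mfderiv 𝓘(ℝ, E2 × ℝ) 𝓘(ℝ, E2) OFrame.pt u v)
        (mfderiv 𝓘(ℝ, E2 × ℝ) 𝓘(ℝ, E2) OFrame.pt u w)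
      = solder₁ g u v * solder₁ g u w - sgn ε * (solder₂ g u v * solder₂ g u w) :=
  g.inner_eq u.g₁₁ u.g₁₂ u.g₂₂ _ _

end OFrame

end FrameBundleStructure

/-! ### A smooth inverse function theorem and calculus on spaces of curves -/

section SmoothFlow

/-- The smooth inverse function theorem, with an inverse that is smooth on an open set. -/
theorem exists_smooth_local_inverse {X Y : Type*} [NormedAddCommGroup X] [NormedSpace ℝ X]
    [CompleteSpace X] [NormedAddCommGroup Y] [NormedSpace ℝ Y] {f : X → Y} {U : Set X}
    (hU : IsOpen U) (hf : ContDiffOn ℝ ∞ f U) {a : X} (ha : a ∈ U) {e : X ≃L[ℝ] Y}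
    (he : HasFDerivAt f (e : X →L[ℝ] Y) a) :
    ∃ P : OpenPartialHomeomorph X Y, a ∈ P.source ∧ P.source ⊆ U ∧ (P : X → Y) = f ∧
      ContDiffOn ℝ ∞ P.symm P.target := by
  have hc : ∀ x ∈ U, ContDiffAt ℝ ∞ f x := fun x hx => hf.contDiffAt (hU.mem_nhds hx)
  let P₀ := (hc a ha).toOpenPartialHomeomorph f he (by simp)
  -- Smoothness of the inverse at a point needs an invertible derivative at its preimage.
  -- Invertibility is an open condition, so restricting to this set gives a smooth inverse on the
  -- whole target.
  let s := U ∩ fderiv ℝ f ⁻¹' range ((↑) : (X ≃L[ℝ] Y) → X →L[ℝ] Y)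
  have hs : IsOpen s :=
    (hf.continuousOn_fderiv_of_isOpen hU (by simp)).isOpen_inter_preimage hU
      ContinuousLinearEquiv.isOpen
  have has : a ∈ s := ⟨ha, e, he.fderiv.symm⟩
  refine ⟨P₀.restrOpen s hs, ⟨(hc a ha).mem_toOpenPartialHomeomorph_source he (by simp), has⟩,
    fun x hx => hx.2.1, rfl, fun y hy => ?_⟩
  have hx : (P₀.restrOpen s hs).symm y ∈ (P₀.restrOpen s hs).source :=
    (P₀.restrOpen s hs).map_target hy
  obtain ⟨hxU, e', he'⟩ := hx.2
  refine ((P₀.restrOpen s hs).contDiffAt_symm hy (f₀' := e') ?_ (hc _ hxU)).contDiffWithinAt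
  rw [he']
  exact ((hc _ hxU).differentiableAt (by simp)).hasFDerivAt

section Superposition

universe u

variable (K : Type*) [TopologicalSpace K] [CompactSpace K] {E F G : Type u}
  [NormedAddCommGroup E] [NormedSpace ℝ E] [NormedAddCommGroup F] [NormedSpace ℝ F]
  [NormedAddCommGroup G] [NormedSpace ℝ G]

/-- A bounded bilinear map applied pointwise to continuous functions. -/
def pointwiseBilin (B : G →L[ℝ] E →L[ℝ] F) : C(K, G) →L[ℝ] C(K, E) →L[ℝ] C(K, F) :=
  LinearMap.mkContinuous₂
    (LinearMap.mk₂ ℝ (fun (A : C(K, G)) (h : C(K, E)) =>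
        (⟨fun k => B (A k) (h k), (B.continuous.comp A.continuous).clm_apply h.continuous⟩ :
          C(K, F)))
      (fun A A' h => by ext k; simp) (fun c A h => by ext k; simp)
      (fun A h h' => by ext k; simp) (fun c A h => by ext k; simp)) ‖B‖
    (fun A h => by
      refine (ContinuousMap.norm_le _ (by positivity)).2 fun k => ?_
      exact (B.le_opNorm₂ (A k) (h k)).trans (by
        gcongr
        · exact A.norm_coe_le_norm k
        · exact h.norm_coe_le_norm k))

variable {K}

/-- The mean value inequality on a ball around each `γ k` bounds the remainder there. The bound is
uniform in k because γ ↦ f' ∘ γ is continuous for the sup norm. -/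
theorem hasFDerivAt_superposition (B : G →L[ℝ] E →L[ℝ] F) {f : C(E, F)} {f' : C(E, G)}
    (hf : ∀ x, HasFDerivAt f (B (f' x)) x) (γ : C(K, E)) :
    HasFDerivAt (fun γ : C(K, E) => f.comp γ) (pointwiseBilin K B (f'.comp γ)) γ := by
  rw [hasFDerivAt_iff_isLittleO_nhds_zero, Asymptotics.isLittleO_iff]
  intro c hc
  have hcont : ContinuousAt (fun γ : C(K, E) => f'.comp γ) γ :=
    (f'.continuous_postcomp).continuousAt
  obtain ⟨δ, hδ, h⟩ := Metric.continuousAt_iff.1 hcont (c / (‖B‖ + 1)) (by positivity)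
  filter_upwards [Metric.ball_mem_nhds (0 : C(K, E)) hδ] with η hη
  rw [mem_ball_zero_iff] at hη
  refine (ContinuousMap.norm_le _ (by positivity)).2 fun k => ?_
  have hk : ‖η k‖ < δ := (η.norm_coe_le_norm k).trans_lt hη
  have hb : ∀ x ∈ Metric.ball (γ k) δ, ‖B (f' x) - B (f' (γ k))‖ ≤ c := by
    intro x hx
    -- Translating the whole curve by a constant moves `γ k` to x and changes γ by less than δ in
    -- norm, so sup norm continuity bounds the derivative at x.
    have h₁ := h (x := γ + ContinuousMap.const K (x - γ k)) (by
      rw [dist_eq_norm, add_sub_cancel_left]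
      refine (ContinuousMap.norm_lt_iff _ hδ).2 fun _ => ?_
      simpa [dist_eq_norm] using hx)
    have h₂ := (ContinuousMap.dist_apply_le_dist k).trans h₁.le
    have h₃ : ‖f' x - f' (γ k)‖ ≤ c / (‖B‖ + 1) := by simpa [dist_eq_norm] using h₂
    rw [← map_sub]
    refine (B.le_opNorm _).trans ?_
    calc ‖B‖ * ‖f' x - f' (γ k)‖ ≤ (‖B‖ + 1) * (c / (‖B‖ + 1)) := by gcongr; linarith
      _ = c := by field_simp
  have hm := (convex_ball (γ k) δ).norm_image_sub_le_of_norm_hasFDerivWithin_le'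
    (f := f) (f' := fun x => B (f' x)) (φ := B (f' (γ k))) (x := γ k) (y := γ k + η k)
    (fun x _ => (hf x).hasFDerivWithinAt) hb (Metric.mem_ball_self hδ) (by simpa using hk)
  rw [add_sub_cancel_left] at hm
  exact hm.trans (mul_le_mul_of_nonneg_left (η.norm_coe_le_norm k) hc.le)

/-- The derivative is pointwise application of the superposition with `fderiv ℝ f`, which has one
order of smoothness less and values in E →L[ℝ] F. The induction therefore ranges over all codomains,
and the common universe keeps these operator spaces in range. -/
theorem contDiff_superposition_nat (n : ℕ) : ∀ {F : Type u} [NormedAddCommGroup F]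
    [NormedSpace ℝ F] (f : C(E, F)), ContDiff ℝ n f →
    ContDiff ℝ n (fun γ : C(K, E) => f.comp γ) := by
  induction n with
  | zero =>
    intro F _ _ f _
    exact contDiff_zero.2 f.continuous_postcomp
  | succ n ih =>
    intro F _ _ f hf
    let f' : C(E, E →L[ℝ] F) := ⟨fderiv ℝ f, hf.continuous_fderiv (by simp)⟩
    have hf' : ContDiff ℝ n f' := hf.fderiv_right (by norm_cast)
    have hd : ∀ x, HasFDerivAt f (ContinuousLinearMap.id ℝ (E →L[ℝ] F) (f' x)) x := fun x =>
      (hf.differentiable (by simp) x).hasFDerivAt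
    have hg := ih f' hf'
    have hs := fun γ : C(K, E) => hasFDerivAt_superposition _ hd γ
    push_cast
    rw [contDiff_succ_iff_hasFDerivAt]
    exact ⟨_, (pointwiseBilin K (ContinuousLinearMap.id ℝ (E →L[ℝ] F))).contDiff.comp hg, hs⟩

theorem contDiff_superposition (f : C(E, E)) (hf : ContDiff ℝ ∞ f) :
    ContDiff ℝ ∞ (fun γ : C(K, E) => f.comp γ) :=
  contDiff_infty.2 fun n => contDiff_superposition_nat n f (contDiff_infty.1 hf n)

end Superposition

variable {E : Type*} [NormedAddCommGroup E] [NormedSpace ℝ E]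

theorem intervalIntegral_projIcc_norm_le (γ : C(unitInterval, E)) {t : ℝ} (ht : t ∈ Icc (0 : ℝ) 1) :
    ‖∫ s in (0 : ℝ)..t, γ (projIcc 0 1 zero_le_one s)‖ ≤ ‖γ‖ := by
  refine (intervalIntegral.norm_integral_le_of_norm_le_const (C := ‖γ‖)
    fun s _ => γ.norm_coe_le_norm _).trans ?_
  rw [sub_zero, abs_of_nonneg ht.1]
  exact mul_le_of_le_one_right (norm_nonneg _) ht.2

omit [NormedSpace ℝ E] in
theorem continuous_projIcc_comp (γ : C(unitInterval, E)) :
    Continuous fun s => γ (projIcc 0 1 zero_le_one s) :=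
  γ.continuous.comp continuous_projIcc

variable (E) in
/-- The primitive of a curve, vanishing at the origin. -/
def primitive : C(unitInterval, E) →L[ℝ] C(unitInterval, E) :=
  LinearMap.mkContinuous
    { toFun := fun γ => ⟨fun t => ∫ s in (0 : ℝ)..t, γ (projIcc 0 1 zero_le_one s),
        (intervalIntegral.continuous_primitive (fun _ _ =>
          (continuous_projIcc_comp γ).intervalIntegrable _ _) 0).comp continuous_subtype_val⟩
      map_add' := fun γ γ' => by
        ext t
        exact intervalIntegral.integral_add ((continuous_projIcc_comp γ).intervalIntegrable _ _)
          ((continuous_projIcc_comp γ').intervalIntegrable _ _)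
      map_smul' := fun c γ => by
        ext t
        exact intervalIntegral.integral_smul _ _ }
    1 (fun γ => by
      rw [one_mul]
      exact (ContinuousMap.norm_le _ (norm_nonneg _)).2 fun t =>
        intervalIntegral_projIcc_norm_le γ t.2)

theorem primitive_apply (γ : C(unitInterval, E)) (t : unitInterval) :
    primitive E γ t = ∫ s in (0 : ℝ)..t, γ (projIcc 0 1 zero_le_one s) := rfl

/-- Rescaling of the time parameter. -/
def rescale (σ : unitInterval) (γ : C(unitInterval, E)) : C(unitInterval, E) :=
  ⟨fun s => γ (σ * s), by fun_prop⟩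

/-- The substitution r ↦ σ r in the integral. -/
theorem primitive_rescale (σ s : unitInterval) (γ : C(unitInterval, E)) :
    primitive E γ (σ * s) = (σ : ℝ) • primitive E (rescale σ γ) s := by
  rw [primitive_apply, primitive_apply]
  have h := intervalIntegral.smul_integral_comp_mul_left (a := 0) (b := s)
    (fun s : ℝ => γ (projIcc 0 1 zero_le_one s)) (σ : ℝ)
  rw [mul_zero] at h
  change ∫ r in (0 : ℝ)..((σ : ℝ) * s), _ = _
  rw [← h]
  congr 1
  refine intervalIntegral.integral_congr fun r hr => ?_
  rw [uIcc_of_le s.2.1] at hr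
  have hr' : r ∈ Icc (0 : ℝ) 1 := ⟨hr.1, hr.2.trans s.2.2⟩
  change γ _ = γ (σ * projIcc 0 1 zero_le_one r)
  rw [projIcc_of_mem _ hr', projIcc_of_mem _ (x := (σ : ℝ) * r)
    (unitInterval.mul_mem σ.2 hr')]
  rfl

end SmoothFlow

/-! ### Smooth local flows by inverting the integral equation -/

section Flow

variable {E : Type*} [NormedAddCommGroup E] [NormedSpace ℝ E]

variable (E) in
/-- Constant curves, as a continuous linear map. -/
def constCurve : E →L[ℝ] C(unitInterval, E) :=
  LinearMap.mkContinuous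
    { toFun := fun x => ContinuousMap.const _ x
      map_add' := fun _ _ => rfl
      map_smul' := fun _ _ => rfl } 1
    (fun x => by
      rw [one_mul]
      exact (ContinuousMap.norm_le _ (norm_nonneg _)).2 fun _ => le_rfl)

/-- The Picard operator without the initial value. -/
def picard (V : C(E, E)) (γ : C(unitInterval, E)) : C(unitInterval, E) := primitive E (V.comp γ)

theorem contDiff_picard {V : C(E, E)} (hV : ContDiff ℝ ∞ V) : ContDiff ℝ ∞ (picard V) :=
  (primitive E).contDiff.comp (contDiff_superposition V hV)

/-- The map whose zeros in the second variable are the solution curves of `V`. -/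
def solutionMap (V : C(E, E)) (p : (ℝ × E) × C(unitInterval, E)) :
    (ℝ × E) × C(unitInterval, E) :=
  (p.1, p.2 - constCurve E p.1.2 - p.1.1 • picard V p.2)

theorem contDiff_solutionMap {V : C(E, E)} (hV : ContDiff ℝ ∞ V) :
    ContDiff ℝ ∞ (solutionMap V) :=
  contDiff_fst.prodMk ((contDiff_snd.sub ((constCurve E).contDiff.comp
    (contDiff_snd.comp contDiff_fst))).sub
    ((contDiff_fst.comp contDiff_fst).smul ((contDiff_picard hV).comp contDiff_snd)))

/-- At time 0 the derivative of the nonlinear term with respect to the curve is multiplied by 0. The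
derivative of the map is thus triangular with identities on the diagonal. -/
theorem hasFDerivAt_solutionMap {V : C(E, E)} (hV : ContDiff ℝ ∞ V) (x₀ : E) :
    ∃ e : ((ℝ × E) × C(unitInterval, E)) ≃L[ℝ] ((ℝ × E) × C(unitInterval, E)),
      HasFDerivAt (solutionMap V) (e : _ →L[ℝ] _) (((0, x₀) : ℝ × E), constCurve E x₀) := by
  have hN : HasFDerivAt (picard V) (fderiv ℝ (picard V) (constCurve E x₀)) (constCurve E x₀) :=
    ((contDiff_picard hV).differentiable (by simp) _).hasFDerivAt
  let L : ℝ × E →L[ℝ] C(unitInterval, E) :=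
    -((constCurve E).comp (ContinuousLinearMap.snd ℝ ℝ E))
      - (ContinuousLinearMap.fst ℝ ℝ E).smulRight (picard V (constCurve E x₀))
  refine ⟨ContinuousLinearEquiv.skewProd (.refl ℝ (ℝ × E))
    (.refl ℝ C(unitInterval, E)) L,
    ?_⟩
  let a : (ℝ × E) × C(unitInterval, E) := (((0, x₀) : ℝ × E), constCurve E x₀)
  have h₁ : HasFDerivAt (fun p : (ℝ × E) × C(unitInterval, E) => p.1)
      (ContinuousLinearMap.fst ℝ (ℝ × E) C(unitInterval, E)) a := hasFDerivAt_fst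
  have h₂ : HasFDerivAt (fun p : (ℝ × E) × C(unitInterval, E) => p.2)
      (ContinuousLinearMap.snd ℝ (ℝ × E) C(unitInterval, E)) a := hasFDerivAt_snd
  have h₃ := (constCurve E).hasFDerivAt.comp a
    ((ContinuousLinearMap.snd ℝ ℝ E).hasFDerivAt.comp a h₁)
  have h₄ := ((ContinuousLinearMap.fst ℝ ℝ E).hasFDerivAt.comp a h₁).smul (hN.comp a h₂)
  refine (h₁.prodMk ((h₂.sub h₃).sub h₄)).congr_fderiv ?_
  refine ContinuousLinearMap.ext fun p => Prod.ext rfl ?_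
  simp [a, L, ContinuousLinearEquiv.skewProd]
  abel

/-- If γ' = t V(γ) on [0, 1], then s ↦ γ(σ s) solves the same equation with σ t in place of t. This
homogeneity later turns the time-one value into a flow. -/
theorem rescale_eq_of_solution {V : C(E, E)} {t : ℝ} {x : E} {γ : C(unitInterval, E)}
    (h : solutionMap V ((t, x), γ) = ((t, x), 0)) (σ : unitInterval) :
    solutionMap V ((σ * t, x), rescale σ γ) = ((σ * t, x), 0) := by
  have h' : γ - constCurve E x - t • picard V γ = 0 := congrArg Prod.snd h
  refine Prod.ext rfl ?_
  ext s
  have h₁ := DFunLike.congr_fun h' (σ * s)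
  have h₂ := primitive_rescale σ s (V.comp γ)
  change γ (σ * s) - x - t • primitive E (V.comp γ) (σ * s) = 0 at h₁
  change γ (σ * s) - x - ((σ : ℝ) * t) • primitive E (rescale σ (V.comp γ)) s = 0
  rw [h₂, smul_smul, mul_comm t] at h₁
  exact h₁

/-- A smooth vector field on a Banach space has a local flow which is smooth in time and the
initial value together. -/
theorem exists_smooth_flow [CompleteSpace E] {V : E → E} (hV : ContDiff ℝ ∞ V) (x₀ : E) :
    ∃ r > 0, ∃ φ : ℝ × E → E, ContDiffOn ℝ ∞ φ (Metric.ball (0, x₀) r) ∧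
      (∀ x ∈ Metric.ball x₀ r, φ (0, x) = x) ∧
      ∀ p ∈ Metric.ball ((0 : ℝ), x₀) r, fderiv ℝ φ p (1, 0) = V (φ p) := by
  let W : C(E, E) := ⟨V, hV.continuous⟩
  obtain ⟨e, he⟩ := hasFDerivAt_solutionMap (V := W) hV x₀
  obtain ⟨P, haP, -, hP, hPs⟩ := exists_smooth_local_inverse isOpen_univ
    (contDiff_solutionMap (V := W) hV).contDiffOn (mem_univ _) he
  set a : (ℝ × E) × C(unitInterval, E) := (((0, x₀) : ℝ × E), constCurve E x₀) with ha
  have hPa : P a = (((0, x₀) : ℝ × E), 0) := by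
    rw [hP]
    refine Prod.ext rfl ?_
    change constCurve E x₀ - constCurve E x₀ - (0 : ℝ) • _ = _
    rw [sub_self, zero_smul, sub_zero]
  let Q : ℝ × E → (ℝ × E) × C(unitInterval, E) := fun q => P.symm (q, 0)
  have hi : Continuous (fun q : ℝ × E => ((q, 0) : (ℝ × E) × C(unitInterval, E))) := by fun_prop
  have hD : IsOpen {q : ℝ × E | ((q, 0) : (ℝ × E) × C(unitInterval, E)) ∈ P.target} :=
    P.open_target.preimage hi
  have hDa : ((0 : ℝ), x₀) ∈ {q : ℝ × E | ((q, 0) : (ℝ × E) × C(unitInterval, E)) ∈ P.target} := by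
    change _ ∈ P.target
    rw [← hPa]
    exact P.map_source haP
  have hQs : ContDiffOn ℝ ∞ Q {q : ℝ × E | ((q, 0) : (ℝ × E) × C(unitInterval, E)) ∈ P.target} :=
    hPs.comp (contDiff_id.prodMk contDiff_const).contDiffOn fun q hq => hq
  have hQa : Q (0, x₀) = a := by
    change P.symm _ = a
    rw [← hPa, P.left_inv haP]
  obtain ⟨ρ, hρ, hρs⟩ := Metric.isOpen_iff.1 P.open_source a haP
  have hQc : ContinuousAt Q (0, x₀) := (hQs.contDiffAt (hD.mem_nhds hDa)).continuousAt
  -- The solutions must lie in a ball inside the source of P, not merely in that source: the ball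
  -- also contains their rescalings, because rescaling fixes constant curves and does not increase
  -- the sup norm.
  obtain ⟨r, hr, hrs⟩ := Metric.mem_nhds_iff.1 (inter_mem (hD.mem_nhds hDa)
    (hQc (by rw [hQa]; exact Metric.ball_mem_nhds a hρ)))
  have hQ : ∀ q ∈ Metric.ball ((0 : ℝ), x₀) r, solutionMap W (q, (Q q).2) = (q, 0) ∧
      (Q q).1 = q := by
    intro q hq
    have h₁ : P (Q q) = (q, 0) := P.right_inv (hrs hq).1
    rw [hP] at h₁
    have h₂ : (Q q).1 = q := congrArg Prod.fst h₁
    refine ⟨?_, h₂⟩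
    rw [← h₁]
    congr 1
    exact Prod.ext h₂.symm rfl
  -- The rescaled solution and the solution for the rescaled time have the same image under P and
  -- lie in its source; injectivity of P identifies them.
  have hresc : ∀ t x, (t, x) ∈ Metric.ball ((0 : ℝ), x₀) r → ∀ σ : unitInterval,
      (Q (σ * t, x)).2 = rescale σ (Q (t, x)).2 := by
    intro t x hq σ
    have h₁ := rescale_eq_of_solution (hQ _ hq).1 σ
    have h₂ : Q (t, x) ∈ Metric.ball a ρ := (hrs hq).2
    have h₃ : (((σ * t, x) : ℝ × E), rescale σ (Q (t, x)).2) ∈ Metric.ball a ρ := by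
      have h₄ := (hQ _ hq).2
      have h₅ : Q (t, x) = ((t, x), (Q (t, x)).2) := Prod.ext h₄ rfl
      rw [h₅] at h₂
      rw [ha, ← ball_prod_same, ← ball_prod_same] at h₂ ⊢
      obtain ⟨⟨h₆, h₇⟩, h₈⟩ := h₂
      refine ⟨⟨?_, h₇⟩, ?_⟩
      · rw [mem_ball_zero_iff, Real.norm_eq_abs] at h₆ ⊢
        rw [abs_mul, abs_of_nonneg σ.2.1]
        exact (mul_le_of_le_one_left (abs_nonneg _) σ.2.2).trans_lt h₆
      · rw [mem_ball_iff_norm] at h₈ ⊢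
        refine lt_of_le_of_lt ((ContinuousMap.norm_le _ (norm_nonneg _)).2 fun s => ?_) h₈
        exact ((Q (t, x)).2 - constCurve E x₀).norm_coe_le_norm (σ * s)
    have h₄ := P.left_inv (hρs h₃)
    rw [hP, h₁] at h₄
    exact congrArg Prod.snd h₄
  let φ : ℝ × E → E := fun q => (Q q).2 1
  have hφ : ContDiffOn ℝ ∞ φ (Metric.ball (0, x₀) r) :=
    (ContinuousMap.evalCLM (M := E) ℝ (1 : unitInterval)).contDiff.comp_contDiffOn
      (contDiff_snd.comp_contDiffOn (hQs.mono fun q hq => (hrs hq).1))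
  have hφd : ∀ q ∈ Metric.ball ((0 : ℝ), x₀) r, HasFDerivAt φ (fderiv ℝ φ q) q := fun q hq =>
    ((hφ.contDiffAt (Metric.isOpen_ball.mem_nhds hq)).differentiableAt (by simp)).hasFDerivAt
  have hsol : ∀ q ∈ Metric.ball ((0 : ℝ), x₀) r, ∀ s : unitInterval,
      (Q q).2 s = q.2 + q.1 • primitive E (W.comp (Q q).2) s := by
    intro q hq s
    have h₁ : (Q q).2 - constCurve E q.2 - q.1 • picard W (Q q).2 = 0 :=
      congrArg Prod.snd (hQ q hq).1
    have h₂ := DFunLike.congr_fun h₁ s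
    change (Q q).2 s - q.2 - q.1 • primitive E (W.comp (Q q).2) s = 0 at h₂
    rw [sub_sub, sub_eq_zero] at h₂
    exact h₂
  refine ⟨r, hr, φ, hφ, fun x hx => ?_, ?_⟩
  · have hq : ((0 : ℝ), x) ∈ Metric.ball ((0 : ℝ), x₀) r := by
      rw [← ball_prod_same]; exact ⟨Metric.mem_ball_self hr, hx⟩
    have h := hsol _ hq 1
    rw [zero_smul, add_zero] at h
    exact h
  -- By rescaling, φ(σ t, x) is the value at σ of the solution for (t, x). Differentiating the
  -- integral equation at σ = 1, from within [0, 1], gives the flow equation multiplied by t.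
  have hmain : ∀ t x, (t, x) ∈ Metric.ball ((0 : ℝ), x₀) r →
      t • fderiv ℝ φ (t, x) (1, 0) = t • V (φ (t, x)) := by
    intro t x hq
    have h₁ : HasDerivAt (fun σ : ℝ => φ (σ * t, x)) (t • fderiv ℝ φ (t, x) (1, 0)) 1 := by
      have hc : HasDerivAt (fun σ : ℝ => ((σ * t, x) : ℝ × E)) (t, 0) 1 := by
        have := (hasDerivAt_id (1 : ℝ)).mul_const t
        rw [one_mul] at this
        exact this.prodMk (hasDerivAt_const _ _)
      have h := hφd _ hq
      rw [← one_mul t] at h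
      have h' := h.comp_hasDerivAt (1 : ℝ) hc
      rw [one_mul] at h'
      rw [← map_smul]
      refine h'.congr_deriv ?_
      rw [Prod.smul_mk, smul_zero, smul_eq_mul, mul_one]
    have h₂ : HasDerivAt (fun σ : ℝ => x + t • ∫ s in (0 : ℝ)..σ,
        (W.comp (Q (t, x)).2) (projIcc 0 1 zero_le_one s)) (t • V (φ (t, x))) 1 := by
      have hc := continuous_projIcc_comp (W.comp (Q (t, x)).2)
      have h := intervalIntegral.integral_hasDerivAt_right (hc.intervalIntegrable 0 1)
        hc.aestronglyMeasurable.stronglyMeasurableAtFilter hc.continuousAt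
      have h' := (h.const_smul t).const_add x
      refine h'.congr_deriv ?_
      rw [projIcc_right]
      rfl
    have h₃ : EqOn (fun σ : ℝ => φ (σ * t, x)) (fun σ : ℝ => x + t • ∫ s in (0 : ℝ)..σ,
        (W.comp (Q (t, x)).2) (projIcc 0 1 zero_le_one s)) (Icc 0 1) := by
      intro σ hσ
      change (Q (σ * t, x)).2 1 = _
      have h := hresc t x hq ⟨σ, hσ⟩
      change (Q (σ * t, x)).2 = _ at h
      rw [h]
      change (Q (t, x)).2 (⟨σ, hσ⟩ * 1) = _
      rw [mul_one, hsol _ hq]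
      rfl
    have hu : UniqueDiffWithinAt ℝ (Icc (0 : ℝ) 1) 1 :=
      uniqueDiffOn_Icc zero_lt_one 1 (by simp)
    exact hu.eq_deriv _ h₁.hasDerivWithinAt
      (h₂.hasDerivWithinAt.congr h₃ (h₃ (by simp)))
  rintro ⟨t, x⟩ hq
  rcases ne_or_eq t 0 with ht | rfl
  · exact smul_right_injective E ht (hmain t x hq)
  -- At t = 0 nothing can be cancelled; the flow equation there is the limit of the equation for t ≠
  -- 0.
  have hb : Metric.ball ((0 : ℝ), x₀) r ∈ 𝓝 ((0 : ℝ), x) := Metric.isOpen_ball.mem_nhds hq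
  have hline : ContinuousAt (fun t : ℝ => (t, x)) 0 := by fun_prop
  have hcd : ContinuousAt (fun q => fderiv ℝ φ q (1, 0)) ((0 : ℝ), x) :=
    (((hφ.continuousOn_fderiv_of_isOpen Metric.isOpen_ball (by simp)).continuousAt hb)).clm_apply
      continuousAt_const
  have hcv : ContinuousAt (fun q => V (φ q)) ((0 : ℝ), x) :=
    hV.continuous.continuousAt.comp (hφ.continuousOn.continuousAt hb)
  have h₁ : Tendsto (fun t : ℝ => fderiv ℝ φ (t, x) (1, 0)) (𝓝[≠] 0)
      (𝓝 (fderiv ℝ φ (0, x) (1, 0))) :=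
    (ContinuousAt.comp (f := fun t : ℝ => (t, x)) hcd hline).tendsto.mono_left nhdsWithin_le_nhds
  have h₂ : Tendsto (fun t : ℝ => V (φ (t, x))) (𝓝[≠] 0) (𝓝 (V (φ (0, x)))) :=
    (ContinuousAt.comp (f := fun t : ℝ => (t, x)) hcv hline).tendsto.mono_left nhdsWithin_le_nhds
  refine tendsto_nhds_unique (h₁.congr' ?_) h₂
  filter_upwards [self_mem_nhdsWithin, nhdsWithin_le_nhds (hline.eventually hb)] with t ht hq'
  exact smul_right_injective E ht (hmain t x hq')

end Flow

/-! ### Straightening the common kernel of two covector fields in dimension three -/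

section Straightening

variable {E : Type*} [NormedAddCommGroup E] [NormedSpace ℝ E]

theorem exists_continuousLinearEquiv_of_injective {X Y : Type*} [NormedAddCommGroup X]
    [NormedSpace ℝ X] [NormedAddCommGroup Y] [NormedSpace ℝ Y] [FiniteDimensional ℝ X]
    [FiniteDimensional ℝ Y] (f : X →L[ℝ] Y) (hf : ∀ v, f v = 0 → v = 0)
    (h : Module.finrank ℝ X = Module.finrank ℝ Y) : ∃ e : X ≃L[ℝ] Y, (e : X →L[ℝ] Y) = f := by
  have hi : Function.Injective (f : X →ₗ[ℝ] Y) := (injective_iff_map_eq_zero _).2 hf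
  refine ⟨(LinearEquiv.ofInjectiveOfFinrankEq _ hi h).toContinuousLinearEquiv, ?_⟩
  ext v
  rfl

theorem finrank_E2_prod : Module.finrank ℝ (E2 × ℝ) = 3 := by
  simp

/-- A basis adapted to two independent covectors in dimension three. -/
theorem exists_adapted_basis (hE : Module.finrank ℝ E = 3) {a₁ a₂ : E →L[ℝ] ℝ}
    (h : ∃ v w, a₁ v * a₂ w - a₁ w * a₂ v ≠ 0) : ∃ v₀ e₁ e₂ : E, v₀ ≠ 0 ∧ a₁ v₀ = 0 ∧ a₂ v₀ = 0 ∧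
      a₁ e₁ = 1 ∧ a₁ e₂ = 0 ∧ a₂ e₁ = 0 ∧ a₂ e₂ = 1 := by
  have : FiniteDimensional ℝ E := Module.finite_of_finrank_pos (by omega)
  obtain ⟨v, w, h⟩ := h
  have hk : (a₁.prod a₂).toLinearMap.ker ≠ ⊥ :=
    LinearMap.ker_ne_bot_of_finrank_lt (by rw [hE]; simp)
  obtain ⟨v₀, hv₀, hne⟩ := Submodule.exists_mem_ne_zero_of_ne_bot hk
  have hv : (a₁ v₀, a₂ v₀) = 0 := hv₀
  rw [Prod.mk_eq_zero] at hv
  refine ⟨v₀, (a₁ v * a₂ w - a₁ w * a₂ v)⁻¹ • (a₂ w • v - a₂ v • w),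
    (a₁ v * a₂ w - a₁ w * a₂ v)⁻¹ • (a₁ v • w - a₁ w • v), hne, hv.1, hv.2, ?_, ?_, ?_, ?_⟩ <;>
  simp only [map_smul, map_sub, smul_eq_mul] <;> field_simp <;> ring

/-- The vector field annihilated by two covector fields, with constant reference vectors. -/
def crossField (α₁ α₂ : E → E →L[ℝ] ℝ) (v₀ e₁ e₂ y : E) : E :=
  (α₁ y e₁ * α₂ y e₂ - α₁ y e₂ * α₂ y e₁) • v₀ - (α₁ y v₀ * α₂ y e₂ - α₂ y v₀ * α₁ y e₂) • e₁
    - (α₂ y v₀ * α₁ y e₁ - α₁ y v₀ * α₂ y e₁) • e₂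

/-- The coefficients are the cofactors of a 3×3 determinant whose other rows are α₁ and α₂, so
applying α₁ gives a determinant with a repeated row. No relation to the reference vectors is needed.
-/
theorem crossField_apply₁ (α₁ α₂ : E → E →L[ℝ] ℝ) (v₀ e₁ e₂ y : E) :
    α₁ y (crossField α₁ α₂ v₀ e₁ e₂ y) = 0 := by
  simp only [crossField, map_sub, map_smul, smul_eq_mul]
  ring

theorem crossField_apply₂ (α₁ α₂ : E → E →L[ℝ] ℝ) (v₀ e₁ e₂ y : E) :
    α₂ y (crossField α₁ α₂ v₀ e₁ e₂ y) = 0 := by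
  simp only [crossField, map_sub, map_smul, smul_eq_mul]
  ring

theorem contDiffOn_crossField {α₁ α₂ : E → E →L[ℝ] ℝ} {U : Set E} (h₁ : ContDiffOn ℝ ∞ α₁ U)
    (h₂ : ContDiffOn ℝ ∞ α₂ U) (v₀ e₁ e₂ : E) :
    ContDiffOn ℝ ∞ (crossField α₁ α₂ v₀ e₁ e₂) U := by
  have k₁ : ∀ v, ContDiffOn ℝ ∞ (fun y => α₁ y v) U := fun v => h₁.clm_apply contDiffOn_const
  have k₂ : ∀ v, ContDiffOn ℝ ∞ (fun y => α₂ y v) U := fun v => h₂.clm_apply contDiffOn_const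
  exact (((((k₁ _).mul (k₂ _)).sub ((k₁ _).mul (k₂ _))).smul contDiffOn_const).sub
    ((((k₁ _).mul (k₂ _)).sub ((k₂ _).mul (k₁ _))).smul contDiffOn_const)).sub
    ((((k₂ _).mul (k₁ _)).sub ((k₁ _).mul (k₂ _))).smul contDiffOn_const)

/-- The linear coordinates defined by three vectors. -/
def basisMap (v₀ e₁ e₂ : E) : E2 × ℝ →L[ℝ] E :=
  (((EuclideanSpace.proj (0 : Fin 2) : E2 →L[ℝ] ℝ).smulRight e₁
    + (EuclideanSpace.proj (1 : Fin 2) : E2 →L[ℝ] ℝ).smulRight e₂).comp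
      (ContinuousLinearMap.fst ℝ E2 ℝ)) + (ContinuousLinearMap.snd ℝ E2 ℝ).smulRight v₀

theorem basisMap_apply (v₀ e₁ e₂ : E) (q : E2 × ℝ) :
    basisMap v₀ e₁ e₂ q = q.1 0 • e₁ + q.1 1 • e₂ + q.2 • v₀ := rfl

/-- Two independent covector fields near a point of a 3-dimensional space are straightened by
smooth coordinates in which the last coordinate lines are tangent to both kernels. -/
theorem exists_straightening_flat (hE : Module.finrank ℝ E = 3) {α₁ α₂ : E → E →L[ℝ] ℝ}
    {U : Set E} (hU : IsOpen U) (h₁ : ContDiffOn ℝ ∞ α₁ U) (h₂ : ContDiffOn ℝ ∞ α₂ U) {y₀ : E}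
    (hy₀ : y₀ ∈ U) (h : ∃ v w, α₁ y₀ v * α₂ y₀ w - α₁ y₀ w * α₂ y₀ v ≠ 0) :
    ∃ P : OpenPartialHomeomorph (E2 × ℝ) E, 0 ∈ P.source ∧ P 0 = y₀ ∧ P.target ⊆ U ∧
      ContDiffOn ℝ ∞ P P.source ∧ ContDiffOn ℝ ∞ P.symm P.target ∧
      ∀ q ∈ P.source, α₁ (P q) (fderiv ℝ P q (0, 1)) = 0 ∧ α₂ (P q) (fderiv ℝ P q (0, 1)) = 0 := by
  have : FiniteDimensional ℝ E := Module.finite_of_finrank_pos (by omega)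
  have : CompleteSpace E := FiniteDimensional.complete ℝ E
  obtain ⟨v₀, e₁, e₂, hv₀, ha, hb, h₁₁, h₁₂, h₂₁, h₂₂⟩ := exists_adapted_basis hE h
  obtain ⟨ρ, hρ, hρU⟩ := Metric.isOpen_iff.1 hU y₀ hy₀
  -- `exists_smooth_flow` asks for a field smooth on the whole space. The cut-off keeps the field in
  -- the common kernel everywhere and leaves the value v₀ at y₀ unchanged.
  let b : ContDiffBump y₀ := ⟨ρ / 4, ρ / 2, by positivity, by linarith⟩
  let V : E → E := fun y => b y • crossField α₁ α₂ v₀ e₁ e₂ y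
  have hVU : ContDiffOn ℝ ∞ V U := b.contDiff.contDiffOn.smul (contDiffOn_crossField h₁ h₂ _ _ _)
  have hts : tsupport b ⊆ U := by
    rw [b.tsupport_eq]
    exact (Metric.closedBall_subset_ball (by change ρ / 2 < ρ; linarith)).trans hρU
  have hV : ContDiff ℝ ∞ V := contDiff_iff_contDiffAt.2 fun y => by
    by_cases hy : y ∈ U
    · exact hVU.contDiffAt (hU.mem_nhds hy)
    · refine (contDiffAt_const (c := (0 : E))).congr_of_eventuallyEq ?_
      filter_upwards [notMem_tsupport_iff_eventuallyEq.1 fun h => hy (hts h)] with z hz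
      change b z • _ = _
      rw [hz, Pi.zero_apply, zero_smul]
  have hVy₀ : V y₀ = v₀ := by
    change b y₀ • crossField α₁ α₂ v₀ e₁ e₂ y₀ = v₀
    rw [b.one_of_mem_closedBall (Metric.mem_closedBall_self b.rIn_pos.le)]
    simp [crossField, ha, hb, h₁₁, h₁₂, h₂₁, h₂₂]
  have hVk : ∀ y, α₁ y (V y) = 0 ∧ α₂ y (V y) = 0 := fun y => by
    constructor
    · change α₁ y (b y • crossField α₁ α₂ v₀ e₁ e₂ y) = 0
      rw [map_smul, crossField_apply₁, smul_zero]
    · change α₂ y (b y • crossField α₁ α₂ v₀ e₁ e₂ y) = 0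
      rw [map_smul, crossField_apply₂, smul_zero]
  obtain ⟨r, hr, φ, hφ, hφ₀, hφV⟩ := exists_smooth_flow hV y₀
  let A : E2 × ℝ →L[ℝ] ℝ × E :=
    (ContinuousLinearMap.snd ℝ E2 ℝ).prod (basisMap 0 e₁ e₂)
  let c : ℝ × E := (0, y₀)
  have hAc : ContDiff ℝ ∞ (fun q => A q + c) := A.contDiff.add contDiff_const
  -- H flows the point y₀ + x₀ e₁ + x₁ e₂ of a transversal plane for the time given by the last
  -- coordinate. Its derivative at 0 sends the coordinate basis to e₁, e₂, v₀, and its last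
  -- coordinate lines are flow lines.
  let H : E2 × ℝ → E := fun q => φ (A q + c)
  have hA0 : A 0 + c = (0, y₀) := by rw [map_zero, zero_add]
  let W : Set (E2 × ℝ) := (fun q => A q + c) ⁻¹' Metric.ball ((0 : ℝ), y₀) r
  have hW : IsOpen W := Metric.isOpen_ball.preimage hAc.continuous
  have h0W : (0 : E2 × ℝ) ∈ W := by
    change A 0 + c ∈ Metric.ball ((0 : ℝ), y₀) r
    rw [hA0]
    exact Metric.mem_ball_self hr
  have hHW : ContDiffOn ℝ ∞ H W := hφ.comp hAc.contDiffOn fun q hq => hq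
  have hφd : ∀ q ∈ W, HasFDerivAt φ (fderiv ℝ φ (A q + c)) (A q + c) := fun q hq =>
    ((hφ.contDiffAt (Metric.isOpen_ball.mem_nhds hq)).differentiableAt (by simp)).hasFDerivAt
  have hHd : ∀ q ∈ W, HasFDerivAt H ((fderiv ℝ φ (A q + c)).comp A) q := fun q hq =>
    (hφd q hq).comp q (A.hasFDerivAt.add_const c)
  have hA01 : A (0, 1) = (1, 0) := by
    refine Prod.ext rfl ?_
    change basisMap 0 e₁ e₂ (0, 1) = 0
    simp [basisMap_apply]
  have hHt : ∀ q ∈ W, fderiv ℝ H q (0, 1) = V (H q) := fun q hq => by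
    rw [(hHd q hq).fderiv, ContinuousLinearMap.comp_apply, hA01]
    exact hφV _ hq
  have hH0 : H 0 = y₀ := by
    change φ (A 0 + c) = y₀
    rw [hA0]
    exact hφ₀ _ (Metric.mem_ball_self hr)
  have hφx : ∀ v, fderiv ℝ φ (0, y₀) (0, v) = v := fun v => by
    have hd := hφd 0 h0W
    rw [hA0] at hd
    have h' := hd.comp y₀ (hasFDerivAt_prodMk_right (0 : ℝ) y₀)
    have h'' : HasFDerivAt (φ ∘ fun x => ((0 : ℝ), x)) (ContinuousLinearMap.id ℝ E) y₀ := by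
      refine (hasFDerivAt_id y₀).congr_of_eventuallyEq ?_
      filter_upwards [Metric.ball_mem_nhds y₀ hr] with x hx using hφ₀ x hx
    exact DFunLike.congr_fun (h'.unique h'') v
  have hH0d : (fderiv ℝ φ (A 0 + c)).comp A = basisMap v₀ e₁ e₂ := by
    refine ContinuousLinearMap.ext fun q => ?_
    have hd : A q = q.2 • (1, 0) + (0, basisMap 0 e₁ e₂ q) := by
      refine Prod.ext ?_ ?_
      · change q.2 = q.2 • 1 + 0
        simp
      · change basisMap 0 e₁ e₂ q = q.2 • 0 + _
        simp
    have hv := hφV (0, y₀) (Metric.mem_ball_self hr)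
    rw [hφ₀ _ (Metric.mem_ball_self hr), hVy₀] at hv
    rw [ContinuousLinearMap.comp_apply, hA0, hd, map_add, map_smul, hφx, hv]
    simp only [basisMap_apply]
    simp [add_comm]
  have hE2 : Module.finrank ℝ (E2 × ℝ) = Module.finrank ℝ E := by rw [finrank_E2_prod, hE]
  obtain ⟨e, he⟩ := exists_continuousLinearEquiv_of_injective (basisMap v₀ e₁ e₂) (fun q hq => by
    rw [basisMap_apply] at hq
    have q₀ := congrArg (α₁ y₀) hq
    have q₁ := congrArg (α₂ y₀) hq
    simp [ha, hb, h₁₁, h₁₂, h₂₁, h₂₂] at q₀ q₁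
    rw [q₀, q₁, zero_smul, zero_smul, zero_add, zero_add] at hq
    refine Prod.ext ?_ ((smul_eq_zero.1 hq).resolve_right hv₀)
    ext i
    fin_cases i
    · exact q₀
    · exact q₁) hE2
  have hd0 := hHd 0 h0W
  rw [hH0d, ← he] at hd0
  have hWU : IsOpen (W ∩ H ⁻¹' U) := hHW.continuousOn.isOpen_inter_preimage hW hU
  obtain ⟨P, h0P, hPW, hPH, hPs⟩ := exists_smooth_local_inverse hWU (hHW.mono inter_subset_left)
    ⟨h0W, by change H 0 ∈ U; rwa [hH0]⟩ hd0
  refine ⟨P, h0P, by rw [hPH, hH0], fun y hy => ?_, ?_, hPs, fun q hq => ?_⟩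
  · rw [← P.right_inv hy, hPH]
    exact (hPW (P.map_target hy)).2
  · rw [hPH]
    exact hHW.mono fun q hq => (hPW hq).1
  · rw [hPH, hHt q (hPW hq).1]
    exact hVk _

/-- The coordinates of `exists_straightening_flat` can be defined on the whole space. -/
theorem exists_global_straightening_flat (hE : Module.finrank ℝ E = 3) {α₁ α₂ : E → E →L[ℝ] ℝ}
    {U : Set E} (hU : IsOpen U) (h₁ : ContDiffOn ℝ ∞ α₁ U) (h₂ : ContDiffOn ℝ ∞ α₂ U) {y₀ : E}
    (hy₀ : y₀ ∈ U) (h : ∃ v w, α₁ y₀ v * α₂ y₀ w - α₁ y₀ w * α₂ y₀ v ≠ 0) :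
    ∃ P : OpenPartialHomeomorph (E2 × ℝ) E, P.source = univ ∧ P 0 = y₀ ∧ P.target ⊆ U ∧
      ContDiff ℝ ∞ P ∧ ContDiffOn ℝ ∞ P.symm P.target ∧
      ∀ q, α₁ (P q) (fderiv ℝ P q (0, 1)) = 0 ∧ α₂ (P q) (fderiv ℝ P q (0, 1)) = 0 := by
  obtain ⟨P, h0, hP0, hPU, hPs, hPi, hPk⟩ := exists_straightening_flat hE hU h₁ h₂ hy₀ h
  obtain ⟨r, hr, hrP⟩ := Metric.isOpen_iff.1 P.open_source 0 h0
  -- Compressing each factor separately keeps the vertical direction vertical, up to a scalar.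
  -- Coordinates on all of E2 × ℝ let the plane itself serve as the surface and make every fibre a
  -- connected line.
  let B₁ := OpenPartialHomeomorph.univBall (0 : E2) r
  let B₂ := OpenPartialHomeomorph.univBall (0 : ℝ) r
  let Q := B₁.prod B₂
  have hQs : Q.source = univ := by
    change B₁.source ×ˢ B₂.source = univ
    rw [OpenPartialHomeomorph.univBall_source, OpenPartialHomeomorph.univBall_source,
      univ_prod_univ]
  have hQt : Q.target = Metric.ball 0 r := by
    change B₁.target ×ˢ B₂.target = _
    rw [OpenPartialHomeomorph.univBall_target _ hr, OpenPartialHomeomorph.univBall_target _ hr,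
      ball_prod_same]
    rfl
  have hQ : ∀ q, Q q ∈ P.source := fun q =>
    hrP (hQt ▸ Q.map_source (by rw [hQs]; exact mem_univ q))
  have hQd : ContDiff ℝ ∞ Q :=
    (OpenPartialHomeomorph.contDiff_univBall.comp contDiff_fst).prodMk
      (OpenPartialHomeomorph.contDiff_univBall.comp contDiff_snd)
  have hQi : ContDiffOn ℝ ∞ Q.symm Q.target := by
    rw [hQt, ← Prod.mk_zero_zero, ← ball_prod_same]
    exact (OpenPartialHomeomorph.contDiffOn_univBall_symm.comp contDiffOn_fst fun q hq => hq.1).prodMk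
      (OpenPartialHomeomorph.contDiffOn_univBall_symm.comp contDiffOn_snd fun q hq => hq.2)
  have hQ' : ∀ q : E2 × ℝ, fderiv ℝ Q q (0, 1) = (fderiv ℝ B₂ q.2 1) • ((0 : E2), (1 : ℝ)) := by
    intro q
    have d₁ : HasFDerivAt B₁ (fderiv ℝ B₁ q.1) q.1 :=
      ((OpenPartialHomeomorph.contDiff_univBall (n := 1)).differentiable (by simp) _).hasFDerivAt
    have d₂ : HasFDerivAt B₂ (fderiv ℝ B₂ q.2) q.2 :=
      ((OpenPartialHomeomorph.contDiff_univBall (n := 1)).differentiable (by simp) _).hasFDerivAt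
    have d : HasFDerivAt Q _ q := (d₁.comp q hasFDerivAt_fst).prodMk (d₂.comp q hasFDerivAt_snd)
    rw [d.fderiv]
    refine Prod.ext ?_ ?_
    · simp
    · simp
  have hPd : ∀ q, ContDiffAt ℝ ∞ P (Q q) := fun q =>
    hPs.contDiffAt (P.open_source.mem_nhds (hQ q))
  refine ⟨Q.trans P, ?_, ?_, fun y hy => hPU hy.1, ?_, ?_, fun q => ?_⟩
  · rw [OpenPartialHomeomorph.trans_source, hQs, univ_inter]
    exact eq_univ_of_forall hQ
  · change P (B₁ 0, B₂ 0) = y₀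
    rw [OpenPartialHomeomorph.univBall_apply_zero, OpenPartialHomeomorph.univBall_apply_zero]
    exact hP0
  · exact contDiff_iff_contDiffAt.2 fun q => (hPd q).comp q hQd.contDiffAt
  · exact hQi.comp (hPi.mono fun y hy => hy.1) fun y hy => hy.2
  · have hd : fderiv ℝ (Q.trans P) q (0, 1)
        = (fderiv ℝ B₂ q.2 1) • fderiv ℝ P (Q q) (0, 1) := by
      change fderiv ℝ (P ∘ Q) q (0, 1) = _
      rw [fderiv_comp _ ((hPd q).differentiableAt (by simp))
        (hQd.differentiable (by simp) q), ContinuousLinearMap.comp_apply, hQ' q, map_smul]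
    rw [hd, map_smul, map_smul]
    have hk := hPk _ (hQ q)
    exact ⟨(congrArg _ hk.1).trans (smul_zero _), (congrArg _ hk.2).trans (smul_zero _)⟩

end Straightening

/-! ### Straightening on a 3-manifold -/

section ManifoldStraightening

variable {E : Type*} [NormedAddCommGroup E] [NormedSpace ℝ E]
  {M : Type*} [TopologicalSpace M] [ChartedSpace E M] [IsManifold 𝓘(ℝ, E) ∞ M]
  {ω₁ ω₂ : OneForm E M}

theorem OneForm.IsSmooth.contDiffOn_inChart {η : OneForm E M} (h : η.IsSmooth) (x : M) :
    ContDiffOn ℝ ∞ (η.inChart x) (extChartAt 𝓘(ℝ, E) x).target := fun _ hy =>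
  (OneForm.isSmoothAt_model.1 ((OneForm.isSmooth_iff.1 h _).pullback
    (contMDiffAt_extChartAt_symm_self x hy))).contDiffWithinAt

/-- Around each point of a 3-manifold there are coordinates whose last coordinate lines are tangent
to the kernels of two independent 1-forms. -/
theorem exists_straightening (hE : Module.finrank ℝ E = 3) (h₁ : ω₁.IsSmooth) (h₂ : ω₂.IsSmooth)
    (p : M) (h : ∃ v w, wedge ω₁ ω₂ p v w ≠ 0) :
    ∃ ψ : OpenPartialHomeomorph (E2 × ℝ) M, ψ.source = univ ∧ p ∈ ψ.target ∧
      ContMDiff 𝓘(ℝ, E2 × ℝ) 𝓘(ℝ, E) ∞ ψ ∧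
      ContMDiffOn 𝓘(ℝ, E) 𝓘(ℝ, E2 × ℝ) ∞ ψ.symm ψ.target ∧
      ∀ q : E2 × ℝ, pullback (E := E2 × ℝ) ψ ω₁ q ((0, 1) : E2 × ℝ) = 0 ∧
        pullback (E := E2 × ℝ) ψ ω₂ q ((0, 1) : E2 × ℝ) = 0 := by
  obtain ⟨v, w, h⟩ := h
  have hU := isOpen_extChartAt_target (I := 𝓘(ℝ, E)) p
  obtain ⟨P, hPs, hP0, hPt, hP, hPi, hPk⟩ := exists_global_straightening_flat hE hU
    (h₁.contDiffOn_inChart p) (h₂.contDiffOn_inChart p) (mem_extChartAt_target p)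
    ⟨mfderiv 𝓘(ℝ, E) 𝓘(ℝ, E) (extChartAt 𝓘(ℝ, E) p) p v,
      mfderiv 𝓘(ℝ, E) 𝓘(ℝ, E) (extChartAt 𝓘(ℝ, E) p) p w, by
        rw [← OneForm.apply_eq_inChart, ← OneForm.apply_eq_inChart, ← OneForm.apply_eq_inChart,
          ← OneForm.apply_eq_inChart]
        exact h⟩
  have hPU : ∀ q, P q ∈ (extChartAt 𝓘(ℝ, E) p).target := fun q =>
    hPt (P.map_source (by rw [hPs]; exact mem_univ q))
  have hc := fun q => contMDiffAt_extChartAt_symm_self (E := E) p (hPU q)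
  have hPU' : ∀ q, P q ∈ (chartAt E p).target := fun q => by simpa using hPU q
  refine ⟨P.trans (chartAt E p).symm, ?_, ?_, ?_, ?_, fun q => ?_⟩
  · rw [OpenPartialHomeomorph.trans_source, hPs, univ_inter]
    exact eq_univ_of_forall hPU'
  · rw [OpenPartialHomeomorph.trans_target]
    refine ⟨mem_chart_source E p, ?_⟩
    change chartAt E p p ∈ P.target
    have : chartAt E p p = P 0 := hP0.symm
    rw [this]
    exact P.map_source (by rw [hPs]; exact mem_univ _)
  · exact fun q => (hc q).comp q (hP.contMDiff q)
  · intro x hx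
    rw [OpenPartialHomeomorph.trans_target] at hx
    refine ContMDiffAt.contMDiffWithinAt ?_
    have k₁ : ContMDiffAt 𝓘(ℝ, E) 𝓘(ℝ, E) ∞ (chartAt E p) x :=
      contMDiffOn_chart.contMDiffAt ((chartAt E p).open_source.mem_nhds hx.1)
    exact (hPi.contMDiffOn.contMDiffAt (P.open_target.mem_nhds hx.2)).comp x k₁
  · have hd : DifferentiableAt ℝ P q := hP.differentiable (by simp) q
    have key : ∀ η : OneForm E M, pullback (E := E2 × ℝ) (P.trans (chartAt E p).symm) η q
        = (η.inChart p (P q)).comp (fderiv ℝ P q) := by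
      intro η
      refine (pullback_comp (E := E2 × ℝ) η ((hc q).mdifferentiableAt (by simp))
        hd.mdifferentiableAt).trans ?_
      exact OneForm.comp_congr (E := E2 × ℝ) (N := E) (η.inChart p) rfl mfderiv_eq_fderiv
    exact ⟨(DFunLike.congr_fun (key ω₁) _).trans (hPk q).1,
      (DFunLike.congr_fun (key ω₂) _).trans (hPk q).2⟩

end ManifoldStraightening

/-! ### Metrics on the plane defined by a global coframe -/

section PlaneMetric

/-- The tangent bundle of a vector space has identity trivializations, so smoothness of the section
is smoothness of the map; the work is in unfolding the iterated hom bundle. -/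
theorem contMDiff_bilinear_section {F : Type*} [NormedAddCommGroup F] [NormedSpace ℝ F]
    {B : ∀ x : F, TangentSpace 𝓘(ℝ, F) x →L[ℝ] TangentSpace 𝓘(ℝ, F) x →L[ℝ] ℝ}
    (hB : ContDiff (F := F →L[ℝ] F →L[ℝ] ℝ) ℝ ∞ B) :
    ContMDiff 𝓘(ℝ, F) (𝓘(ℝ, F).prod 𝓘(ℝ, F →L[ℝ] F →L[ℝ] ℝ)) ∞
      (fun x => TotalSpace.mk' (F →L[ℝ] F →L[ℝ] ℝ)
        (E := fun x : F => TangentSpace 𝓘(ℝ, F) x →L[ℝ] TangentSpace 𝓘(ℝ, F) x →L[ℝ] ℝ)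
        x (B x)) := by
  intro x
  have h := (ContDiff.contMDiff hB) x
  rw [contMDiffAt_hom_bundle]
  refine ⟨contMDiffAt_id, h.congr_of_eventuallyEq (Eventually.of_forall fun y => ?_)⟩
  ext v w
  have hy : y ∈ (trivializationAt (F →L[ℝ] ℝ)
      (fun b : F => TangentSpace 𝓘(ℝ, F) b →L[ℝ] ℝ) x).baseSet := by
    rw [hom_trivializationAt_baseSet, TangentBundle.trivializationAt_baseSet, chartAt_self_eq]
    exact ⟨mem_univ y, mem_univ y⟩
  have k : ∀ L : TangentSpace 𝓘(ℝ, F) y →L[ℝ] ℝ, Trivialization.linearMapAt ℝ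
      (trivializationAt (F →L[ℝ] ℝ) (fun b : F => TangentSpace 𝓘(ℝ, F) b →L[ℝ] ℝ) x) y L w
        = L w := by
    intro L
    rw [Trivialization.coe_linearMapAt_of_mem _ hy]
    simp [hom_trivializationAt_apply, ContinuousLinearMap.inCoordinates]
    rfl
  simp only [ContinuousLinearMap.inCoordinates]
  refine Eq.trans ?_ (k (B y v))
  simp
  rfl

/-- The metric `a₁² - ε a₂²` on the plane defined by a coframe. -/
def SurfaceMetric.ofCoframe (ε : ℤˣ) (a₁ a₂ : E2 → E2 →L[ℝ] ℝ) (h₁ : ContDiff ℝ ∞ a₁)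
    (h₂ : ContDiff ℝ ∞ a₂) (h : ∀ y, ∃ v w, a₁ y v * a₂ y w - a₁ y w * a₂ y v ≠ 0) :
    SurfaceMetric ε E2 where
  inner y := ((a₁ y).smulRight (a₁ y) - sgn ε • (a₂ y).smulRight (a₂ y) : E2 →L[ℝ] E2 →L[ℝ] ℝ)
  symm y v w := by
    change a₁ y v * a₁ y w - sgn ε * (a₂ y v * a₂ y w)
      = a₁ y w * a₁ y v - sgn ε * (a₂ y w * a₂ y v)
    ring
  signature y := by
    obtain ⟨v, w, h⟩ := h y
    have k₁ : a₁ y ((a₁ y v * a₂ y w - a₁ y w * a₂ y v)⁻¹ • (a₂ y w • v - a₂ y v • w)) = 1 := by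
      simp only [map_smul, map_sub, smul_eq_mul]
      field_simp
    have k₂ : a₂ y ((a₁ y v * a₂ y w - a₁ y w * a₂ y v)⁻¹ • (a₂ y w • v - a₂ y v • w)) = 0 := by
      simp only [map_smul, map_sub, smul_eq_mul]
      ring
    have k₃ : a₁ y ((a₁ y v * a₂ y w - a₁ y w * a₂ y v)⁻¹ • (a₁ y v • w - a₁ y w • v)) = 0 := by
      simp only [map_smul, map_sub, smul_eq_mul]
      ring
    have k₄ : a₂ y ((a₁ y v * a₂ y w - a₁ y w * a₂ y v)⁻¹ • (a₁ y v • w - a₁ y w • v)) = 1 := by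
      simp only [map_smul, map_sub, smul_eq_mul]
      field_simp
    refine ⟨(a₁ y v * a₂ y w - a₁ y w * a₂ y v)⁻¹ • (a₂ y w • v - a₂ y v • w),
      (a₁ y v * a₂ y w - a₁ y w * a₂ y v)⁻¹ • (a₁ y v • w - a₁ y w • v), ?_, ?_, ?_⟩
    · change a₁ y _ * a₁ y _ - sgn ε * (a₂ y _ * a₂ y _) = 1
      rw [k₁, k₂]
      ring
    · change a₁ y _ * a₁ y _ - sgn ε * (a₂ y _ * a₂ y _) = 0
      rw [k₁, k₂, k₃, k₄]
      ring
    · change a₁ y _ * a₁ y _ - sgn ε * (a₂ y _ * a₂ y _) = -sgn ε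
      rw [k₃, k₄]
      ring
  smooth := by
    have hs : ContDiff ℝ ∞ (fun y => ((a₁ y).smulRight (a₁ y) - sgn ε • (a₂ y).smulRight (a₂ y) :
        E2 →L[ℝ] E2 →L[ℝ] ℝ)) :=
      (h₁.smulRight h₁).sub ((h₂.smulRight h₂).const_smul (sgn ε))
    exact contMDiff_bilinear_section hs

end PlaneMetric

/-! ### The metric on the leaf space and the tautological frame map -/

/-- Two smooth 1-forms on `E2 × ℝ` that vanish along the second factor, are independent, and satisfy
the first two structure equations with some `η`. -/
structure FiberedForms (ε : ℤˣ) (β₁ β₂ η : E2 × ℝ → E2 × ℝ →L[ℝ] ℝ) : Prop where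
  smooth₁ : ContDiff ℝ ∞ β₁
  smooth₂ : ContDiff ℝ ∞ β₂
  vertical₁ : ∀ q, β₁ q (0, 1) = 0
  vertical₂ : ∀ q, β₂ q (0, 1) = 0
  d₁ : ∀ q v w, extDerivFlat β₁ q v w = β₂ q v * η q w - β₂ q w * η q v
  d₂ : ∀ q v w, extDerivFlat β₂ q v w = sgn ε * (β₁ q v * η q w - β₁ q w * η q v)
  indep : ∀ q, ∃ v w, β₁ q v * β₂ q w - β₁ q w * β₂ q v ≠ 0

theorem apply_eq_apply_fst {L : E2 × ℝ →L[ℝ] ℝ} (h : L (0, 1) = 0) (v : E2 × ℝ) :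
    L v = L (v.1, 0) := by
  have : v = (v.1, 0) + v.2 • ((0 : E2), (1 : ℝ)) := by
    refine Prod.ext ?_ ?_
    · simp
    · simp
  conv_lhs => rw [this]
  rw [map_add, map_smul, h, smul_zero, add_zero]

/-- Cartan's formula: since β(∂_t) vanishes identically, the Lie derivative of β along ∂_t is the
contraction of dβ. -/
theorem fderiv_vertical_eq {β : E2 × ℝ → E2 × ℝ →L[ℝ] ℝ} (hβ : ContDiff ℝ ∞ β)
    (h : ∀ q, β q (0, 1) = 0) (q v : E2 × ℝ) :
    fderiv ℝ β q (0, 1) v = extDerivFlat β q (0, 1) v := by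
  have hd : HasFDerivAt (fun q => β q (0, 1)) ((fderiv ℝ β q).flip (0, 1)) q :=
    (ContinuousLinearMap.apply ℝ ℝ ((0, 1) : E2 × ℝ)).hasFDerivAt.comp q
      (hβ.differentiable (by simp) q).hasFDerivAt
  have h0 : HasFDerivAt (fun q => β q (0, 1)) (0 : E2 × ℝ →L[ℝ] ℝ) q :=
    (hasFDerivAt_const (0 : ℝ) q).congr_of_eventuallyEq (Eventually.of_forall h)
  have hz : fderiv ℝ β q v (0, 1) = 0 := DFunLike.congr_fun (hd.unique h0) v
  rw [extDerivFlat, hz, sub_zero]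

theorem hasDerivAt_vertical {β : E2 × ℝ → E2 × ℝ →L[ℝ] ℝ} (hβ : ContDiff ℝ ∞ β)
    (h : ∀ q, β q (0, 1) = 0) (y : E2) (t : ℝ) (v : E2 × ℝ) :
    HasDerivAt (fun t => β (y, t) v) (extDerivFlat β (y, t) (0, 1) v) t := by
  have hd : HasFDerivAt (fun q => β q v) ((fderiv ℝ β (y, t)).flip v) (y, t) :=
    (ContinuousLinearMap.apply ℝ ℝ v).hasFDerivAt.comp (y, t)
      (hβ.differentiable (by simp) (y, t)).hasFDerivAt
  have hl : HasDerivAt (fun t : ℝ => ((y, t) : E2 × ℝ)) (0, 1) t :=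
    (hasDerivAt_const t y).prodMk (hasDerivAt_id t)
  refine (hd.comp_hasDerivAt t hl).congr_deriv ?_
  exact fderiv_vertical_eq hβ h _ v

namespace FiberedForms

variable {ε : ℤˣ} {β₁ β₂ η : E2 × ℝ → E2 × ℝ →L[ℝ] ℝ} (H : FiberedForms ε β₁ β₂ η)

include H

/-- With h = η(∂_t), the vertical derivatives of β₁ and β₂ are -h β₂ and -ε h β₁. The contributions
to β₁² - ε β₂² cancel because ε² = 1. -/
theorem form_eq (y : E2) (s t : ℝ) (v w : E2 × ℝ) :
    β₁ (y, s) v * β₁ (y, s) w - sgn ε * (β₂ (y, s) v * β₂ (y, s) w)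
      = β₁ (y, t) v * β₁ (y, t) w - sgn ε * (β₂ (y, t) v * β₂ (y, t) w) := by
  have hd : ∀ r, HasDerivAt (fun r => β₁ (y, r) v * β₁ (y, r) w
      - sgn ε * (β₂ (y, r) v * β₂ (y, r) w)) 0 r := by
    intro r
    have k₁ := fun v => hasDerivAt_vertical H.smooth₁ H.vertical₁ y r v
    have k₂ := fun v => hasDerivAt_vertical H.smooth₂ H.vertical₂ y r v
    refine (((k₁ v).mul (k₁ w)).sub (((k₂ v).mul (k₂ w)).const_mul (sgn ε))).congr_deriv ?_
    rw [H.d₁, H.d₁, H.d₂, H.d₂, H.vertical₁, H.vertical₂]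
    linear_combination (β₂ (y, r) w * β₁ (y, r) v + β₂ (y, r) v * β₁ (y, r) w)
      * η (y, r) (0, 1) * sgn_mul_self ε
  exact is_const_of_deriv_eq_zero (fun r => (hd r).differentiableAt) (fun r => (hd r).deriv) s t

omit H in
variable (β₁ β₂) in
/-- The determinant of the two forms along the first factor. -/
def detAt (q : E2 × ℝ) : ℝ :=
  β₁ q (stdVec 0, 0) * β₂ q (stdVec 1, 0) - β₁ q (stdVec 1, 0) * β₂ q (stdVec 0, 0)

theorem indep_fst (q : E2 × ℝ) :
    ∃ v w : E2, β₁ q (v, 0) * β₂ q (w, 0) - β₁ q (w, 0) * β₂ q (v, 0) ≠ 0 := by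
  obtain ⟨v, w, h⟩ := H.indep q
  refine ⟨v.1, w.1, ?_⟩
  rwa [apply_eq_apply_fst (H.vertical₁ q) v, apply_eq_apply_fst (H.vertical₁ q) w,
    apply_eq_apply_fst (H.vertical₂ q) v, apply_eq_apply_fst (H.vertical₂ q) w] at h

theorem detAt_ne_zero (q : E2 × ℝ) : detAt β₁ β₂ q ≠ 0 := by
  obtain ⟨v, w, h⟩ := H.indep_fst q
  have := E2.wedge_eq ((β₁ q).comp (ContinuousLinearMap.inl ℝ E2 ℝ))
    ((β₂ q).comp (ContinuousLinearMap.inl ℝ E2 ℝ)) v w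
  intro h0
  refine h (this.trans ?_)
  change _ * detAt β₁ β₂ q = 0
  rw [h0, mul_zero]

omit H in
variable (β₁ β₂) in
/-- The first vector of the frame dual to the two forms along the first factor. -/
def dual₁ (q : E2 × ℝ) : E2 :=
  (detAt β₁ β₂ q)⁻¹ • (β₂ q (stdVec 1, 0) • stdVec 0 - β₂ q (stdVec 0, 0) • stdVec 1)

omit H in
variable (β₁ β₂) in
/-- The second vector of the frame dual to the two forms along the first factor. -/
def dual₂ (q : E2 × ℝ) : E2 :=
  (detAt β₁ β₂ q)⁻¹ • (β₁ q (stdVec 0, 0) • stdVec 1 - β₁ q (stdVec 1, 0) • stdVec 0)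

omit H in
theorem apply_comb (L : E2 × ℝ →L[ℝ] ℝ) (c a b : ℝ) (v w : E2) :
    L (c • (a • v - b • w), 0) = c * (a * L (v, 0) - b * L (w, 0)) := by
  have : ((c • (a • v - b • w), 0) : E2 × ℝ) = c • (a • (v, 0) - b • (w, 0)) := by
    simp
  rw [this, map_smul, map_sub, map_smul, map_smul]
  rfl

theorem apply₁_dual₁ (q : E2 × ℝ) : β₁ q (dual₁ β₁ β₂ q, 0) = 1 := by
  have h := H.detAt_ne_zero q
  rw [dual₁, apply_comb, inv_mul_eq_one₀ h, detAt]
  ring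

omit H in
theorem apply₂_dual₁ (q : E2 × ℝ) : β₂ q (dual₁ β₁ β₂ q, 0) = 0 := by
  rw [dual₁, apply_comb]
  ring

omit H in
theorem apply₁_dual₂ (q : E2 × ℝ) : β₁ q (dual₂ β₁ β₂ q, 0) = 0 := by
  rw [dual₂, apply_comb]
  ring

theorem apply₂_dual₂ (q : E2 × ℝ) : β₂ q (dual₂ β₁ β₂ q, 0) = 1 := by
  have h := H.detAt_ne_zero q
  rw [dual₂, apply_comb, inv_mul_eq_one₀ h, detAt]

theorem contDiff_detAt : ContDiff ℝ ∞ (detAt β₁ β₂) :=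
  ((H.smooth₁.clm_apply contDiff_const).mul (H.smooth₂.clm_apply contDiff_const)).sub
    ((H.smooth₁.clm_apply contDiff_const).mul (H.smooth₂.clm_apply contDiff_const))

theorem contDiff_dual₁ : ContDiff ℝ ∞ (dual₁ β₁ β₂) :=
  (H.contDiff_detAt.inv H.detAt_ne_zero).smul
    (((H.smooth₂.clm_apply contDiff_const).smul contDiff_const).sub
      ((H.smooth₂.clm_apply contDiff_const).smul contDiff_const))

theorem contDiff_dual₂ : ContDiff ℝ ∞ (dual₂ β₁ β₂) :=
  (H.contDiff_detAt.inv H.detAt_ne_zero).smul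
    (((H.smooth₁.clm_apply contDiff_const).smul contDiff_const).sub
      ((H.smooth₁.clm_apply contDiff_const).smul contDiff_const))

omit H in
theorem contDiff_restrict {β : E2 × ℝ → E2 × ℝ →L[ℝ] ℝ} (h : ContDiff ℝ ∞ β) :
    ContDiff ℝ ∞ (fun y : E2 => (β (y, 0)).comp (ContinuousLinearMap.inl ℝ E2 ℝ)) :=
  (h.comp (contDiff_id.prodMk contDiff_const)).clm_comp contDiff_const

/-- The metric on the base that makes the two forms the components of the projection in an
orthonormal frame. -/
def metric : SurfaceMetric ε E2 :=
  SurfaceMetric.ofCoframe ε _ _ (contDiff_restrict H.smooth₁) (contDiff_restrict H.smooth₂)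
    fun y => H.indep_fst (y, 0)

/-- The metric is defined on the slice t = 0; constancy along fibres allows any point of the fibre
to be used instead. -/
theorem metric_inner (q : E2 × ℝ) (v w : E2) : H.metric.inner q.1 v w
    = β₁ q (v, 0) * β₁ q (w, 0) - sgn ε * (β₂ q (v, 0) * β₂ q (w, 0)) :=
  H.form_eq q.1 0 q.2 (v, 0) (w, 0)

/-- The frame dual to the two forms, as a map to the orthonormal frame bundle. -/
def frame (q : E2 × ℝ) : OFrame H.metric where
  pt := q.1
  e₁ := dual₁ β₁ β₂ q
  e₂ := dual₂ β₁ β₂ q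
  g₁₁ := by
    refine (H.metric_inner q _ _).trans ?_
    rw [H.apply₁_dual₁, apply₂_dual₁]
    ring
  g₁₂ := by
    refine (H.metric_inner q _ _).trans ?_
    rw [H.apply₁_dual₁, apply₂_dual₁, apply₁_dual₂, H.apply₂_dual₂]
    ring
  g₂₂ := by
    refine (H.metric_inner q _ _).trans ?_
    rw [apply₁_dual₂, H.apply₂_dual₂]
    ring

theorem contDiffAt_inner {A B : E2 × ℝ → E2} {q : E2 × ℝ} (hA : ContDiffAt ℝ ∞ A q)
    (hB : ContDiffAt ℝ ∞ B q) :
    ContDiffAt ℝ ∞ (fun q : E2 × ℝ => H.metric.inner q.1 (A q) (B q)) q := by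
  have h : (fun q : E2 × ℝ => H.metric.inner q.1 (A q) (B q)) = fun q => β₁ q (A q, 0) * β₁ q (B q, 0)
      - sgn ε * (β₂ q (A q, 0) * β₂ q (B q, 0)) := funext fun q => H.metric_inner q _ _
  rw [h]
  have k₁ := H.smooth₁.contDiffAt (x := q)
  have k₂ := H.smooth₂.contDiffAt (x := q)
  have hA' : ContDiffAt ℝ ∞ (fun q => ((A q, 0) : E2 × ℝ)) q := hA.prodMk contDiffAt_const
  have hB' : ContDiffAt ℝ ∞ (fun q => ((B q, 0) : E2 × ℝ)) q := hB.prodMk contDiffAt_const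
  exact ((k₁.clm_apply hA').mul (k₁.clm_apply hB')).sub
    (contDiffAt_const.mul ((k₂.clm_apply hA').mul (k₂.clm_apply hB')))

/-- The frame map stays near `H.frame q₀` in one bundle chart, since its domain is cut out by
positivity of continuous functions. There its coordinates are the base point and a metric pairing,
which is smooth because the metric is expressed through β₁ and β₂. -/
theorem contMDiff_frame : ContMDiff 𝓘(ℝ, E2 × ℝ) 𝓘(ℝ, E2 × ℝ) ∞ H.frame := by
  intro q₀
  let u := H.frame q₀
  let D := u.localFrame
  have hU : D.U ∈ 𝓝 q₀.1 := D.isOpen.mem_nhds D.mem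
  have hX : ∀ X : ∀ x : E2, TangentSpace 𝓘(ℝ, E2) x,
      ContMDiffOn 𝓘(ℝ, E2) (𝓘(ℝ, E2).prod 𝓘(ℝ, E2)) ∞
        (fun x => TotalSpace.mk' E2 (E := fun x : E2 => TangentSpace 𝓘(ℝ, E2) x) x (X x)) D.U →
      ContDiffAt (E := E2 × ℝ) (F := E2) ℝ ∞ (fun q => X q.1) q₀ := by
    intro X h
    have h' : ContDiffOn (E := E2) (F := E2) ℝ ∞ X D.U :=
      contMDiffOn_vectorSpace_iff_contDiffOn.1 h
    exact (h'.contDiffAt hU).comp q₀ contDiffAt_fst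
  have hX₁ := hX _ D.smooth₁
  have hX₂ := hX _ D.smooth₂
  have hs := (H.contDiffAt_inner H.contDiff_dual₁.contDiffAt hX₂).const_smul (-sgn ε)
  have hb := (H.contDiffAt_inner H.contDiff_dual₁.contDiffAt hX₁).continuousAt
  have hc := ((H.contDiffAt_inner H.contDiff_dual₂.contDiffAt hX₂).const_smul (-sgn ε)).continuousAt
  have hF : ContDiffAt ℝ ∞ (fun q : E2 × ℝ => ((q.1, -sgn ε * H.metric.inner q.1 (H.frame q).e₁
      (D.X₂ q.1)) : E2 × ℝ)) q₀ := contDiffAt_fst.prodMk hs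
  have hmem := D.mem_chart_source
  have hsrc : ∀ᶠ q in 𝓝 q₀, H.frame q ∈ D.chart.source := by
    have i₁ := continuousAt_fst.eventually hU
    have i₂ := hb.eventually (lt_mem_nhds hmem.2.1)
    have i₃ := hc.eventually (lt_mem_nhds hmem.2.2)
    filter_upwards [i₁, i₂, i₃] with q j₁ j₂ j₃ using ⟨j₁, j₂, j₃⟩
  have hchart : ∀ q, D.chart (H.frame q) = (q.1, -sgn ε * H.metric.inner q.1 (H.frame q).e₁
      (D.X₂ q.1)) := fun q => rfl
  have ht : D.chart (H.frame q₀) ∈ (extChartAt 𝓘(ℝ, E2 × ℝ) u).target := mem_extChartAt_target u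
  have hsym := contMDiffAt_extChartAt_symm_self (E := E2 × ℝ) u ht
  refine (ContMDiffAt.comp q₀ hsym hF.contMDiffAt).congr_of_eventuallyEq ?_
  filter_upwards [hsrc] with q hq
  exact (D.chart.left_inv hq).symm

theorem mfderiv_pt_frame (q : E2 × ℝ) (v : TangentSpace 𝓘(ℝ, E2 × ℝ) q) :
    mfderiv 𝓘(ℝ, E2 × ℝ) 𝓘(ℝ, E2) (OFrame.pt ∘ H.frame) q v = (v : E2 × ℝ).1 := by
  have h : HasFDerivAt (OFrame.pt ∘ H.frame) (ContinuousLinearMap.fst ℝ E2 ℝ) q := hasFDerivAt_fst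
  exact DFunLike.congr_fun (mfderiv_eq_fderiv.trans h.fderiv) v

/-- The first solder form is the pairing of the projected vector with e₁. As e₁ is dual to (β₁, β₂),
that pairing is β₁ itself. -/
theorem pullback_frame_solder₁ (q : E2 × ℝ) :
    pullback (E := E2 × ℝ) H.frame (OFrame.solder₁ H.metric) q = β₁ q := by
  refine ContinuousLinearMap.ext fun v => ?_
  refine (OFrame.pullback_solder₁ ((H.contMDiff_frame q).mdifferentiableAt (by simp)) v).trans ?_
  refine (congrArg _ (H.mfderiv_pt_frame q v)).trans ?_
  refine (H.metric_inner q _ _).trans ?_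
  change β₁ q (dual₁ β₁ β₂ q, 0) * _ - sgn ε * (β₂ q (dual₁ β₁ β₂ q, 0) * _) = _
  rw [H.apply₁_dual₁, apply₂_dual₁, one_mul, zero_mul, mul_zero, sub_zero]
  exact (apply_eq_apply_fst (H.vertical₁ q) v).symm

theorem pullback_frame_solder₂ (q : E2 × ℝ) :
    pullback (E := E2 × ℝ) H.frame (OFrame.solder₂ H.metric) q = β₂ q := by
  refine ContinuousLinearMap.ext fun v => ?_
  refine (OFrame.pullback_solder₂ ((H.contMDiff_frame q).mdifferentiableAt (by simp)) v).trans ?_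
  refine (congrArg _ ((congrArg _ (H.mfderiv_pt_frame q v)).trans (H.metric_inner q _ _))).trans ?_
  change -sgn ε * (β₁ q (dual₂ β₁ β₂ q, 0) * _ - sgn ε * (β₂ q (dual₂ β₁ β₂ q, 0) * _)) = _
  rw [apply₁_dual₂, H.apply₂_dual₂]
  refine Eq.trans ?_ (apply_eq_apply_fst (H.vertical₂ q) v).symm
  linear_combination (β₂ q (Prod.fst (α := E2) v, 0)) * sgn_mul_self ε

end FiberedForms

/-! ### The inverse function theorem between manifolds -/

section LocalDiffeomorphism

variable {E : Type*} [NormedAddCommGroup E] [NormedSpace ℝ E] [CompleteSpace E]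
  {M : Type*} [TopologicalSpace M] [ChartedSpace E M] [IsManifold 𝓘(ℝ, E) ∞ M]
  {E' : Type*} [NormedAddCommGroup E'] [NormedSpace ℝ E']
  {N : Type*} [TopologicalSpace N] [ChartedSpace E' N] [IsManifold 𝓘(ℝ, E') ∞ N]

/-- The inverse function theorem on manifolds. -/
theorem exists_partialDiffeomorph {f : M → N} {W : Set M} (hW : IsOpen W) {p : M} (hp : p ∈ W)
    (hf : ∀ x ∈ W, ContMDiffAt 𝓘(ℝ, E) 𝓘(ℝ, E') ∞ f x) {e : E ≃L[ℝ] E'}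
    (he : mfderiv 𝓘(ℝ, E) 𝓘(ℝ, E') f p = (e : E →L[ℝ] E')) :
    ∃ Φ : PartialDiffeomorph 𝓘(ℝ, E) 𝓘(ℝ, E') M N ∞, p ∈ Φ.source ∧ Φ.source ⊆ W ∧
      EqOn Φ f Φ.source := by
  let c := chartAt E p
  let c' := chartAt E' (f p)
  have hfW : ContinuousOn f W := fun x hx => (hf x hx).continuousAt.continuousWithinAt
  let W' := W ∩ f ⁻¹' c'.source
  have hW' : IsOpen W' := hfW.isOpen_inter_preimage hW c'.open_source
  have hpW' : p ∈ W' := ⟨hp, mem_chart_source E' (f p)⟩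
  let U := c.target ∩ c.symm ⁻¹' W'
  have hU : IsOpen U := c.isOpen_inter_preimage_symm hW'
  have hcp : c.symm (c p) = p := c.left_inv (mem_chart_source E p)
  have hpU : c p ∈ U := ⟨c.map_source (mem_chart_source E p), by
    change c.symm (c p) ∈ W'
    rwa [hcp]⟩
  let F : E → E' := c' ∘ f ∘ c.symm
  have hF : ContDiffOn ℝ ∞ F U := by
    intro y hy
    have k₁ : ContMDiffAt 𝓘(ℝ, E) 𝓘(ℝ, E) ∞ c.symm y :=
      contMDiffOn_chart_symm.contMDiffAt (c.open_target.mem_nhds hy.1)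
    have k₂ : ContMDiffAt 𝓘(ℝ, E') 𝓘(ℝ, E') ∞ c' (f (c.symm y)) :=
      contMDiffOn_chart.contMDiffAt (c'.open_source.mem_nhds hy.2.2)
    exact (contMDiffAt_iff_contDiffAt.1
      (ContMDiffAt.comp y k₂ (ContMDiffAt.comp y (hf _ hy.2.1) k₁))).contDiffWithinAt
  have hd : HasFDerivAt F (e : E →L[ℝ] E') (c p) := by
    have h₁ := ((hF.contDiffAt (hU.mem_nhds hpU)).differentiableAt (by simp)).hasFDerivAt
    have h₂ := mfderiv_eq_fderiv_written ((hf p hp).mdifferentiableAt (by simp))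
    exact h₁.congr_fderiv (h₂.symm.trans he)
  obtain ⟨P, hPp, hPU, hPF, hPs⟩ := exists_smooth_local_inverse hU hF hpU hd
  have hPd : ContDiffOn ℝ ∞ P P.source := by
    rw [hPF]
    exact hF.mono hPU
  let Q := (c.trans P).trans c'.symm
  have hQ : ∀ x ∈ Q.source, x ∈ c.source ∧ c x ∈ P.source ∧ P (c x) ∈ c'.target :=
    fun x hx => ⟨hx.1.1, hx.1.2, hx.2⟩
  have hQt : ∀ x ∈ Q.target, x ∈ c'.source ∧ c' x ∈ P.target ∧ P.symm (c' x) ∈ c.target :=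
    fun x hx => ⟨hx.1, hx.2.1, hx.2.2⟩
  have hQW : Q.source ⊆ W' := fun x hx => by
    have h := (hPU (hQ x hx).2.1).2
    change c.symm (c x) ∈ W' at h
    rwa [c.left_inv (hQ x hx).1] at h
  refine ⟨{ toPartialEquiv := Q.toPartialEquiv
            open_source := Q.open_source
            open_target := Q.open_target
            contMDiffOn_toFun := fun x hx => ?_
            contMDiffOn_invFun := fun x hx => ?_ }, ?_, fun x hx => (hQW hx).1, fun x hx => ?_⟩
  · obtain ⟨h₁, h₂, h₃⟩ := hQ x hx
    have k₁ : ContMDiffAt 𝓘(ℝ, E) 𝓘(ℝ, E) ∞ c x :=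
      contMDiffOn_chart.contMDiffAt (c.open_source.mem_nhds h₁)
    have k₂ : ContMDiffAt 𝓘(ℝ, E) 𝓘(ℝ, E') ∞ P (c x) :=
      (hPd.contDiffAt (P.open_source.mem_nhds h₂)).contMDiffAt
    have k₃ : ContMDiffAt 𝓘(ℝ, E') 𝓘(ℝ, E') ∞ c'.symm (P (c x)) :=
      contMDiffOn_chart_symm.contMDiffAt (c'.open_target.mem_nhds h₃)
    exact (ContMDiffAt.comp x k₃ (ContMDiffAt.comp x k₂ k₁)).contMDiffWithinAt
  · obtain ⟨h₁, h₂, h₃⟩ := hQt x hx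
    have k₁ : ContMDiffAt 𝓘(ℝ, E') 𝓘(ℝ, E') ∞ c' x :=
      contMDiffOn_chart.contMDiffAt (c'.open_source.mem_nhds h₁)
    have k₂ : ContMDiffAt 𝓘(ℝ, E') 𝓘(ℝ, E) ∞ P.symm (c' x) :=
      (hPs.contDiffAt (P.open_target.mem_nhds h₂)).contMDiffAt
    have k₃ : ContMDiffAt 𝓘(ℝ, E) 𝓘(ℝ, E) ∞ c.symm (P.symm (c' x)) :=
      contMDiffOn_chart_symm.contMDiffAt (c.open_target.mem_nhds h₃)
    exact (ContMDiffAt.comp x k₃ (ContMDiffAt.comp x k₂ k₁)).contMDiffWithinAt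
  · refine ⟨⟨mem_chart_source E p, hPp⟩, ?_⟩
    change P (c p) ∈ c'.target
    rw [hPF]
    change c' (f (c.symm (c p))) ∈ c'.target
    rw [hcp]
    exact c'.map_source (mem_chart_source E' (f p))
  · change c'.symm (P (c x)) = f x
    rw [hPF]
    change c'.symm (c' (f (c.symm (c x)))) = f x
    rw [c.left_inv (hQ x hx).1, c'.left_inv (hQW hx).2]

end LocalDiffeomorphism

/-! ### Maps to a frame bundle that pull the solder forms back to given forms -/

section FrameMap

variable {E : Type*} [NormedAddCommGroup E] [NormedSpace ℝ E]
  {M : Type*} [TopologicalSpace M] [ChartedSpace E M] {ε : ℤˣ} {ω₁ ω₂ η : OneForm E M}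

/-- Cramer's rule gives an explicit preimage of every triple under (l₁, l₂, l₃). In dimension three
this surjectivity forces injectivity. -/
theorem eq_zero_of_det_ne_zero (hE : Module.finrank ℝ E = 3) {l₁ l₂ l₃ : E →L[ℝ] ℝ} {a b c : E}
    (h : l₁ a * (l₂ b * l₃ c - l₂ c * l₃ b) - l₁ b * (l₂ a * l₃ c - l₂ c * l₃ a)
      + l₁ c * (l₂ a * l₃ b - l₂ b * l₃ a) ≠ 0) {v : E} (h₁ : l₁ v = 0) (h₂ : l₂ v = 0)
    (h₃ : l₃ v = 0) : v = 0 := by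
  have : FiniteDimensional ℝ E := Module.finite_of_finrank_pos (by omega)
  let L : E →ₗ[ℝ] ℝ × ℝ × ℝ := (l₁.prod (l₂.prod l₃)).toLinearMap
  have hL : ∀ v : E, L v = (l₁ v, l₂ v, l₃ v) := fun _ => rfl
  have hi : Function.Injective L := by
    refine (LinearMap.injective_iff_surjective_of_finrank_eq_finrank (by simp [hE])).2 ?_
    rintro ⟨r, s, t⟩
    refine ⟨(l₁ a * (l₂ b * l₃ c - l₂ c * l₃ b) - l₁ b * (l₂ a * l₃ c - l₂ c * l₃ a)
      + l₁ c * (l₂ a * l₃ b - l₂ b * l₃ a))⁻¹ •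
      ((r * (l₂ b * l₃ c - l₂ c * l₃ b) - s * (l₁ b * l₃ c - l₁ c * l₃ b)
          + t * (l₁ b * l₂ c - l₁ c * l₂ b)) • a
        - (r * (l₂ a * l₃ c - l₂ c * l₃ a) - s * (l₁ a * l₃ c - l₁ c * l₃ a)
          + t * (l₁ a * l₂ c - l₁ c * l₂ a)) • b
        + (r * (l₂ a * l₃ b - l₂ b * l₃ a) - s * (l₁ a * l₃ b - l₁ b * l₃ a)
          + t * (l₁ a * l₂ b - l₁ b * l₂ a)) • c), ?_⟩
    have hl : ∀ (l : E →L[ℝ] ℝ) (k p q r : ℝ), l (k • (p • a - q • b + r • c))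
        = k * (p * l a - q * l b + r * l c) := by
      intro l k p q r
      simp only [map_smul, map_add, map_sub, smul_eq_mul]
    rw [hL, hl, hl, hl]
    refine Prod.ext ?_ (Prod.ext ?_ ?_) <;>
    · rw [inv_mul_eq_iff_eq_mul₀ h]
      ring
  refine hi ?_
  rw [map_zero, hL, h₁, h₂, h₃]
  rfl

/-- In dimension three a vector annihilated by a coframe vanishes. -/
theorem eq_zero_of_coframe (hE : Module.finrank ℝ E = 3) {x : M}
    (h : wedge₁₂ ω₁ (wedge ω₂ η) x ≠ 0) {v : TangentSpace 𝓘(ℝ, E) x} (h₁ : ω₁ x v = 0)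
    (h₂ : ω₂ x v = 0) (h₃ : η x v = 0) : v = 0 := by
  have : ∃ a b c : E, wedge₁₂ ω₁ (wedge ω₂ η) x a b c ≠ 0 := by
    by_contra! h'
    exact h (funext fun a => funext fun b => funext fun c => h' a b c)
  obtain ⟨a, b, c, h⟩ := this
  exact eq_zero_of_det_ne_zero hE (l₁ := ω₁ x) (l₂ := ω₂ x) (l₃ := η x) h h₁ h₂ h₃

variable {S : Type*} [TopologicalSpace S] [ChartedSpace E2 S]
  [IsManifold 𝓘(ℝ, E2) ∞ S] {g : SurfaceMetric ε S}

/-- Near `x`, the map `f` to the orthonormal frame bundle is smooth and pulls the solder forms back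
to the given forms. -/
def IsFrameMapAt (ω₁ ω₂ : OneForm E M) (f : M → OFrame g) (x : M) : Prop :=
  ∀ᶠ z in 𝓝 x, ContMDiffAt 𝓘(ℝ, E) 𝓘(ℝ, E2 × ℝ) ∞ f z ∧
    pullback (E := E) f (OFrame.solder₁ g) z = ω₁ z ∧
    pullback (E := E) f (OFrame.solder₂ g) z = ω₂ z

variable [IsManifold 𝓘(ℝ, E) ∞ M]

/-- A frame map pulls the connection form back to the adapted form. -/
theorem IsFrameMapAt.exists_isAdaptedAt (hE : Module.finrank ℝ E = 3) (hω : IsContactForm ω₁)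
    {f : M → OFrame g} {x : M} (h : IsFrameMapAt ω₁ ω₂ f x) :
    ∃ η : OneForm E M, η.IsSmoothAt x ∧ (∀ᶠ z in 𝓝 x, IsAdaptedAt ε ω₁ ω₂ η z) ∧
      wedge₁₂ ω₁ (wedge ω₂ η) x ≠ 0 ∧
      η.d x = (-sgn ε * g.gaussCurvature (f x).pt) • wedge ω₁ ω₂ x ∧
      ∀ v, mfderiv 𝓘(ℝ, E) 𝓘(ℝ, E2 × ℝ) f x v = 0 → v = 0 := by
  obtain ⟨-, θ₃, hc, ha, hK, -⟩ := OFrame.hasStructureEquations_solder g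
  have hs₁ := OneForm.isSmooth_iff.1 hc.smooth₁
  have hs₂ := OneForm.isSmooth_iff.1 hc.smooth₂
  have hs₃ := OneForm.isSmooth_iff.1 hc.smooth₃
  have had : ∀ᶠ z in 𝓝 x, IsAdaptedAt ε ω₁ ω₂ (pullback (E := E) f θ₃) z := by
    filter_upwards [h.eventually_nhds] with z hz
    obtain ⟨hf, h₁, h₂⟩ := hz.self_of_nhds
    have e₁ := OneForm.d_congr (hz.mono fun y hy => hy.2.1.symm)
    have e₂ := OneForm.d_congr (hz.mono fun y hy => hy.2.2.symm)
    constructor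
    · refine e₁.trans (funext fun v => funext fun w => ?_)
      refine (d_pullback hf (hs₁ _) v w).trans ?_
      refine (congrFun (congrFun (congrFun ha.1 (f z)) _) _).trans ?_
      simp only [wedge]
      rw [← h₂]
      rfl
    · refine e₂.trans (funext fun v => funext fun w => ?_)
      refine (d_pullback hf (hs₂ _) v w).trans ?_
      refine (congrFun (congrFun (congrFun ha.2 (f z)) _) _).trans ?_
      simp only [Pi.smul_apply, wedge, smul_eq_mul]
      rw [← h₁]
      rfl
  obtain ⟨hf, h₁, h₂⟩ := h.self_of_nhds
  -- By the first structure equation this triple product is ω₁ ∧ dω₁, nonzero because ω₁ is contact.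
  -- Invertibility of the differential of f is not presupposed but deduced from it.
  have hnd : wedge₁₂ ω₁ (wedge ω₂ (pullback (E := E) f θ₃)) x ≠ 0 := by
    have e := had.self_of_nhds.1
    intro h0
    refine hω x ((funext fun a => funext fun b => funext fun c => ?_ : _ = _).trans h0)
    simp only [wedge₁₂, e]
  refine ⟨pullback (E := E) f θ₃, (hs₃ _).pullback hf, had, hnd, ?_, fun v hv => ?_⟩
  · refine funext fun v => funext fun w => ?_
    refine (d_pullback hf (hs₃ _) v w).trans ?_
    refine (congrFun (congrFun (hK (f x)) _) _).trans ?_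
    simp only [Pi.smul_apply, wedge, smul_eq_mul]
    rw [← h₁, ← h₂]
    rfl
  · refine eq_zero_of_coframe hE hnd ?_ ?_ ?_
    · rw [← h₁]
      exact (congrArg (OFrame.solder₁ g (f x)) hv).trans (map_zero _)
    · rw [← h₂]
      exact (congrArg (OFrame.solder₂ g (f x)) hv).trans (map_zero _)
    · exact (congrArg (θ₃ (f x)) hv).trans (map_zero _)

end FrameMap

/-! ### Local models and curvature of a Cartan structure -/

section CartanStructures

variable {E : Type*} [NormedAddCommGroup E] [NormedSpace ℝ E]
  {M : Type*} [TopologicalSpace M] [ChartedSpace E M] [IsManifold 𝓘(ℝ, E) ∞ M] {ε : ℤˣ}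
  {ω₁ ω₂ : OneForm E M}

/-- Around each point a Cartan structure is pulled back from the orthonormal frame bundle of a
metric on the plane. -/
theorem IsCartan.exists_isFrameMapAt (hE : Module.finrank ℝ E = 3) (h : IsCartan ε ω₁ ω₂) (p : M) :
    ∃ (g : SurfaceMetric ε E2) (f : M → OFrame g), IsFrameMapAt ω₁ ω₂ f p := by
  -- This form is chosen point by point and is not yet known to be smooth. Only its values enter
  -- below, and `FiberedForms` asks for no smoothness of its third form.
  obtain ⟨ω₃, ha⟩ := h.exists_isAdapted
  have hw := h.toIsBiContact.exists_wedge_ne_zero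
  have hs₁ := OneForm.isSmooth_iff.1 h.smooth₁
  have hs₂ := OneForm.isSmooth_iff.1 h.smooth₂
  obtain ⟨ψ, hψs, hp, hψ, hψi, hψk⟩ := exists_straightening hE h.smooth₁ h.smooth₂ p (hw p)
  have hψi' : ∀ x ∈ ψ.target, ContMDiffAt 𝓘(ℝ, E) 𝓘(ℝ, E2 × ℝ) ∞ ψ.symm x := fun x hx =>
    hψi.contMDiffAt (ψ.open_target.mem_nhds hx)
  have hback : ∀ (θ : OneForm E M), ∀ x ∈ ψ.target,
      pullback (E := E) ψ.symm (pullback (E := E2 × ℝ) ψ θ) x = θ x := by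
    intro θ x hx
    refine (pullback_comp θ ((hψ _).mdifferentiableAt (by simp))
      ((hψi' x hx).mdifferentiableAt (by simp))).symm.trans ?_
    refine pullback_id_of_eventuallyEq θ ?_
    filter_upwards [ψ.open_target.mem_nhds hx] with z hz using ψ.right_inv hz
  have H : FiberedForms ε (pullback (E := E2 × ℝ) ψ ω₁) (pullback (E := E2 × ℝ) ψ ω₂)
      (pullback (E := E2 × ℝ) ψ ω₃) := by
    refine ⟨?_, ?_, fun q => (hψk q).1, fun q => (hψk q).2, fun q v w => ?_, fun q v w => ?_,
      fun q => ?_⟩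
    · exact contDiff_iff_contDiffAt.2 fun q =>
        OneForm.isSmoothAt_model.1 ((hs₁ _).pullback (hψ q))
    · exact contDiff_iff_contDiffAt.2 fun q =>
        OneForm.isSmoothAt_model.1 ((hs₂ _).pullback (hψ q))
    · refine (OneForm.d_model (pullback (E := E2 × ℝ) ψ ω₁) q v w).symm.trans ?_
      refine (d_pullback (hψ q) (hs₁ _) v w).trans ?_
      exact congrFun (congrFun (congrFun ha.1 (ψ q)) _) _
    · refine (OneForm.d_model (pullback (E := E2 × ℝ) ψ ω₂) q v w).symm.trans ?_
      refine (d_pullback (hψ q) (hs₂ _) v w).trans ?_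
      exact congrFun (congrFun (congrFun ha.2 (ψ q)) _) _
    · have hq : q ∈ ψ.source := by rw [hψs]; exact mem_univ q
      obtain ⟨v, w, hvw⟩ := hw (ψ q)
      have hx := ψ.map_source hq
      have k₁ := hback ω₁ _ hx
      have k₂ := hback ω₂ _ hx
      have key : ∃ v w : E2 × ℝ, pullback (E := E2 × ℝ) ψ ω₁ (ψ.symm (ψ q)) v
            * pullback (E := E2 × ℝ) ψ ω₂ (ψ.symm (ψ q)) w
          - pullback (E := E2 × ℝ) ψ ω₁ (ψ.symm (ψ q)) w
            * pullback (E := E2 × ℝ) ψ ω₂ (ψ.symm (ψ q)) v ≠ 0 := by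
        refine ⟨mfderiv 𝓘(ℝ, E) 𝓘(ℝ, E2 × ℝ) ψ.symm (ψ q) v,
          mfderiv 𝓘(ℝ, E) 𝓘(ℝ, E2 × ℝ) ψ.symm (ψ q) w, fun h0 => hvw ?_⟩
        simp only [wedge]
        rw [← k₁, ← k₂]
        exact h0
      rwa [ψ.left_inv hq] at key
  refine ⟨H.metric, H.frame ∘ ψ.symm, ?_⟩
  have hF : ∀ q, MDifferentiableAt 𝓘(ℝ, E2 × ℝ) 𝓘(ℝ, E2 × ℝ) H.frame q := fun q =>
    (H.contMDiff_frame q).mdifferentiableAt (by simp)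
  filter_upwards [ψ.open_target.mem_nhds hp] with x hx
  have hd := (hψi' x hx).mdifferentiableAt (by simp)
  refine ⟨(H.contMDiff_frame _).comp x (hψi' x hx), ?_, ?_⟩
  · refine (pullback_comp (OFrame.solder₁ H.metric) (hF _) hd).trans ?_
    refine (pullback_congr_form (E := E) ψ.symm (H.pullback_frame_solder₁ (ψ.symm x))).trans ?_
    exact hback ω₁ x hx
  · refine (pullback_comp (OFrame.solder₂ H.metric) (hF _) hd).trans ?_
    refine (pullback_congr_form (E := E) ψ.symm (H.pullback_frame_solder₂ (ψ.symm x))).trans ?_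
    exact hback ω₂ x hx

variable {S : Type*} [TopologicalSpace S] [ChartedSpace E2 S]
  [IsManifold 𝓘(ℝ, E2) ∞ S] {g : SurfaceMetric ε S}
  {S' : Type*} [TopologicalSpace S'] [ChartedSpace E2 S']
  [IsManifold 𝓘(ℝ, E2) ∞ S'] {g' : SurfaceMetric ε S'}

/-- The curvature of the surface is determined by the forms. -/
theorem IsFrameMapAt.curvature_eq (hE : Module.finrank ℝ E = 3) (h : IsBiContact ω₁ ω₂)
    {f : M → OFrame g} {f' : M → OFrame g'} {x : M} (hf : IsFrameMapAt ω₁ ω₂ f x)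
    (hf' : IsFrameMapAt ω₁ ω₂ f' x) :
    -sgn ε * g.gaussCurvature (f x).pt = -sgn ε * g'.gaussCurvature (f' x).pt := by
  obtain ⟨η, -, ha, -, hK, -⟩ := hf.exists_isAdaptedAt hE h.contact₁
  obtain ⟨η', -, ha', -, hK', -⟩ := hf'.exists_isAdaptedAt hE h.contact₁
  -- Uniqueness of the adapted form on a neighbourhood, not only at x, makes the exterior
  -- derivatives equal.
  have hd : η.d x = η'.d x := by
    refine OneForm.d_congr ?_
    filter_upwards [ha, ha'] with z hz hz'
    exact hz.unique hz' (h.exists_wedge_ne_zero z)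
  obtain ⟨v, w, hvw⟩ := h.exists_wedge_ne_zero x
  rw [hK, hK'] at hd
  exact mul_right_cancel₀ hvw (congrFun (congrFun hd v) w)

/-- A frame map restricts to a bi-contactomorphism from a neighbourhood. -/
theorem IsFrameMapAt.exists_isBiContactomorphism (hE : Module.finrank ℝ E = 3)
    (h : IsBiContact ω₁ ω₂) {f : M → OFrame g} {p : M} (hf : IsFrameMapAt ω₁ ω₂ f p) :
    ∃ Φ : PartialDiffeomorph 𝓘(ℝ, E) 𝓘(ℝ, E2 × ℝ) M (OFrame g) ∞, p ∈ Φ.source ∧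
      IsBiContactomorphism Φ ω₁ ω₂ (OFrame.solder₁ g) (OFrame.solder₂ g) ∧
      ∀ x ∈ Φ.source, IsFrameMapAt ω₁ ω₂ Φ x := by
  have : FiniteDimensional ℝ E := Module.finite_of_finrank_pos (by omega)
  have : CompleteSpace E := FiniteDimensional.complete ℝ E
  have hequiv : ∀ {f : M → OFrame g} {x : M}, IsFrameMapAt ω₁ ω₂ f x →
      ∃ e : E ≃L[ℝ] E2 × ℝ, (e : E →L[ℝ] E2 × ℝ) = mfderiv 𝓘(ℝ, E) 𝓘(ℝ, E2 × ℝ) f x := by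
    intro f x hf
    obtain ⟨-, -, -, -, -, hi⟩ := hf.exists_isAdaptedAt hE h.contact₁
    exact exists_continuousLinearEquiv_of_injective (X := E) (Y := E2 × ℝ)
      (mfderiv 𝓘(ℝ, E) 𝓘(ℝ, E2 × ℝ) f x) hi (by rw [hE, finrank_E2_prod])
  obtain ⟨W, hWf, hW, hpW⟩ := eventually_nhds_iff.1 hf
  obtain ⟨e, he⟩ := hequiv hf
  obtain ⟨Φ, hp, hΦW, hΦf⟩ := exists_partialDiffeomorph hW hpW (fun x hx => (hWf x hx).1) he.symm
  have hΦ : ∀ x ∈ Φ.source, IsFrameMapAt ω₁ ω₂ Φ x := by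
    intro x hx
    have hn := Φ.open_source.mem_nhds hx
    filter_upwards [hn] with z hz
    have hzn : Φ =ᶠ[𝓝 z] f := by
      filter_upwards [Φ.open_source.mem_nhds hz] with y hy using hΦf hy
    obtain ⟨k₁, k₂, k₃⟩ := hWf z (hΦW hz)
    exact ⟨k₁.congr_of_eventuallyEq hzn, (pullback_congr _ hzn).trans k₂,
      (pullback_congr _ hzn).trans k₃⟩
  refine ⟨Φ, hp, fun x hx => ?_, hΦ⟩
  obtain ⟨e, he⟩ := hequiv (hΦ x hx)
  obtain ⟨-, k₁, k₂⟩ := (hΦ x hx).self_of_nhds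
  have hsurj : ∀ w : TangentSpace 𝓘(ℝ, E2 × ℝ) (Φ x), ∃ v : TangentSpace 𝓘(ℝ, E) x,
      mfderiv 𝓘(ℝ, E) 𝓘(ℝ, E2 × ℝ) Φ x v = w := fun w =>
    ⟨e.symm w, (DFunLike.congr_fun he.symm _).trans (e.apply_symm_apply w)⟩
  have key : ∀ {α : OneForm E M} {θ : OneForm (E2 × ℝ) (OFrame g)},
      pullback (E := E) Φ θ x = α x →
      (α x).ker.map (mfderiv 𝓘(ℝ, E) 𝓘(ℝ, E2 × ℝ) Φ x).toLinearMap = (θ (Φ x)).ker := by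
    intro α θ h'
    ext w
    constructor
    · rintro ⟨v, hv, rfl⟩
      have hv' : α x v = 0 := hv
      rw [← h'] at hv'
      exact hv'
    · intro hw
      obtain ⟨v, rfl⟩ := hsurj w
      refine ⟨v, ?_, rfl⟩
      change α x v = 0
      rw [← h']
      exact hw
  exact ⟨key k₁, key k₂⟩

/-- The structure equations of a Cartan structure, and its realisations on orthonormal frame
bundles. -/
theorem IsCartan.exists_hasStructureEquations (hE : Module.finrank ℝ E = 3)
    (h : IsCartan ε ω₁ ω₂) : ∃ K : M → ℝ, HasStructureEquations ε ω₁ ω₂ K ∧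
      ∀ p : M, ∃ (g : SurfaceMetric ε E2)
        (Φ : PartialDiffeomorph 𝓘(ℝ, E) 𝓘(ℝ, E2 × ℝ) M (OFrame g) ∞), p ∈ Φ.source ∧
        IsBiContactomorphism Φ ω₁ ω₂ (OFrame.solder₁ g) (OFrame.solder₂ g) ∧
        ∀ x ∈ Φ.source, pullback Φ (OFrame.solder₁ g) x = ω₁ x ∧
          pullback Φ (OFrame.solder₂ g) x = ω₂ x ∧
          K x = -sgn ε * g.gaussCurvature (Φ x).pt := by
  choose g f hf using h.exists_isFrameMapAt hE
  -- K is read off at each x from a model chosen for that x alone. Local gluing gives its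
  -- smoothness, and `IsFrameMapAt.curvature_eq` compares it with the single model used around p.
  refine ⟨fun x => -sgn ε * (g x).gaussCurvature (f x x).pt, ?_, fun p => ?_⟩
  · refine hasStructureEquations_of_local h.smooth₁ h.smooth₂ fun x => ?_
    obtain ⟨η, h₁, h₂, h₃, h₄, -⟩ := (hf x).exists_isAdaptedAt hE h.contact₁
    exact ⟨η, h₁, h₂, h₃, h₄⟩
  · obtain ⟨Φ, hp, hb, hΦ⟩ := (hf p).exists_isBiContactomorphism hE h.toIsBiContact
    refine ⟨g p, Φ, hp, hb, fun x hx => ?_⟩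
    obtain ⟨-, k₁, k₂⟩ := (hΦ x hx).self_of_nhds
    exact ⟨k₁, k₂, (hf x).curvature_eq hE h.toIsBiContact (hΦ x hx)⟩

end CartanStructures

end BiContact

end

theorem mainTheorem2 (ε : ℤˣ) :
    (∀ (E : Type*) [NormedAddCommGroup E] [NormedSpace ℝ E] (_ : Module.finrank ℝ E = 3)
      (M : Type*) [TopologicalSpace M] [ChartedSpace E M] [IsManifold 𝓘(ℝ, E) ∞ M]
      (ω₁ ω₂ : BiContact.OneForm E M), BiContact.IsCartan ε ω₁ ω₂ →
      ∃ K : M → ℝ, BiContact.HasStructureEquations ε ω₁ ω₂ K ∧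
        ∀ p : M, ∃ (S : Type) (_ : TopologicalSpace S) (_ : T2Space S)
          (_ : SecondCountableTopology S) (_ : ChartedSpace BiContact.E2 S)
          (_ : IsManifold 𝓘(ℝ, BiContact.E2) ∞ S) (g : BiContact.SurfaceMetric ε S)
          (Φ : PartialDiffeomorph 𝓘(ℝ, E) 𝓘(ℝ, BiContact.E2 × ℝ) M (BiContact.OFrame g) ∞),
          p ∈ Φ.source ∧
          BiContact.IsBiContactomorphism Φ ω₁ ω₂ (BiContact.OFrame.solder₁ g)
            (BiContact.OFrame.solder₂ g) ∧
          ∀ x ∈ Φ.source,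
            BiContact.pullback Φ (BiContact.OFrame.solder₁ g) x = ω₁ x ∧
            BiContact.pullback Φ (BiContact.OFrame.solder₂ g) x = ω₂ x ∧
            K x = -BiContact.sgn ε * g.gaussCurvature (Φ x).pt) ∧
    (∀ (S : Type*) [TopologicalSpace S] [T2Space S] [SecondCountableTopology S]
      [ChartedSpace BiContact.E2 S] [IsManifold 𝓘(ℝ, BiContact.E2) ∞ S]
      (g : BiContact.SurfaceMetric ε S),
      BiContact.IsCartan ε (BiContact.OFrame.solder₁ g) (BiContact.OFrame.solder₂ g) ∧
      (∀ (u : BiContact.OFrame g) (v w : TangentSpace 𝓘(ℝ, BiContact.E2 × ℝ) u),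
        g.inner u.pt
            (mfderiv 𝓘(ℝ, BiContact.E2 × ℝ) 𝓘(ℝ, BiContact.E2) BiContact.OFrame.pt u v)
            (mfderiv 𝓘(ℝ, BiContact.E2 × ℝ) 𝓘(ℝ, BiContact.E2) BiContact.OFrame.pt u w) =
          BiContact.OFrame.solder₁ g u v * BiContact.OFrame.solder₁ g u w
            - BiContact.sgn ε * (BiContact.OFrame.solder₂ g u v * BiContact.OFrame.solder₂ g u w)) ∧
      BiContact.HasStructureEquations ε (BiContact.OFrame.solder₁ g) (BiContact.OFrame.solder₂ g)
        (fun u => -BiContact.sgn ε * g.gaussCurvature u.pt)) := by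
  refine ⟨fun E _ _ hE M _ _ _ ω₁ ω₂ h => ?_, fun S _ _ _ _ _ g =>
    ⟨BiContact.OFrame.isCartan_solder g, BiContact.OFrame.inner_mfderiv_pt,
      BiContact.OFrame.hasStructureEquations_solder g⟩⟩
  obtain ⟨K, hK, h'⟩ := h.exists_hasStructureEquations hE
  refine ⟨K, hK, fun p => ?_⟩
  obtain ⟨g, Φ, hΦ⟩ := h' p
  -- Every local model lives on the plane, so one surface serves for all points, with a metric
  -- depending on p.
  exact ⟨BiContact.E2, inferInstance, inferInstance, inferInstance, inferInstance, inferInstance,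
    g, Φ, hΦ⟩
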